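/- **Drury's identity with explicit constant.** Let $d\ge 2$ and $1\le k\le d-1$ be integers. For an integer $n\ge 0$ and $z\in\mathbb{C}$ put $$\gamma_n(z)=\prod_{j=0}^{n-1}\frac{\Gamma\big(\tfrac{z-j}{2}\big)}{2\pi^{(z-j)/2}},\qquad \mathbf{D}_{d,k}=\frac{1}{\gamma_k(k)\,\gamma_{d-k}(d-k)},$$ and for $x=(x_1,\dots,x_{d+1})\in(\mathbb{R}^d)^{d+1}$ let $$\rho(x)=\det\begin{pmatrix}1&\cdots&1\\ x_1&\cdots&x_{d+1}\end{pmatrix}.$$ Let $\mathcal{G}_{d,k}$ be the Grassmannian of $k$-dimensional linear subspaces of $\mathbb{R}^d$, with its $O(d)$-invariant measure $\mu_{\mathcal G}$ normalised by $$\mu_{\mathcal G}(\mathcal{G}_{d,k})=\frac{|\mathbb{S}^{d-1}|\cdots|\mathbb{S}^{d-k}|}{|\mathbb{S}^{k-1}|\cdots|\mathbb{S}^{0}|},$$ where $|\mathbb{S}^n|$ is the surface area of the unit $n$-sphere. Let $\mathcal{M}_{d,k}$ be the manifold of $k$-dimensional affine subspaces of $\mathbb{R}^d$, with the measure $\mu_{\mathcal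 M}$ given by $$\int_{\mathcal{M}_{d,k}}F\,d\mu_{\mathcal M}=\int_{\mathcal{G}_{d,k}}\int_{W^\perp}F(x+W)\,dx\,d\mu_{\mathcal G}(W),$$ $dx$ being Lebesgue measure on $W^\perp$. For $\Pi\in\mathcal{M}_{d,k}$ let $T_{d,k}f(\Pi)=\int_\Pi f$, the integral of $f$ over $\Pi$ with respect to $k$-dimensional Lebesgue measure on $\Pi$. Then there is exactly one family $(A_s)_{s\in\mathbb{C}}$ of tempered distributions on $(\mathbb{R}^d)^{d+1}$ such that $s\mapsto\langle A_s,\varphi\rangle$ is entire for every Schwartz function $\varphi$ and, whenever $\operatorname{Re}s>d-1$, $$\langle A_s,\varphi\rangle=\frac{1}{\gamma_d(s)}\int_{(\mathbb{R}^d)^{d+1}}|\rho(x)|^{-d+s}\varphi(x)\,dx$$ (with absolutely convergent integral); and for all Schwartz functions $f_1,\dots,f_{d+1}:\mathbb{R}^d\to\mathbb{C}$ the function $\Pi\mapsto\prod_{i=1}^{d+1}T_{d,k}f_i(\Pi)$ is $\mu_{\mathcal M}$-integrable and $$\langle A_k,f_1\otimes\cdots\otimes f_{d+1}\rangle=\mathbf{D}_{d,k}\int_{\mathcal{M}_{d,k}}\prod_{i=1}^{d+1}T_{d,k}f_i(\Pi)\,d\mu_{\mathcal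 M}(\Pi).$$ -/

import Mathlib

open MeasureTheory Set
open scoped SchwartzMap ContDiff

noncomputable section

namespace Drury

/-- Euclidean space `ℝ^d`. -/
abbrev E (d : ℕ) : Type := EuclideanSpace ℝ (Fin d)

/-! ### Constants -/

/-- `γ_n(z) = ∏_{j=0}^{n-1} Γ((z-j)/2) / (2 π^{(z-j)/2})`. -/
def gam (n : ℕ) (z : ℂ) : ℂ :=
  ∏ j ∈ Finset.range n,
    1 / (2 * (Real.pi : ℂ) ^ ((z - j) / 2)) * Complex.Gamma ((z - j) / 2)

/-- `D_{d,k} = 1 / (γ_k(k) γ_{d-k}(d-k))`. -/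
def constD (d k : ℕ) : ℂ := 1 / (gam k k * gam (d - k) ((d - k : ℕ) : ℂ))

/-- The surface area `|𝕊^n|` of the unit sphere of `ℝ^{n+1}`. -/
def sphereArea (n : ℕ) : ℝ := (volume : Measure (E (n + 1))).toSphere.real univ

/-! ### The Grassmannian and its invariant measure -/

/-- The Grassmannian of `k`-dimensional linear subspaces of `ℝ^d`. -/
structure Grass (d k : ℕ) where
  /-- the underlying subspace -/
  space : Submodule ℝ (E d)
  finrank_space : Module.finrank ℝ space = k

/-- The usual topology: `W` is identified with the orthogonal projection onto `W`. -/
instance (d k : ℕ) : TopologicalSpace (Grass d k) :=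
  TopologicalSpace.induced (fun W => (W.space.starProjection : E d →L[ℝ] E d)) inferInstance

instance (d k : ℕ) : MeasurableSpace (Grass d k) := borel _

instance (d k : ℕ) : BorelSpace (Grass d k) := ⟨rfl⟩

/-- The orthogonal group `O(d)`. -/
abbrev Orth (d : ℕ) : Type := Matrix.orthogonalGroup (Fin d) ℝ

instance (d : ℕ) : MeasurableSpace (Orth d) := borel _

instance (d : ℕ) : BorelSpace (Orth d) := ⟨rfl⟩

instance (d : ℕ) : CompactSpace (Orth d) := by
  have hc : IsClosed (unitary (Matrix (Fin d) (Fin d) ℝ) : Set (Matrix (Fin d) (Fin d) ℝ)) :=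
    isClosed_unitary
  have hK : IsCompact {M : Matrix (Fin d) (Fin d) ℝ | ∀ i, M i ∈ {v : Fin d → ℝ | ∀ j,
      v j ∈ Icc (-1 : ℝ) 1}} :=
    isCompact_pi_infinite fun _ => isCompact_pi_infinite fun _ => isCompact_Icc
  refine isCompact_iff_compactSpace.mp (hK.of_isClosed_subset hc ?_)
  intro U hU i j
  have h := entry_norm_bound_of_unitary (𝕜 := ℝ) (U := U) hU i j
  exact abs_le.mp h

lemma orth_injective {d : ℕ} (U : Orth d) :
    Function.Injective (Matrix.toEuclideanLin (U : Matrix (Fin d) (Fin d) ℝ)) := by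
  have h : star (U : Matrix (Fin d) (Fin d) ℝ) * (U : Matrix (Fin d) (Fin d) ℝ) = 1 :=
    Unitary.star_mul_self_of_mem U.2
  intro x y hxy
  have h2 : (U : Matrix (Fin d) (Fin d) ℝ).mulVec x.ofLp
      = (U : Matrix (Fin d) (Fin d) ℝ).mulVec y.ofLp := by
    have := congrArg WithLp.ofLp hxy
    simpa [Matrix.toLpLin_apply] using this
  have h3 := congrArg (fun v => (star (U : Matrix (Fin d) (Fin d) ℝ)).mulVec v) h2
  simp only [Matrix.mulVec_mulVec, h, Matrix.one_mulVec] at h3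
  exact WithLp.ofLp_injective _ h3

/-- The action `(U, W) ↦ U W` of `O(d)` on the Grassmannian. -/
def rot {d k : ℕ} (U : Orth d) (W : Grass d k) : Grass d k :=
  ⟨W.space.map (Matrix.toEuclideanLin (U : Matrix (Fin d) (Fin d) ℝ)), by
    exact (LinearEquiv.finrank_eq (Submodule.equivMapOfInjective _
      (orth_injective U) W.space)).symm.trans W.finrank_space⟩

/-- The coordinate plane spanned by the first `k` vectors of the standard basis. -/
def coordPlane (d k : ℕ) (hk : k ≤ d) : Grass d k :=
  ⟨Submodule.span ℝ (range fun i : Fin k => EuclideanSpace.basisFun (Fin d) ℝ (Fin.castLE hk i)), by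
    have h : LinearIndependent ℝ
        (fun i : Fin k => EuclideanSpace.basisFun (Fin d) ℝ (Fin.castLE hk i)) :=
      (EuclideanSpace.basisFun (Fin d) ℝ).orthonormal.linearIndependent.comp _
        (Fin.castLE_injective hk)
    simpa using finrank_span_eq_card h⟩

/-- The total mass `|𝕊^{d-1}| ⋯ |𝕊^{d-k}| / (|𝕊^{k-1}| ⋯ |𝕊^0|)`. -/
def grassMass (d k : ℕ) : ℝ :=
  (∏ i ∈ Finset.range k, sphereArea (d - 1 - i)) / ∏ i ∈ Finset.range k, sphereArea i

/-- The `O(d)`-invariant measure on the Grassmannian, with total mass `grassMass d k`: the image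
of Haar measure on `O(d)` under an orbit map, suitably scaled. -/
def muG (d k : ℕ) (hk : k ≤ d) : Measure (Grass d k) :=
  ENNReal.ofReal (grassMass d k) •
    (Measure.haarMeasure (⊤ : TopologicalSpace.PositiveCompacts (Orth d))).map
      (fun U => rot U (coordPlane d k hk))

/-! ### The manifold of affine planes and the `k`-plane transform -/

/-- The set of all `k`-dimensional affine subspaces of `ℝ^d`. -/
structure AffGrass (d k : ℕ) where
  /-- the underlying affine subspace -/
  space : AffineSubspace ℝ (E d)
  nonempty : (space : Set (E d)).Nonempty
  finrank_direction : Module.finrank ℝ space.direction = k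

/-- The affine plane `x + W`. -/
def translate {d k : ℕ} (W : Grass d k) (x : E d) : AffGrass d k :=
  ⟨AffineSubspace.mk' x W.space, ⟨x, AffineSubspace.self_mem_mk' x W.space⟩, by
    rw [AffineSubspace.direction_mk']; exact W.finrank_space⟩

/-- The point of an affine plane that is closest to the origin. -/
def foot {d k : ℕ} (P : AffGrass d k) : E d :=
  haveI : Nonempty P.space := P.nonempty.to_subtype
  (EuclideanGeometry.orthogonalProjection P.space 0 : P.space)

/-- The usual topology: an affine plane is identified with the pair formed by the orthogonal
projection onto its direction and its point closest to the origin. -/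
instance (d k : ℕ) : TopologicalSpace (AffGrass d k) :=
  TopologicalSpace.induced
    (fun P => ((P.space.direction.starProjection : E d →L[ℝ] E d), foot P)) inferInstance

instance (d k : ℕ) : MeasurableSpace (AffGrass d k) := borel _

instance (d k : ℕ) : BorelSpace (AffGrass d k) := ⟨rfl⟩

/-- The uniform measure on the manifold of affine `k`-planes: `W` is distributed according to
`muG`, and, given `W`, the plane is `x + W` with `x` distributed according to Lebesgue measure on
the orthogonal complement of `W`. -/
def muM (d k : ℕ) (hk : k ≤ d) : Measure (AffGrass d k) :=
  (muG d k hk).bind fun W =>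
    (volume : Measure (W.spaceᗮ : Submodule ℝ (E d))).map
      fun x : (W.spaceᗮ : Submodule ℝ (E d)) => translate W (x : E d)

/-- The `k`-plane transform `T_{d,k} f(P) = ∫_P f`, the integral being with respect to
`k`-dimensional Lebesgue measure on the plane `P`. -/
def planeTransform {d k : ℕ} (f : E d → ℂ) (P : AffGrass d k) : ℂ :=
  ∫ x in (P.space : Set (E d)), f x ∂(Measure.euclideanHausdorffMeasure k)

/-! ### The family of distributions -/

/-- `ρ(x_1, …, x_{d+1})`: the determinant of the matrix whose `j`-th column is `(1, x_j)`. -/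
def rho {d : ℕ} (x : Fin (d + 1) → E d) : ℝ :=
  Matrix.det (Matrix.of fun i j : Fin (d + 1) => Fin.cases (1 : ℝ) (fun a => x j a) i)

/-- `A` is the analytic family of tempered distributions `A_s = γ_d(s)⁻¹ |ρ|^{-d+s}`: it is given
by this locally integrable function when `Re s > d - 1`, and `s ↦ ⟨A_s, φ⟩` is entire for each
Schwartz function `φ`. -/
structure IsRhoFamily (d : ℕ) (A : ℂ → 𝓢'(Fin (d + 1) → E d, ℂ)) : Prop where
  entire : ∀ φ : 𝓢(Fin (d + 1) → E d, ℂ), Differentiable ℂ fun s => A s φ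
  integrable : ∀ s : ℂ, (d : ℝ) - 1 < s.re → ∀ φ : 𝓢(Fin (d + 1) → E d, ℂ),
    Integrable fun x => ((|rho x| : ℝ) : ℂ) ^ (-(d : ℂ) + s) * φ x
  eq_integral : ∀ s : ℂ, (d : ℝ) - 1 < s.re → ∀ φ : 𝓢(Fin (d + 1) → E d, ℂ),
    A s φ = 1 / gam d s * ∫ x, ((|rho x| : ℝ) : ℂ) ^ (-(d : ℂ) + s) * φ x

/-- The derivatives of `x ↦ f (x i)` are controlled by those of `f`. -/
lemma norm_iteratedFDeriv_comp_proj_le {d : ℕ} (f : 𝓢(E d, ℂ)) (i : Fin (d + 1)) (m : ℕ)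
    (x : Fin (d + 1) → E d) :
    ‖iteratedFDeriv ℝ m (fun x : Fin (d + 1) → E d => f (x i)) x‖ ≤
      ‖iteratedFDeriv ℝ m f (x i)‖ := by
  set L : (Fin (d + 1) → E d) →L[ℝ] E d := ContinuousLinearMap.proj i
  have h := L.iteratedFDeriv_comp_right (f := f) (f.smooth m) x (i := m) le_rfl
  have hL : ‖L‖ ≤ 1 := ContinuousLinearMap.opNorm_le_bound _ zero_le_one fun y => by
    simpa [L] using norm_le_pi_norm y i
  have hfun : (fun x : Fin (d + 1) → E d => f (x i)) = f ∘ L := rfl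
  rw [hfun, h]
  refine (ContinuousMultilinearMap.norm_compContinuousLinearMap_le _ _).trans ?_
  refine mul_le_of_le_one_right (norm_nonneg _) ?_
  exact Finset.prod_le_one (fun _ _ => norm_nonneg _) fun _ _ => hL

lemma contDiff_comp_proj {d : ℕ} (f : 𝓢(E d, ℂ)) (i : Fin (d + 1)) (n : ℕ∞) :
    ContDiff ℝ n (fun x : Fin (d + 1) → E d => f (x i)) :=
  (f.smooth n).comp (contDiff_apply ℝ (E d) i)

/-- The Schwartz function `f_1 ⊗ ⋯ ⊗ f_{d+1}` on `(ℝ^d)^{d+1}`. -/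
def tensor {d : ℕ} (f : Fin (d + 1) → 𝓢(E d, ℂ)) : 𝓢(Fin (d + 1) → E d, ℂ) where
  toFun x := ∏ i, f i (x i)
  smooth' := contDiff_prod fun i _ => contDiff_comp_proj (f i) i ⊤
  decay' := by
    intro p n
    choose C hC using fun (i : Fin (d + 1)) (q m : ℕ) => (f i).decay q m
    set B : Fin (d + 1) → ℕ → ℝ := fun i m => (C i 0 m) + (C i p m) with hB
    have hC0 : ∀ i q m, 0 ≤ C i q m := fun i q m => (hC i q m).1.le
    have h0 : ∀ i m y, ‖iteratedFDeriv ℝ m (f i) y‖ ≤ B i m := fun i m y => by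
      have := (hC i 0 m).2 y
      have h2 := hC0 i p m
      simp only [pow_zero, one_mul] at this
      simp only [hB]; linarith
    have h1 : ∀ i m y, ‖y‖ ^ p * ‖iteratedFDeriv ℝ m (f i) y‖ ≤ B i m := fun i m y => by
      have := (hC i p m).2 y
      have h2 := hC0 i 0 m
      simp only [hB]; linarith
    refine ⟨∑ q ∈ (Finset.univ : Finset (Fin (d + 1))).sym n,
      ((q : Multiset (Fin (d + 1))).countPerms : ℝ) *
        ∏ j, B j ((q : Multiset (Fin (d + 1))).count j), fun x => ?_⟩
    have hprod := norm_iteratedFDeriv_prod_le (𝕜 := ℝ) (u := (Finset.univ : Finset (Fin (d + 1))))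
      (f := fun j (x : Fin (d + 1) → E d) => f j (x j)) (N := n) (n := n) (x := x)
      (fun i _ => contDiff_comp_proj (f i) i n) le_rfl
    obtain ⟨i₀, hi₀⟩ : ∃ i, ‖x‖ = ‖x i‖ := by
      obtain ⟨i, -, hi⟩ := Finset.exists_mem_eq_sup' (Finset.univ_nonempty (α := Fin (d + 1)))
        (fun i => ‖x i‖)
      refine ⟨i, le_antisymm ?_ (norm_le_pi_norm x i)⟩
      refine (pi_norm_le_iff_of_nonneg (norm_nonneg _)).2 fun j => ?_
      rw [← hi]
      exact Finset.le_sup' (fun i => ‖x i‖) (Finset.mem_univ j)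
    refine (mul_le_mul_of_nonneg_left hprod (by positivity)).trans ?_
    rw [Finset.mul_sum]
    refine Finset.sum_le_sum fun q _ => ?_
    rw [mul_left_comm]
    refine mul_le_mul_of_nonneg_left ?_ (by positivity)
    rw [← Finset.mul_prod_erase _ _ (Finset.mem_univ i₀),
      ← Finset.mul_prod_erase _ _ (Finset.mem_univ i₀), ← mul_assoc]
    refine mul_le_mul ?_ ?_ (Finset.prod_nonneg fun _ _ => norm_nonneg _)
      (add_nonneg (hC0 _ _ _) (hC0 _ _ _))
    · rw [hi₀]
      exact (mul_le_mul_of_nonneg_left (norm_iteratedFDeriv_comp_proj_le (f i₀) i₀ _ x)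
        (by positivity)).trans (h1 _ _ _)
    · exact Finset.prod_le_prod (fun _ _ => norm_nonneg _) fun j _ =>
        (norm_iteratedFDeriv_comp_proj_le (f j) j _ x).trans (h0 _ _ _)

end Drury

end

open MeasureTheory Set
open scoped SchwartzMap ContDiff

noncomputable section

namespace Drury

open Filter Topology FourierTransform SchwartzMap ProbabilityTheory
open scoped RealInnerProductSpace ENNReal NNReal

/-! ### The partial Fourier transform of Schwartz functions -/

lemma norm_iteratedDeriv_cexp_mul_I (n : ℕ) (t : ℝ) :
    ‖iteratedDeriv n (fun t : ℝ => Complex.exp (t * Complex.I)) t‖ = 1 := by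
  have h : ∀ n : ℕ, iteratedDeriv n (fun t : ℝ => Complex.exp (t * Complex.I)) =
      fun t : ℝ => Complex.I ^ n * Complex.exp (t * Complex.I) := by
    intro n
    induction n with
    | zero => simp
    | succ n ih =>
      rw [iteratedDeriv_succ, ih]
      ext t
      have h1 : HasDerivAt (fun t : ℝ => Complex.exp (t * Complex.I))
          (Complex.exp (t * Complex.I) * (1 * Complex.I)) t :=
        ((Complex.ofRealCLM.hasDerivAt (x := t)).mul_const Complex.I).cexp
      rw [(h1.const_mul _).deriv]
      ring
  rw [h]
  simp [Complex.norm_exp_ofReal_mul_I]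

lemma hasTemperateGrowth_cexp_mul_I :
    Function.HasTemperateGrowth (fun t : ℝ => Complex.exp (t * Complex.I)) := by
  refine ⟨?_, fun n => ⟨0, 1, fun t => ?_⟩⟩
  · exact Complex.contDiff_exp.comp (Complex.ofRealCLM.contDiff.mul contDiff_const)
  · rw [norm_iteratedFDeriv_eq_norm_iteratedDeriv, norm_iteratedDeriv_cexp_mul_I]
    simp

section Partial

variable {V H : Type*} [NormedAddCommGroup V] [InnerProductSpace ℝ V]
  [NormedAddCommGroup H] [InnerProductSpace ℝ H]

lemma hasTemperateGrowth_chirp (c : ℝ) (P : H →L[ℝ] V) :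
    Function.HasTemperateGrowth
      (fun y : H => Complex.exp ((c * ‖P y‖ ^ 2 : ℝ) * Complex.I)) := by
  have h1 : Function.HasTemperateGrowth (fun y : H => c * ‖P y‖ ^ 2) :=
    (Function.HasTemperateGrowth.const c).mul
      ((Function.hasTemperateGrowth_norm_sq V).comp P.hasTemperateGrowth)
  exact hasTemperateGrowth_cexp_mul_I.comp h1

/-- The restriction of a Schwartz function to an affine subspace. -/
def slice (ι : V →ₗᵢ[ℝ] H) (y : H) : 𝓢(H, ℂ) →L[ℂ] 𝓢(V, ℂ) :=
  compCLMOfAntilipschitz (K := 1) ℂ (g := fun x : V => y - ι x)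
    ((Function.HasTemperateGrowth.const y).sub ι.toContinuousLinearMap.hasTemperateGrowth)
    (AntilipschitzWith.of_le_mul_dist fun a b => by
      rw [dist_sub_left, ι.dist_map]; simp)

lemma slice_apply (ι : V →ₗᵢ[ℝ] H) (y : H) (φ : 𝓢(H, ℂ)) (x : V) :
    slice ι y φ x = φ (y - ι x) := rfl

variable [FiniteDimensional ℝ V] [MeasurableSpace V] [BorelSpace V]
  [FiniteDimensional ℝ H] [MeasurableSpace H] [BorelSpace H]

/-- The partial Fourier transform along the subspace `ι V` of `H`, where `P` is the adjoint of the
isometric embedding `ι`; see `partialFourier_apply`. -/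
def partialFourier (P : H →L[ℝ] V) : 𝓢(H, ℂ) →L[ℂ] 𝓢(H, ℂ) :=
  (Complex.I ^ (Module.finrank ℝ V / 2 : ℂ)) •
    (smulLeftCLM ℂ (fun y : H => Complex.exp ((-Real.pi * ‖P y‖ ^ 2 : ℝ) * Complex.I)) ∘L
      (fourierMultiplierCLM ℂ
        (fun y : H => Complex.exp ((-Real.pi * ‖P y‖ ^ 2 : ℝ) * Complex.I))) ∘L
      smulLeftCLM ℂ (fun y : H => Complex.exp ((-Real.pi * ‖P y‖ ^ 2 : ℝ) * Complex.I)))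

lemma fourierInv_gaussian_mul (ι : V →ₗᵢ[ℝ] H) (P : H →L[ℝ] V) (h : ∀ x y, ⟪ι x, y⟫ = ⟪x, P y⟫)
    (b : ℂ) (hb : 0 < b.re) (φ : 𝓢(H, ℂ)) (y : H) :
    ∫ ξ : H, Complex.exp ((2 * Real.pi * ⟪ξ, y⟫ : ℝ) * Complex.I) *
        (((Real.pi / b) ^ (Module.finrank ℝ V / 2 : ℂ) *
          Complex.exp (-Real.pi ^ 2 * ‖P ξ‖ ^ 2 / b)) * 𝓕 φ ξ) =
      ∫ x : V, Complex.exp (-b * ‖x‖ ^ 2) * φ (y - ι x) := by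
  have hg : Integrable (fun x : V => Complex.exp (-b * ‖x‖ ^ 2)) := by
    simpa using GaussianFourier.integrable_cexp_neg_mul_sq_norm_add hb 0 (0 : V)
  have hF : Integrable (fun ξ : H => 𝓕 φ ξ) := (𝓕 φ).integrable
  have h1 : ∀ ξ : H, Complex.exp ((2 * Real.pi * ⟪ξ, y⟫ : ℝ) * Complex.I) *
        (((Real.pi / b) ^ (Module.finrank ℝ V / 2 : ℂ) *
          Complex.exp (-Real.pi ^ 2 * ‖P ξ‖ ^ 2 / b)) * 𝓕 φ ξ) =
      ∫ x : V, Complex.exp (-b * ‖x‖ ^ 2) *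
        (Complex.exp ((2 * Real.pi * ⟪ξ, y - ι x⟫ : ℝ) * Complex.I) * 𝓕 φ ξ) := by
    intro ξ
    rw [← fourier_gaussian_innerProductSpace hb (P ξ), Real.fourier_eq', ← mul_assoc,
      ← integral_const_mul, ← integral_mul_const]
    refine integral_congr_ae (Eventually.of_forall fun x => ?_)
    simp only [smul_eq_mul]
    have : ⟪ξ, y - ι x⟫ = ⟪ξ, y⟫ - ⟪x, P ξ⟫ := by
      rw [inner_sub_right, real_inner_comm (ι x) ξ, h]
    rw [this]
    have e : Complex.exp ((2 * Real.pi * (⟪ξ, y⟫ - ⟪x, P ξ⟫) : ℝ) * Complex.I) =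
        Complex.exp ((2 * Real.pi * ⟪ξ, y⟫ : ℝ) * Complex.I) *
          Complex.exp ((-2 * Real.pi * ⟪x, P ξ⟫ : ℝ) * Complex.I) := by
      rw [← Complex.exp_add]; congr 1; push_cast; ring
    rw [e]
    ring
  simp_rw [h1]
  rw [integral_integral_swap]
  · refine integral_congr_ae (Eventually.of_forall fun x => ?_)
    simp only
    rw [integral_const_mul]
    congr 1
    have h2 : (𝓕⁻ (𝓕 φ)) (y - ι x) = φ (y - ι x) := by
      rw [FourierTransform.fourierInv_fourier_eq]
    rw [← h2, fourierInv_coe, Real.fourierInv_eq']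
    rfl
  · have h3 := hF.mul_prod hg
    refine (h3.bdd_mul (f := fun p : H × V =>
      Complex.exp ((2 * Real.pi * ⟪p.1, y - ι p.2⟫ : ℝ) * Complex.I)) (c := 1) ?_ ?_).congr ?_
    · exact Continuous.aestronglyMeasurable (by fun_prop)
    · exact Eventually.of_forall fun p => (Complex.norm_exp_ofReal_mul_I _).le
    · refine Eventually.of_forall fun p => ?_
      simp only [Function.uncurry]
      ring

/-- The partial convolution with a chirp as a Fourier multiplier. -/
lemma fourierMultiplier_chirp (ι : V →ₗᵢ[ℝ] H) (P : H →L[ℝ] V) (h : ∀ x y, ⟪ι x, y⟫ = ⟪x, P y⟫)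
    (φ : 𝓢(H, ℂ)) (y : H) :
    Complex.I ^ (Module.finrank ℝ V / 2 : ℂ) * fourierMultiplierCLM ℂ
        (fun y : H => Complex.exp ((-Real.pi * ‖P y‖ ^ 2 : ℝ) * Complex.I)) φ y =
      ∫ x : V, Complex.exp ((Real.pi * ‖x‖ ^ 2 : ℝ) * Complex.I) * φ (y - ι x) := by
  have hchirp := hasTemperateGrowth_chirp (-Real.pi) P
  rw [fourierMultiplierCLM_apply, fourierInv_coe, Real.fourierInv_eq', ← integral_const_mul]
  set z : ℝ → ℂ := fun δ => (δ : ℂ) + Complex.I with hz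
  have hz0 : ∀ δ : ℝ, 0 < δ → 0 < (z δ).re := fun δ hδ => by simp [hz, hδ]
  have hzne : ∀ δ : ℝ, 0 < δ → z δ ≠ 0 := fun δ hδ h0 => by
    have := hz0 δ hδ; rw [h0] at this; simp at this
  have hb : ∀ δ : ℝ, 0 < δ → 0 < (Real.pi / z δ).re := fun δ hδ => by
    rw [div_eq_mul_inv, Complex.re_ofReal_mul, Complex.inv_re]
    exact mul_pos Real.pi_pos (div_pos (hz0 δ hδ) (Complex.normSq_pos.2 (hzne δ hδ)))
  have hzt : Tendsto z (𝓝[>] 0) (𝓝 Complex.I) := by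
    have : Continuous z := by fun_prop
    have h2 := this.tendsto 0
    simp only [hz, Complex.ofReal_zero, zero_add] at h2
    exact h2.mono_left nhdsWithin_le_nhds
  have hkey : ∀ δ : ℝ, 0 < δ → _ := fun δ hδ =>
    fourierInv_gaussian_mul ι P h (Real.pi / z δ) (hb δ hδ) φ y
  have hpz : ∀ δ : ℝ, 0 < δ → (Real.pi : ℂ) / (Real.pi / z δ) = z δ := fun δ hδ => by
    have := hzne δ hδ
    have := Real.pi_ne_zero
    field_simp
  have hcp : ContinuousAt (fun w : ℂ => w ^ (Module.finrank ℝ V / 2 : ℂ)) Complex.I :=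
    continuousAt_id.cpow continuousAt_const (by simp [Complex.slitPlane])
  have hcpt := hcp.tendsto.comp hzt
  have hbd : ∀ᶠ δ in 𝓝[>] (0 : ℝ), ‖z δ ^ (Module.finrank ℝ V / 2 : ℂ)‖ ≤
      ‖Complex.I ^ (Module.finrank ℝ V / 2 : ℂ)‖ + 1 := by
    have := hcpt.norm.eventually (gt_mem_nhds (lt_add_one _))
    filter_upwards [this] with δ hδ using hδ.le
  have hpos : ∀ᶠ δ in 𝓝[>] (0 : ℝ), 0 < δ := self_mem_nhdsWithin
  have hL : Tendsto (fun δ : ℝ =>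
      ∫ ξ : H, Complex.exp ((2 * Real.pi * ⟪ξ, y⟫ : ℝ) * Complex.I) *
        (((Real.pi / (Real.pi / z δ)) ^ (Module.finrank ℝ V / 2 : ℂ) *
          Complex.exp (-Real.pi ^ 2 * ‖P ξ‖ ^ 2 / (Real.pi / z δ))) * 𝓕 φ ξ)) (𝓝[>] 0)
      (𝓝 (∫ ξ : H, Complex.I ^ (Module.finrank ℝ V / 2 : ℂ) *
        (Complex.exp ((2 * Real.pi * ⟪ξ, y⟫ : ℝ) * Complex.I) •
          smulLeftCLM ℂ (fun y : H => Complex.exp ((-Real.pi * ‖P y‖ ^ 2 : ℝ) * Complex.I))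
            (𝓕 φ) ξ))) := by
    refine tendsto_integral_filter_of_dominated_convergence
      (fun ξ => (‖Complex.I ^ (Module.finrank ℝ V / 2 : ℂ)‖ + 1) * ‖𝓕 φ ξ‖) ?_ ?_ ?_ ?_
    · refine Eventually.of_forall fun δ => Continuous.aestronglyMeasurable ?_
      have := (𝓕 φ).continuous
      fun_prop
    · filter_upwards [hpos, hbd] with δ hδ hδ2
      refine Eventually.of_forall fun ξ => ?_
      rw [norm_mul, Complex.norm_exp_ofReal_mul_I, one_mul, norm_mul, norm_mul, hpz δ hδ]
      refine mul_le_mul_of_nonneg_right ?_ (norm_nonneg _)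
      refine (mul_le_of_le_one_right (norm_nonneg _) ?_).trans hδ2
      have e : -(Real.pi : ℂ) ^ 2 * ‖P ξ‖ ^ 2 / (Real.pi / z δ) =
          ((-(Real.pi * ‖P ξ‖ ^ 2) : ℝ) : ℂ) * z δ := by
        have := hzne δ hδ
        have := Real.pi_ne_zero
        push_cast
        field_simp
      rw [e, Complex.norm_exp, Complex.re_ofReal_mul]
      refine Real.exp_le_one_iff.2 ?_
      have := hz0 δ hδ
      have := Real.pi_pos
      rw [neg_mul, neg_nonpos]
      positivity
    · exact (𝓕 φ).integrable.norm.const_mul _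
    · refine Eventually.of_forall fun ξ => ?_
      rw [smulLeftCLM_apply_apply hchirp]
      have h3 : Tendsto (fun δ => Complex.exp ((2 * Real.pi * ⟪ξ, y⟫ : ℝ) * Complex.I) *
          ((z δ ^ (Module.finrank ℝ V / 2 : ℂ) *
            Complex.exp (((-(Real.pi * ‖P ξ‖ ^ 2) : ℝ) : ℂ) * z δ)) * 𝓕 φ ξ)) (𝓝[>] 0)
          (𝓝 (Complex.exp ((2 * Real.pi * ⟪ξ, y⟫ : ℝ) * Complex.I) *
          ((Complex.I ^ (Module.finrank ℝ V / 2 : ℂ) *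
            Complex.exp (((-(Real.pi * ‖P ξ‖ ^ 2) : ℝ) : ℂ) * Complex.I)) * 𝓕 φ ξ))) := by
        refine Tendsto.const_mul _ (Tendsto.mul_const _ (hcpt.mul ?_))
        exact (Complex.continuous_exp.tendsto _).comp (hzt.const_mul _)
      refine (h3.congr' ?_).trans (le_of_eq ?_)
      · filter_upwards [hpos] with δ hδ
        have e : -(Real.pi : ℂ) ^ 2 * ‖P ξ‖ ^ 2 / (Real.pi / z δ) =
            ((-(Real.pi * ‖P ξ‖ ^ 2) : ℝ) : ℂ) * z δ := by
          have := hzne δ hδ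
          have := Real.pi_ne_zero
          push_cast
          field_simp
        rw [e, hpz δ hδ]
      · congr 1
        simp only [smul_eq_mul, neg_mul]
        ring
  have hR : Tendsto (fun δ : ℝ =>
      ∫ x : V, Complex.exp (-(Real.pi / z δ) * ‖x‖ ^ 2) * φ (y - ι x)) (𝓝[>] 0)
      (𝓝 (∫ x : V, Complex.exp ((Real.pi * ‖x‖ ^ 2 : ℝ) * Complex.I) * φ (y - ι x))) := by
    refine tendsto_integral_filter_of_dominated_convergence
      (fun x => ‖slice ι y φ x‖) ?_ ?_ ?_ ?_
    · refine Eventually.of_forall fun δ => Continuous.aestronglyMeasurable ?_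
      have := φ.continuous
      have := ι.continuous
      fun_prop
    · filter_upwards [hpos] with δ hδ
      refine Eventually.of_forall fun x => ?_
      rw [norm_mul, slice_apply]
      refine mul_le_of_le_one_left (norm_nonneg _) ?_
      have e : -((Real.pi : ℂ) / z δ) * ‖x‖ ^ 2 =
          ((-(‖x‖ ^ 2) : ℝ) : ℂ) * (Real.pi / z δ) := by push_cast; ring
      rw [e, Complex.norm_exp, Complex.re_ofReal_mul, Real.exp_le_one_iff, neg_mul, neg_nonpos]
      have := hb δ hδ
      positivity
    · exact (slice ι y φ).integrable.norm
    · refine Eventually.of_forall fun x => Tendsto.mul_const _ ?_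
      refine (Complex.continuous_exp.tendsto _).comp ?_
      have h4 : Tendsto (fun δ => -((Real.pi : ℂ) / z δ) * ‖x‖ ^ 2) (𝓝[>] 0)
          (𝓝 (-((Real.pi : ℂ) / Complex.I) * ‖x‖ ^ 2)) :=
        ((tendsto_const_nhds.div hzt Complex.I_ne_zero).neg).mul_const _
      refine h4.trans (le_of_eq ?_)
      congr 1
      rw [Complex.div_I]
      push_cast
      ring
  refine tendsto_nhds_unique hL (hR.congr' ?_)
  filter_upwards [hpos] with δ hδ
  exact (hkey δ hδ).symm

lemma partialFourier_apply (ι : V →ₗᵢ[ℝ] H) (P : H →L[ℝ] V) (h : ∀ x y, ⟪ι x, y⟫ = ⟪x, P y⟫)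
    (φ : 𝓢(H, ℂ)) (y : H) :
    partialFourier P φ y =
      ∫ x : V, Complex.exp ((-2 * Real.pi * ⟪x, P y⟫ : ℝ) * Complex.I) *
        φ (y - ι (P y) + ι x) := by
  have hchirp := hasTemperateGrowth_chirp (-Real.pi) P
  have hPι : ∀ x, P (ι x) = x := fun x => ext_inner_left ℝ fun v => by
    rw [← h, ι.inner_map_map]
  have e0 : partialFourier P φ y =
      Complex.exp ((-Real.pi * ‖P y‖ ^ 2 : ℝ) * Complex.I) *
      (Complex.I ^ (Module.finrank ℝ V / 2 : ℂ) * fourierMultiplierCLM ℂ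
        (fun y : H => Complex.exp ((-Real.pi * ‖P y‖ ^ 2 : ℝ) * Complex.I))
        (smulLeftCLM ℂ (fun y : H => Complex.exp ((-Real.pi * ‖P y‖ ^ 2 : ℝ) * Complex.I)) φ)
        y) := by
    simp only [partialFourier, smul_apply, ContinuousLinearMap.comp_apply, smul_eq_mul]
    rw [smulLeftCLM_apply_apply hchirp, smul_eq_mul]
    ring
  rw [e0, fourierMultiplier_chirp ι P h, ← integral_const_mul]
  rw [← integral_sub_left_eq_self _ volume (P y)]
  refine integral_congr_ae (Eventually.of_forall fun x => ?_)
  simp only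
  rw [smulLeftCLM_apply_apply hchirp, smul_eq_mul, map_sub ι, map_sub P, map_sub P, hPι, hPι,
    show y - (ι (P y) - ι x) = y - ι (P y) + ι x by abel, ← mul_assoc, ← mul_assoc,
    ← Complex.exp_add, ← Complex.exp_add]
  congr 2
  rw [show P y - (P y - x) = x by abel, norm_sub_sq_real (P y) x, real_inner_comm]
  push_cast
  ring

end Partial

section Column

variable {n d : ℕ}

/-- The isometric embedding of the `j`-th column. -/
def colEmb (j : Fin n) : E d →ₗᵢ[ℝ] PiLp 2 (fun _ : Fin n => E d) where
  toFun x := WithLp.toLp 2 (Pi.single j x)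
  map_add' x y := by rw [Pi.single_add]; rfl
  map_smul' c x := by rw [Pi.single_smul]; rfl
  norm_map' x := by
    exact PiLp.norm_single 2 (fun _ : Fin n => E d) j x

lemma inner_colEmb (j : Fin n) (x : E d) (y : PiLp 2 (fun _ : Fin n => E d)) :
    ⟪colEmb j x, y⟫ = ⟪x, PiLp.proj 2 (𝕜 := ℝ) (fun _ : Fin n => E d) j y⟫ := by
  rw [PiLp.inner_apply, Finset.sum_eq_single j]
  · simp [colEmb]
  · intro i _ hi
    simp [colEmb, hi]
  · simp

/-- The Fourier transform in the `j`-th column. -/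
def colFourier (j : Fin n) : 𝓢(Fin n → E d, ℂ) →L[ℂ] 𝓢(Fin n → E d, ℂ) :=
  compCLMOfContinuousLinearEquiv ℂ
      (PiLp.continuousLinearEquiv 2 ℝ (fun _ : Fin n => E d)).symm ∘L
    partialFourier (PiLp.proj 2 (𝕜 := ℝ) (fun _ : Fin n => E d) j) ∘L
    compCLMOfContinuousLinearEquiv ℂ (PiLp.continuousLinearEquiv 2 ℝ (fun _ : Fin n => E d))

lemma colFourier_apply (j : Fin n) (φ : 𝓢(Fin n → E d, ℂ)) (Y : Fin n → E d) :
    colFourier j φ Y = ∫ x : E d, Complex.exp ((-2 * Real.pi * ⟪x, Y j⟫ : ℝ) * Complex.I) *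
      φ (Function.update Y j x) := by
  simp only [colFourier, ContinuousLinearMap.comp_apply, compCLMOfContinuousLinearEquiv_apply,
    Function.comp_apply]
  rw [partialFourier_apply (colEmb j) _ (inner_colEmb j)]
  refine integral_congr_ae (Eventually.of_forall fun x => ?_)
  simp only [compCLMOfContinuousLinearEquiv_apply, Function.comp_apply]
  congr 2
  ext i : 1
  by_cases hi : i = j
  · subst hi
    simp [colEmb]
  · simp [colEmb, hi]

/-- The function of one column obtained by fixing the other columns. -/
def colSlice (Y : Fin n → E d) (j : Fin n) : 𝓢(Fin n → E d, ℂ) →L[ℂ] 𝓢(E d, ℂ) :=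
  compCLMOfAntilipschitz (K := 1) ℂ (g := fun x : E d => Function.update Y j x)
    (by
      have : (fun x : E d => Function.update Y j x) = fun x : E d =>
          Function.update Y j 0 + ContinuousLinearMap.single ℝ (fun _ : Fin n => E d) j x := by
        ext x i : 2
        by_cases hi : i = j
        · subst hi; simp
        · simp [hi]
      rw [this]
      exact (Function.HasTemperateGrowth.const _).add (ContinuousLinearMap.hasTemperateGrowth _))
    (AntilipschitzWith.of_le_mul_dist fun a b => by
      simp only [NNReal.coe_one, one_mul]
      have := dist_le_pi_dist (Function.update Y j a) (Function.update Y j b) j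
      simpa using this)

lemma colSlice_apply (Y : Fin n → E d) (j : Fin n) (φ : 𝓢(Fin n → E d, ℂ)) (x : E d) :
    colSlice Y j φ x = φ (Function.update Y j x) := rfl

lemma fourier_colSlice (Y : Fin n → E d) (j : Fin n) (φ : 𝓢(Fin n → E d, ℂ)) :
    𝓕 (colSlice Y j φ) = colSlice Y j (colFourier j φ) := by
  ext ξ
  rw [fourier_coe, Real.fourier_eq', colSlice_apply, colFourier_apply]
  refine integral_congr_ae (Eventually.of_forall fun x => ?_)
  simp only [smul_eq_mul, colSlice_apply, Function.update_self, Function.update_idem]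

end Column

/-! ### Product measures -/

lemma lintegral_fin_prod {n : ℕ} {X : Type*} [MeasurableSpace X]
    (μ : Fin n → Measure X) [∀ i, SigmaFinite (μ i)] (f : Fin n → X → ℝ≥0∞)
    (hf : ∀ i, Measurable (f i)) :
    ∫⁻ x, ∏ i, f i (x i) ∂Measure.pi μ = ∏ i, ∫⁻ x, f i x ∂μ i := by
  induction n with
  | zero => simp
  | succ n ih =>
    have hm : Measurable fun y : Fin n → X => ∏ i : Fin n, f i.succ (y i) :=
      Finset.measurable_fun_prod _ fun i _ => (hf i.succ).comp (measurable_pi_apply i)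
    have h := (measurePreserving_piFinSuccAbove (α := fun _ => X) μ 0).lintegral_comp
      (f := fun z : X × (Fin n → X) => f 0 z.1 * ∏ i : Fin n, f i.succ (z.2 i))
      (((hf 0).comp measurable_fst).mul (hm.comp measurable_snd))
    simp_rw [Fin.prod_univ_succ]
    refine Eq.trans h ?_
    rw [lintegral_prod_mul (hf 0).aemeasurable hm.aemeasurable]
    congr 1
    exact ih (fun i => μ i.succ) (fun i => f i.succ) fun i => hf i.succ

lemma pi_withDensity {n : ℕ} {X : Type*} [MeasurableSpace X]
    (μ : Fin n → Measure X) [∀ i, SigmaFinite (μ i)] (f : Fin n → X → ℝ≥0∞)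
    (hf : ∀ i, Measurable (f i)) [∀ i, SigmaFinite ((μ i).withDensity (f i))] :
    Measure.pi (fun i => (μ i).withDensity (f i)) =
      (Measure.pi μ).withDensity (fun x => ∏ i, f i (x i)) := by
  refine Measure.pi_eq fun s hs => ?_
  rw [withDensity_apply _ (MeasurableSet.univ_pi hs), Measure.restrict_pi_pi,
    lintegral_fin_prod _ _ hf]
  exact Finset.prod_congr rfl fun i _ => (withDensity_apply _ (hs i)).symm

/-! ### Lebesgue measure on coordinate subspaces -/

/-- Lebesgue measure on the coordinate subspace of `ℝ^d` whose coordinates outside `S` vanish. -/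
def kap {d : ℕ} (S : Finset (Fin d)) : Measure (E d) :=
  (Measure.pi fun i => if i ∈ S then (volume : Measure ℝ) else Measure.dirac 0).map
    (WithLp.toLp 2)

instance (p : Prop) [Decidable p] :
    SigmaFinite (if p then (volume : Measure ℝ) else Measure.dirac 0) := by
  split_ifs <;> infer_instance

lemma measurableEmbedding_toLp (d : ℕ) :
    MeasurableEmbedding (WithLp.toLp 2 : (Fin d → ℝ) → E d) :=
  (MeasurableEquiv.toLp 2 (Fin d → ℝ)).measurableEmbedding

instance {d : ℕ} (S : Finset (Fin d)) : SigmaFinite (kap S) :=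
  (MeasurableEquiv.toLp 2 (Fin d → ℝ)).sigmaFinite_map

lemma kap_univ (d : ℕ) : kap (Finset.univ : Finset (Fin d)) = volume := by
  rw [← (PiLp.volume_preserving_toLp (Fin d)).map_eq]
  simp [kap, volume_pi]

lemma integrable_kap_prod {d : ℕ} (S : Finset (Fin d)) (u : Fin d → ℝ → ℝ)
    (hu : ∀ i ∈ S, Integrable (u i)) :
    Integrable (fun x : E d => ∏ i, u i (x i)) (kap S) := by
  rw [kap, (measurableEmbedding_toLp d).integrable_map_iff]
  refine Integrable.fintype_prod (f := u) fun i => ?_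
  split_ifs with h
  · exact hu i h
  · exact integrable_dirac (by simp)

/-- Polynomial decay in all the coordinates. -/
lemma schwartz_prod_decay {d : ℕ} (φ : 𝓢(E d, ℂ)) (K : ℕ) :
    ∃ C : ℝ, 0 ≤ C ∧ ∀ x : E d, ‖φ x‖ ≤ C * ∏ i, ((1 + |x i|) ^ K)⁻¹ := by
  refine ⟨2 ^ (K * d) * (Finset.Iic (K * d, 0)).sup (schwartzSeminormFamily ℂ (E d) ℂ) φ,
    by positivity, fun x => ?_⟩
  have h := one_add_le_sup_seminorm_apply (𝕜 := ℂ) (m := (K * d, 0)) le_rfl le_rfl φ x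
  rw [norm_iteratedFDeriv_zero] at h
  have hP : ∏ i, (1 + |x i|) ^ K ≤ (1 + ‖x‖) ^ (K * d) := by
    calc ∏ i, (1 + |x i|) ^ K ≤ ∏ _i : Fin d, (1 + ‖x‖) ^ K :=
          Finset.prod_le_prod (fun _ _ => by positivity) fun i _ => by
            have := PiLp.norm_apply_le x i
            rw [Real.norm_eq_abs] at this
            gcongr
      _ = (1 + ‖x‖) ^ (K * d) := by simp [pow_mul]
  rw [Finset.prod_inv_distrib, ← div_eq_mul_inv, le_div_iff₀ (by positivity), mul_comm]
  exact (mul_le_mul_of_nonneg_right hP (norm_nonneg _)).trans h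

lemma integrable_one_add_abs_inv_sq : Integrable (fun t : ℝ => ((1 + |t|) ^ 2)⁻¹) := by
  have := integrable_one_add_norm (E := ℝ) (r := 2) (μ := volume) (by simp)
  refine this.congr (Eventually.of_forall fun t => ?_)
  simp only [Real.norm_eq_abs]
  rw [Real.rpow_neg (by positivity)]
  norm_cast

/-! ### Gaussian regularisation -/

/-- The variance `δ² / 2π`, for which the density of the Gaussian is `δ⁻¹ exp (-π t² / δ²)`. -/
def gaussVar (δ : ℝ) : ℝ≥0 := (δ ^ 2 / (2 * Real.pi)).toNNReal

lemma coe_gaussVar (δ : ℝ) : (gaussVar δ : ℝ) = δ ^ 2 / (2 * Real.pi) :=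
  Real.coe_toNNReal _ (by positivity)

/-- The product of Gaussian measures of scale `δ` in the coordinates of `Z`, and of Lebesgue
measures in the others. -/
def gaussKap {d : ℕ} (Z : Finset (Fin d)) (δ : ℝ) : Measure (E d) :=
  (Measure.pi fun i => if i ∈ Z then gaussianReal 0 (gaussVar δ) else volume).map (WithLp.toLp 2)

instance (p : Prop) [Decidable p] (v : ℝ≥0) :
    SigmaFinite (if p then gaussianReal 0 v else volume) := by
  split_ifs <;> infer_instance

/-- Scaling of the coordinates of `Z`. -/
def scaleOn {d : ℕ} (Z : Finset (Fin d)) (δ : ℝ) (x : E d) : E d :=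
  WithLp.toLp 2 fun i => if i ∈ Z then δ * x i else x i

lemma continuous_scaleOn {d : ℕ} (Z : Finset (Fin d)) :
    Continuous (fun p : ℝ × E d => scaleOn Z p.1 p.2) := by
  unfold scaleOn
  refine (PiLp.continuous_toLp 2 _).comp (continuous_pi fun i => ?_)
  split_ifs <;> fun_prop

lemma gaussKap_map_scale {d : ℕ} (Z : Finset (Fin d)) (δ : ℝ) :
    (gaussKap Z 1).map (scaleOn Z δ) = gaussKap Z δ := by
  have hm : Measurable (scaleOn Z δ) :=
    ((continuous_scaleOn Z).comp (by fun_prop : Continuous fun x : E d => (δ, x))).measurable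
  have hi : ∀ i : Fin d,
      ((if i ∈ Z then gaussianReal 0 (gaussVar 1) else (volume : Measure ℝ)).map
        (fun t => if i ∈ Z then δ * t else t)) =
      if i ∈ Z then gaussianReal 0 (gaussVar δ) else volume := by
    intro i
    split_ifs
    · rw [gaussianReal_map_const_mul, mul_zero]
      congr 1
      ext
      rw [NNReal.coe_mul, coe_gaussVar, coe_gaussVar, NNReal.coe_mk]
      ring
    · exact Measure.map_id
  have hs : ∀ i : Fin d, SigmaFinite
      ((if i ∈ Z then gaussianReal 0 (gaussVar 1) else (volume : Measure ℝ)).map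
        (fun t => if i ∈ Z then δ * t else t)) := fun i => by rw [hi]; infer_instance
  rw [gaussKap, Measure.map_map hm (measurableEmbedding_toLp d).measurable, gaussKap]
  have h := Measure.pi_map_pi
    (μ := fun i : Fin d => if i ∈ Z then gaussianReal 0 (gaussVar 1) else (volume : Measure ℝ))
    (f := fun i t => if i ∈ Z then δ * t else t)
    (fun i => by split_ifs <;> fun_prop)
  simp_rw [hi] at h
  rw [← h, Measure.map_map (measurableEmbedding_toLp d).measurable
    (measurable_pi_lambda _ fun i => by split_ifs <;> fun_prop)]
  rfl

lemma gaussKap_zero {d : ℕ} (Z : Finset (Fin d)) : gaussKap Z 0 = kap Zᶜ := by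
  rw [gaussKap, kap]
  congr 2
  ext1 i
  have : gaussVar 0 = 0 := by ext; simp [coe_gaussVar]
  by_cases h : i ∈ Z <;> simp [h, this]

lemma integral_gaussKap {d : ℕ} (Z : Finset (Fin d)) {δ : ℝ} (hδ : 0 < δ) (F : E d → ℂ) :
    ∫ x, F x ∂gaussKap Z δ = ∫ x : E d,
      ((∏ i ∈ Z, δ⁻¹ * Real.exp (-Real.pi * (x i) ^ 2 / δ ^ 2) : ℝ) : ℂ) * F x := by
  have hv : gaussVar δ ≠ 0 := by
    intro h
    have := congrArg NNReal.toReal h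
    rw [coe_gaussVar, NNReal.coe_zero] at this
    have h2 : 0 < δ ^ 2 / (2 * Real.pi) := by positivity
    exact h2.ne' this
  have hpdf : ∀ t, gaussianPDFReal 0 (gaussVar δ) t =
      δ⁻¹ * Real.exp (-Real.pi * t ^ 2 / δ ^ 2) := by
    intro t
    have hpi := Real.pi_ne_zero
    have e : 2 * Real.pi * (gaussVar δ : ℝ) = δ ^ 2 := by
      rw [coe_gaussVar]; field_simp
    rw [gaussianPDFReal, e, Real.sqrt_sq hδ.le]
    congr 2
    rw [sub_zero, show (2 * (gaussVar δ : ℝ)) = δ ^ 2 / Real.pi by rw [← e]; field_simp]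
    field_simp
  set f : Fin d → ℝ → ℝ≥0∞ := fun i t => if i ∈ Z then gaussianPDF 0 (gaussVar δ) t else 1 with hf
  have hfm : ∀ i, Measurable (f i) := fun i => by
    simp only [hf]
    split_ifs
    · exact measurable_gaussianPDF _ _
    · exact measurable_const
  have hi : ∀ i : Fin d, (if i ∈ Z then gaussianReal 0 (gaussVar δ) else (volume : Measure ℝ)) =
      (volume : Measure ℝ).withDensity (f i) := by
    intro i
    simp only [hf]
    split_ifs
    · rw [gaussianReal_of_var_ne_zero _ hv]
    · exact withDensity_one.symm
  have hs : ∀ i, SigmaFinite ((volume : Measure ℝ).withDensity (f i)) := fun i => by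
    rw [← hi]; infer_instance
  rw [gaussKap]
  simp_rw [hi]
  rw [pi_withDensity _ _ hfm, (measurableEmbedding_toLp d).integral_map,
    ← (PiLp.volume_preserving_toLp (Fin d)).integral_comp (measurableEmbedding_toLp d)]
  have hfin : ∀ x : Fin d → ℝ, ∏ i, f i (x i) =
      ENNReal.ofReal (∏ i ∈ Z, δ⁻¹ * Real.exp (-Real.pi * (x i) ^ 2 / δ ^ 2)) := by
    intro x
    rw [ENNReal.ofReal_prod_of_nonneg fun i _ => by positivity, ← Finset.prod_subset
      (Finset.subset_univ Z) fun i _ hi => by simp [hf, hi]]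
    refine Finset.prod_congr rfl fun i hi => ?_
    simp only [hf, hi, if_true, gaussianPDF, hpdf]
  simp_rw [hfin]
  rw [integral_withDensity_eq_integral_toReal_smul]
  · rw [volume_pi]
    refine integral_congr_ae (Eventually.of_forall fun x => ?_)
    simp only
    rw [ENNReal.toReal_ofReal (Finset.prod_nonneg fun i _ => by positivity), Complex.real_smul]
  · fun_prop
  · exact Eventually.of_forall fun x => ENNReal.ofReal_lt_top

lemma tendsto_integral_gaussKap {d : ℕ} (Z F M : Finset (Fin d)) {l : ℝ} (hl : 0 ≤ l)
    (φ : 𝓢(E d, ℂ)) :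
    Tendsto (fun δ : ℝ => ∫ x : E d,
      (Real.exp (-Real.pi * (δ ^ 2 * ∑ i ∈ F, x i ^ 2 + l * ∑ i ∈ M, x i ^ 2)) : ℂ) * φ x
        ∂gaussKap Z δ) (𝓝[>] 0)
      (𝓝 (∫ x : E d, (Real.exp (-Real.pi * (l * ∑ i ∈ M, x i ^ 2)) : ℂ) * φ x ∂kap Zᶜ)) := by
  set w : ℝ × E d → ℂ := fun p =>
    (Real.exp (-Real.pi * (p.1 ^ 2 * ∑ i ∈ F, p.2 i ^ 2 + l * ∑ i ∈ M, p.2 i ^ 2)) : ℂ) * φ p.2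
    with hw
  have hwc : Continuous w := by
    have := φ.continuous
    fun_prop
  have hsc := continuous_scaleOn (d := d) Z
  have hm : ∀ δ : ℝ, Continuous (scaleOn Z δ) := fun δ =>
    hsc.comp (by fun_prop : Continuous fun x : E d => (δ, x))
  have hmap : ∀ δ : ℝ, ∫ x, w (δ, x) ∂gaussKap Z δ =
      ∫ x, w (δ, scaleOn Z δ x) ∂gaussKap Z 1 := fun δ => by
    rw [← gaussKap_map_scale, integral_map (hm δ).aemeasurable]
    exact (hwc.comp (by fun_prop)).aestronglyMeasurable
  have h0 : ∫ x : E d, (Real.exp (-Real.pi * (l * ∑ i ∈ M, x i ^ 2)) : ℂ) * φ x ∂kap Zᶜ =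
      ∫ x, w (0, scaleOn Z 0 x) ∂gaussKap Z 1 := by
    rw [← hmap, gaussKap_zero]
    simp [hw]
  rw [h0]
  simp_rw [show ∀ δ : ℝ, ∀ x : E d,
    (Real.exp (-Real.pi * (δ ^ 2 * ∑ i ∈ F, x i ^ 2 + l * ∑ i ∈ M, x i ^ 2)) : ℂ) * φ x =
      w (δ, x) from fun δ x => rfl, hmap]
  obtain ⟨C, hC0, hC⟩ := schwartz_prod_decay φ 2
  refine tendsto_integral_filter_of_dominated_convergence
    (fun x : E d => C * ∏ i, (if i ∈ Z then 1 else ((1 + |x i|) ^ 2)⁻¹)) ?_ ?_ ?_ ?_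
  · exact Eventually.of_forall fun δ =>
      (hwc.comp (continuous_const.prodMk (hm δ))).aestronglyMeasurable
  · refine Eventually.of_forall fun δ => Eventually.of_forall fun x => ?_
    simp only [hw]
    rw [norm_mul]
    have h1 : ‖(Real.exp (-Real.pi * (δ ^ 2 * ∑ i ∈ F, scaleOn Z δ x i ^ 2 +
        l * ∑ i ∈ M, scaleOn Z δ x i ^ 2)) : ℂ)‖ ≤ 1 := by
      rw [Complex.norm_real, Real.norm_eq_abs, Real.abs_exp, Real.exp_le_one_iff, neg_mul,
        neg_nonpos]
      have := Real.pi_pos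
      have h2 : ∀ G : Finset (Fin d), 0 ≤ ∑ i ∈ G, scaleOn Z δ x i ^ 2 :=
        fun G => Finset.sum_nonneg fun i _ => sq_nonneg _
      have := h2 F
      have := h2 M
      positivity
    refine (mul_le_of_le_one_left (norm_nonneg _) h1).trans ((hC _).trans ?_)
    refine mul_le_mul_of_nonneg_left (Finset.prod_le_prod (fun i _ => by positivity)
      fun i _ => ?_) hC0
    by_cases hi : i ∈ Z
    · simp only [hi, if_true]
      exact inv_le_one_of_one_le₀ (one_le_pow₀ (by simp))
    · simp [hi, scaleOn]
  · refine Integrable.const_mul ?_ C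
    rw [gaussKap, (measurableEmbedding_toLp d).integrable_map_iff]
    refine Integrable.fintype_prod
      (f := fun i t => if i ∈ Z then (1 : ℝ) else ((1 + |t|) ^ 2)⁻¹) fun i => ?_
    by_cases hi : i ∈ Z
    · simp only [hi, if_true]
      exact integrable_const _
    · simp only [hi, if_false]
      exact integrable_one_add_abs_inv_sq
  · refine Eventually.of_forall fun x => ?_
    have hc : Continuous fun δ : ℝ => w (δ, scaleOn Z δ x) :=
      hwc.comp (continuous_id.prodMk (hsc.comp (by fun_prop : Continuous fun δ : ℝ => (δ, x))))
    exact (hc.tendsto 0).mono_left nhdsWithin_le_nhds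

lemma integral_fourier_mul_gaussian {d : ℕ} (a : Fin d → ℝ) (ha : ∀ i, 0 < a i)
    (φ : 𝓢(E d, ℂ)) :
    ∫ ξ : E d, ((∏ i, Real.exp (-Real.pi * a i * ξ i ^ 2) : ℝ) : ℂ) * 𝓕 φ ξ =
      ((∏ i, (√(a i))⁻¹ : ℝ) : ℂ) *
        ∫ x : E d, ((∏ i, Real.exp (-Real.pi * x i ^ 2 / a i) : ℝ) : ℂ) * φ x := by
  set G : E d → ℂ := fun ξ => ((∏ i, Real.exp (-Real.pi * a i * ξ i ^ 2) : ℝ) : ℂ) with hG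
  have hGi : Integrable G := by
    have h1 : Integrable (fun ξ : E d => ∏ i, Real.exp (-Real.pi * a i * ξ i ^ 2)) := by
      rw [← kap_univ]
      refine integrable_kap_prod _ (fun i t => Real.exp (-Real.pi * a i * t ^ 2)) fun i _ => ?_
      have := integrable_exp_neg_mul_sq (b := Real.pi * a i) (mul_pos Real.pi_pos (ha i))
      simpa [neg_mul] using this
    exact h1.ofReal
  have hF : ∀ x : E d, 𝓕 G x = ((∏ i, (√(a i))⁻¹ : ℝ) : ℂ) *
      ((∏ i, Real.exp (-Real.pi * x i ^ 2 / a i) : ℝ) : ℂ) := by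
    intro x
    rw [Real.fourier_eq', ← (PiLp.volume_preserving_toLp (Fin d)).integral_comp
      (measurableEmbedding_toLp d)]
    have h2 := GaussianFourier.integral_cexp_neg_sum_mul_add
      (b := fun i => ((Real.pi * a i : ℝ) : ℂ))
      (fun i => by rw [Complex.ofReal_re]; exact mul_pos Real.pi_pos (ha i))
      (fun i => -2 * Real.pi * x i * Complex.I)
    refine Eq.trans (integral_congr_ae (Eventually.of_forall fun v => ?_)) (h2.trans ?_)
    · simp only [hG, smul_eq_mul]
      rw [← Real.exp_sum, Complex.ofReal_exp, ← Complex.exp_add]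
      congr 1
      rw [PiLp.inner_apply]
      simp only [RCLike.inner_apply, conj_trivial]
      push_cast
      rw [add_comm, ← Finset.sum_neg_distrib, Finset.mul_sum, Finset.sum_mul]
      congr 1
      · exact Finset.sum_congr rfl fun i _ => by ring
      · exact Finset.sum_congr rfl fun i _ => by ring
    · rw [Complex.ofReal_prod, Complex.ofReal_prod, ← Finset.prod_mul_distrib]
      refine Finset.prod_congr rfl fun i _ => ?_
      have hpi := Real.pi_ne_zero
      have hai := (ha i).ne'
      congr 1
      · rw [← Complex.ofReal_div, show Real.pi / (Real.pi * a i) = (a i)⁻¹ by field_simp,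
          show (1 / 2 : ℂ) = ((1 / 2 : ℝ) : ℂ) by push_cast; rfl,
          ← Complex.ofReal_cpow (inv_nonneg.2 (ha i).le), ← Real.sqrt_eq_rpow, Real.sqrt_inv]
      · rw [Complex.ofReal_exp]
        congr 1
        push_cast
        have : (a i : ℂ) ≠ 0 := by exact_mod_cast hai
        have : (Real.pi : ℂ) ≠ 0 := by exact_mod_cast hpi
        field_simp
        rw [Complex.I_sq]
        ring
  have h := VectorFourier.integral_fourierIntegral_smul_eq_flip (L := innerₗ (E d))
      Real.continuous_fourierChar continuous_inner φ.integrable hGi (μ := volume) (ν := volume)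
  have h' : ∫ ξ : E d, 𝓕 φ ξ * G ξ = ∫ x, φ x * 𝓕 G x := by simpa using! h
  rw [← integral_const_mul]
  refine Eq.trans ?_ (h'.trans ?_)
  · exact integral_congr_ae (Eventually.of_forall fun x => mul_comm _ _)
  simp_rw [hF]
  exact integral_congr_ae (Eventually.of_forall fun x => by simp only; ring)

/-- Parseval's identity between complementary coordinate subspaces, with a Gaussian weight in the
remaining coordinates. -/
lemma integral_fourier_kap {d : ℕ} (S Z : Finset (Fin d)) (hSZ : Disjoint S Z) {l : ℝ}
    (hl : 0 < l) (φ : 𝓢(E d, ℂ)) :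
    ∫ ξ : E d, (Real.exp (-Real.pi * (l⁻¹ * ∑ i ∈ (S ∪ Z)ᶜ, ξ i ^ 2)) : ℂ) * 𝓕 φ ξ ∂kap Sᶜ =
      ((√l ^ (S ∪ Z)ᶜ.card : ℝ) : ℂ) *
      ∫ x : E d, (Real.exp (-Real.pi * (l * ∑ i ∈ (S ∪ Z)ᶜ, x i ^ 2)) : ℂ) * φ x ∂kap Zᶜ := by
  have h1 := tendsto_integral_gaussKap S Z (S ∪ Z)ᶜ (inv_nonneg.2 hl.le) (𝓕 φ)
  have h2 := (tendsto_integral_gaussKap Z S (S ∪ Z)ᶜ hl.le φ).const_mul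
    ((√l ^ (S ∪ Z)ᶜ.card : ℝ) : ℂ)
  refine tendsto_nhds_unique h1 (h2.congr' ?_)
  have hpos : ∀ᶠ δ in 𝓝[>] (0 : ℝ), 0 < δ := self_mem_nhdsWithin
  filter_upwards [hpos] with δ hδ
  rw [integral_gaussKap _ hδ, integral_gaussKap _ hδ]
  set a : Fin d → ℝ := fun i => if i ∈ S then (δ ^ 2)⁻¹ else if i ∈ Z then δ ^ 2 else l⁻¹ with hadef
  have ha : ∀ i, 0 < a i := fun i => by
    simp only [hadef]; split_ifs <;> positivity
  have haS : ∀ i ∈ S, a i = (δ ^ 2)⁻¹ := fun i hi => by simp [hadef, hi]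
  have haZ : ∀ i ∈ Z, a i = δ ^ 2 := fun i hi => by
    simp [hadef, hi, Finset.disjoint_right.1 hSZ hi]
  have haM : ∀ i ∈ (S ∪ Z)ᶜ, a i = l⁻¹ := fun i hi => by
    rw [Finset.mem_compl, Finset.mem_union, not_or] at hi
    simp [hadef, hi.1, hi.2]
  have hsplit : ∀ f : Fin d → ℝ, ∏ i, f i =
      (∏ i ∈ S, f i) * (∏ i ∈ Z, f i) * ∏ i ∈ (S ∪ Z)ᶜ, f i := fun f => by
    rw [← Finset.prod_mul_prod_compl (S ∪ Z), Finset.prod_union hSZ]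
  have h := integral_fourier_mul_gaussian a ha φ
  have hc : ∏ i, (√(a i))⁻¹ = δ ^ S.card * (δ⁻¹) ^ Z.card * √l ^ (S ∪ Z)ᶜ.card := by
    rw [hsplit, Finset.prod_congr rfl fun i hi => by rw [haS i hi],
      Finset.prod_congr (s₁ := Z) rfl fun i hi => by rw [haZ i hi],
      Finset.prod_congr (s₁ := (S ∪ Z)ᶜ) rfl fun i hi => by rw [haM i hi]]
    simp [Real.sqrt_inv, Real.sqrt_sq hδ.le]
  have hexp : ∀ (T : Finset (Fin d)) (c : ℝ) (x : E d),
      Real.exp (-Real.pi * (c * ∑ i ∈ T, x i ^ 2)) =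
        ∏ i ∈ T, Real.exp (-Real.pi * (c * x i ^ 2)) := fun T c x => by
    rw [Finset.mul_sum, Finset.mul_sum, Real.exp_sum]
  have e1 : ∀ ξ : E d, (∏ i ∈ S, δ⁻¹ * Real.exp (-Real.pi * ξ i ^ 2 / δ ^ 2)) *
      Real.exp (-Real.pi * (δ ^ 2 * ∑ i ∈ Z, ξ i ^ 2 + l⁻¹ * ∑ i ∈ (S ∪ Z)ᶜ, ξ i ^ 2)) =
      (δ⁻¹) ^ S.card * ∏ i, Real.exp (-Real.pi * a i * ξ i ^ 2) := fun ξ => by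
    rw [hsplit, Finset.prod_mul_distrib, Finset.prod_const, mul_add, Real.exp_add, hexp, hexp,
      mul_assoc, mul_assoc]
    congr 2
    · exact Finset.prod_congr rfl fun i hi => by rw [haS i hi]; congr 1; ring
    congr 1
    · exact Finset.prod_congr rfl fun i hi => by rw [haZ i hi]; congr 1; ring
    · exact Finset.prod_congr rfl fun i hi => by rw [haM i hi]; congr 1; ring
  have e2 : ∀ x : E d, (∏ i ∈ Z, δ⁻¹ * Real.exp (-Real.pi * x i ^ 2 / δ ^ 2)) *
      Real.exp (-Real.pi * (δ ^ 2 * ∑ i ∈ S, x i ^ 2 + l * ∑ i ∈ (S ∪ Z)ᶜ, x i ^ 2)) =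
      (δ⁻¹) ^ Z.card * ∏ i, Real.exp (-Real.pi * x i ^ 2 / a i) := fun x => by
    rw [hsplit, Finset.prod_mul_distrib, Finset.prod_const, mul_add, Real.exp_add, hexp, hexp,
      mul_assoc, mul_comm (∏ i ∈ S, _) (∏ i ∈ Z, _), mul_assoc]
    congr 2
    · exact Finset.prod_congr rfl fun i hi => by rw [haZ i hi]
    congr 1
    · exact Finset.prod_congr rfl fun i hi => by rw [haS i hi, div_inv_eq_mul]; congr 1; ring
    · exact Finset.prod_congr rfl fun i hi => by rw [haM i hi, div_inv_eq_mul]; congr 1; ring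
  have e3 : ∀ (p q c r : ℝ) (w : ℂ), p * q = c * r →
      (p : ℂ) * ((q : ℂ) * w) = c * ((r : ℂ) * w) := fun p q c r w hpq => by
    rw [← mul_assoc, ← Complex.ofReal_mul, hpq, Complex.ofReal_mul, mul_assoc]
  simp_rw [fun ξ : E d => e3 _ _ _ _ (𝓕 φ ξ) (e1 ξ), fun x : E d => e3 _ _ _ _ (φ x) (e2 x)]
  rw [integral_const_mul, integral_const_mul, h, hc]
  push_cast
  have hδ' : (δ : ℂ) ≠ 0 := by exact_mod_cast hδ.ne'
  have : (δ : ℂ)⁻¹ ^ S.card * (δ : ℂ) ^ S.card = 1 := by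
    rw [← mul_pow, inv_mul_cancel₀ hδ', one_pow]
  linear_combination (-((δ : ℂ)⁻¹ ^ Z.card * (√l : ℂ) ^ (S ∪ Z)ᶜ.card *
    ∫ x : E d, (∏ i, Complex.exp (-Real.pi * x i ^ 2 / a i) : ℂ) * φ x)) * this

/-- The Fourier transform and integration over complementary coordinate subspaces. -/
lemma integral_fourier_kap_compl {d : ℕ} (S : Finset (Fin d)) (φ : 𝓢(E d, ℂ)) :
    ∫ ξ, 𝓕 φ ξ ∂kap Sᶜ = ∫ x, φ x ∂kap S := by
  have h := integral_fourier_kap S Sᶜ disjoint_compl_right one_pos φ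
  simpa using h

/-! ### The functional equation in one variable -/

lemma integrable_abs_rpow_mul {a : ℝ} (ha : -1 < a) {K : ℕ} (hK : a + 1 < K) :
    Integrable (fun t : ℝ => |t| ^ a * ((1 + |t|) ^ K)⁻¹) := by
  have h := integrable_fun_norm_addHaar (E := ℝ) (F := ℝ) volume
    (f := fun t => t ^ a * ((1 + t) ^ K)⁻¹)
  simp only [Real.norm_eq_abs, Module.finrank_self, le_refl, tsub_eq_zero_of_le, pow_zero,
    one_smul] at h
  rw [h]
  have hm : Measurable fun t : ℝ => t ^ a * ((1 + t) ^ K)⁻¹ := by fun_prop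
  rw [← Ioc_union_Ioi_eq_Ioi (zero_le_one' ℝ)]
  refine IntegrableOn.union ?_ ?_
  · have h1 : IntegrableOn (fun t : ℝ => t ^ a) (Ioc 0 1) :=
      (intervalIntegrable_iff_integrableOn_Ioc_of_le zero_le_one).1
        (intervalIntegral.intervalIntegrable_rpow' ha)
    refine h1.mono' hm.aestronglyMeasurable ?_
    refine (ae_restrict_iff' measurableSet_Ioc).2 (Eventually.of_forall fun t ht => ?_)
    have h0 : 0 ≤ t ^ a := Real.rpow_nonneg ht.1.le a
    have h2 : ((1 + t) ^ K)⁻¹ ≤ 1 := inv_le_one_of_one_le₀ (one_le_pow₀ (by linarith [ht.1]))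
    have h3 : 0 ≤ ((1 + t) ^ K)⁻¹ := inv_nonneg.2 (pow_nonneg (by linarith [ht.1]) K)
    rw [Real.norm_eq_abs, abs_of_nonneg (mul_nonneg h0 h3)]
    exact mul_le_of_le_one_right h0 h2
  · have h1 : IntegrableOn (fun t : ℝ => t ^ (a - K)) (Ioi 1) :=
      integrableOn_Ioi_rpow_of_lt (by linarith) one_pos
    refine h1.mono' hm.aestronglyMeasurable ?_
    refine (ae_restrict_iff' measurableSet_Ioi).2 (Eventually.of_forall fun t ht => ?_)
    have ht0 : (0 : ℝ) < t := one_pos.trans ht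
    have h0 : 0 ≤ t ^ a := Real.rpow_nonneg ht0.le a
    have h3 : 0 ≤ ((1 + t) ^ K)⁻¹ := inv_nonneg.2 (pow_nonneg (by linarith) K)
    rw [Real.norm_eq_abs, abs_of_nonneg (mul_nonneg h0 h3), Real.rpow_sub ht0, Real.rpow_natCast,
      div_eq_mul_inv]
    refine mul_le_mul_of_nonneg_left (inv_anti₀ (pow_pos ht0 K) ?_) h0
    gcongr
    linarith

/-- The local factor `Γ(z/2) / (2 π^{z/2})`. -/
def gfac (z : ℂ) : ℂ := 1 / (2 * (Real.pi : ℂ) ^ (z / 2)) * Complex.Gamma (z / 2)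

lemma integral_cpow_mul_gaussian {z : ℂ} (hz : 0 < z.re) {t : ℝ} (ht : t ≠ 0) :
    ∫ l in Ioi (0 : ℝ), (l : ℂ) ^ (z / 2 - 1) * (Real.exp (-Real.pi * (l * t ^ 2)) : ℂ) =
      2 * gfac z * ((|t| : ℝ) : ℂ) ^ (-z) := by
  have hr : 0 < Real.pi * t ^ 2 := mul_pos Real.pi_pos (by positivity)
  have h := Complex.integral_cpow_mul_exp_neg_mul_Ioi (a := z / 2) (r := (Real.pi * t ^ 2 : ℝ))
    (by simpa using hz) (by simpa using hr)
  have e : ∀ l : ℝ, (Real.exp (-Real.pi * (l * t ^ 2)) : ℂ) =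
      Complex.exp (-((Real.pi * t ^ 2 : ℝ) : ℂ) * l) := fun l => by
    rw [Complex.ofReal_exp]; congr 1; push_cast; ring
  simp_rw [e]
  refine Eq.trans (by simp only [neg_mul]) (h.trans ?_)
  have ht' : (0 : ℝ) < |t| := abs_pos.2 ht
  have e2 : (1 / ((Real.pi * t ^ 2 : ℝ) : ℂ)) ^ (z / 2) =
      ((Real.pi : ℂ) ^ (z / 2))⁻¹ * ((|t| : ℝ) : ℂ) ^ (-z) := by
    rw [one_div, Complex.inv_cpow _ _ (by rw [Complex.arg_ofReal_of_nonneg hr.le]; exact Real.pi_pos.ne),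
      Complex.ofReal_mul, Complex.mul_cpow_ofReal_nonneg Real.pi_pos.le (sq_nonneg t), mul_inv,
      Complex.cpow_neg, ← sq_abs, Complex.ofReal_pow]
    congr 2
    rw [← Complex.ofReal_pow, sq, Complex.ofReal_mul,
      Complex.mul_cpow_ofReal_nonneg ht'.le ht'.le, ← Complex.cpow_add _ _ (by exact_mod_cast ht'.ne')]
    congr 1
    ring
  rw [e2, gfac]
  ring

lemma integral_rpow_mul_gaussian {r : ℝ} (hr : 0 < r) :
    ∃ c : ℝ, 0 ≤ c ∧ ∀ t : ℝ, t ≠ 0 →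
    ∫ l in Ioi (0 : ℝ), l ^ (r / 2 - 1) * Real.exp (-Real.pi * (l * t ^ 2)) = c * |t| ^ (-r) := by
  refine ⟨Real.pi⁻¹ ^ (r / 2) * Real.Gamma (r / 2),
    mul_nonneg (by positivity) (Real.Gamma_nonneg_of_nonneg (by positivity)), fun t ht => ?_⟩
  have hr' : 0 < Real.pi * t ^ 2 := mul_pos Real.pi_pos (by positivity)
  have h := Real.integral_rpow_mul_exp_neg_mul_Ioi (a := r / 2) (by positivity) hr'
  have e : ∀ l : ℝ, Real.exp (-Real.pi * (l * t ^ 2)) =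
      Real.exp (-((Real.pi * t ^ 2) * l)) := fun l => by congr 1; ring
  simp_rw [e, h]
  have ht' : (0 : ℝ) < |t| := abs_pos.2 ht
  rw [one_div, mul_inv, Real.mul_rpow (by positivity) (by positivity), ← sq_abs, ← inv_pow,
    ← Real.rpow_natCast, ← Real.rpow_mul (by positivity), Real.inv_rpow ht'.le, Real.rpow_neg ht'.le]
  rw [show ((2 : ℕ) : ℝ) * (r / 2) = r by push_cast; ring]
  ring

lemma integrableOn_rpow_mul_gaussian {r : ℝ} (hr : 0 < r) {t : ℝ} (ht : t ≠ 0) :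
    IntegrableOn (fun l : ℝ => l ^ (r / 2 - 1) * Real.exp (-Real.pi * (l * t ^ 2))) (Ioi 0) := by
  have hr' : 0 < Real.pi * t ^ 2 := mul_pos Real.pi_pos (by positivity)
  have h := integrableOn_rpow_mul_exp_neg_mul_rpow (s := r / 2 - 1) (p := 1)
    (by linarith) one_pos hr'
  refine h.congr_fun (fun l _ => ?_) measurableSet_Ioi
  simp only [Real.rpow_one]
  congr 2
  ring

/-- The Mellin transform of the Gaussian averages of a function. -/
lemma mellin_gaussian {X : Type*} [MeasurableSpace X] (ν : Measure X) [SigmaFinite ν]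
    (p : X → ℝ) (hp : Measurable p) (hp0 : ∀ᵐ x ∂ν, p x ≠ 0) (f : X → ℂ)
    (hf : AEStronglyMeasurable f ν)
    {z : ℂ} (hz : 0 < z.re) (hint : Integrable (fun x => |p x| ^ (-z.re) * ‖f x‖) ν) :
    mellin (fun l : ℝ => ∫ x, (Real.exp (-Real.pi * (l * p x ^ 2)) : ℂ) * f x ∂ν) (z / 2) =
      2 * gfac z * ∫ x, ((|p x| : ℝ) : ℂ) ^ (-z) * f x ∂ν := by
  unfold mellin
  simp_rw [smul_eq_mul, ← integral_const_mul]
  rw [integral_integral_swap]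
  · refine integral_congr_ae ?_
    filter_upwards [hp0] with x hx
    have e : ∀ l : ℝ, (l : ℂ) ^ (z / 2 - 1) * ((Real.exp (-Real.pi * (l * p x ^ 2)) : ℂ) * f x) =
        (l : ℂ) ^ (z / 2 - 1) * (Real.exp (-Real.pi * (l * p x ^ 2)) : ℂ) * f x :=
      fun l => (mul_assoc _ _ _).symm
    simp_rw [e]
    rw [integral_mul_const, integral_cpow_mul_gaussian hz hx, mul_assoc]
  · have hm : AEStronglyMeasurable (Function.uncurry fun (l : ℝ) (x : X) =>
        (l : ℂ) ^ (z / 2 - 1) * ((Real.exp (-Real.pi * (l * p x ^ 2)) : ℂ) * f x))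
        ((volume.restrict (Ioi 0)).prod ν) := by
      refine AEStronglyMeasurable.mul ?_ (AEStronglyMeasurable.mul ?_ hf.comp_snd)
      · exact (by fun_prop : Measurable fun q : ℝ × X => (q.1 : ℂ) ^ (z / 2 - 1)).aestronglyMeasurable
      · refine Measurable.aestronglyMeasurable ?_
        have := hp.comp (measurable_snd : Measurable (Prod.snd : ℝ × X → X))
        fun_prop
    rw [integrable_prod_iff' hm]
    have hn : ∀ x, ∀ l ∈ Ioi (0 : ℝ), ‖(l : ℂ) ^ (z / 2 - 1) *
        ((Real.exp (-Real.pi * (l * p x ^ 2)) : ℂ) * f x)‖ =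
        l ^ (z.re / 2 - 1) * Real.exp (-Real.pi * (l * p x ^ 2)) * ‖f x‖ := fun x l hl => by
      rw [norm_mul, norm_mul, Complex.norm_cpow_eq_rpow_re_of_pos hl, Complex.norm_real,
        Real.norm_eq_abs, Real.abs_exp, mul_assoc]
      simp
    obtain ⟨c, hc0, hc⟩ := integral_rpow_mul_gaussian hz
    constructor
    · filter_upwards [hp0, hm.prodMk_right] with x hx hmx
      refine (integrable_norm_iff hmx).1 ?_
      have h : IntegrableOn (fun l : ℝ => l ^ (z.re / 2 - 1) *
          Real.exp (-Real.pi * (l * p x ^ 2)) * ‖f x‖) (Ioi 0) :=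
        (integrableOn_rpow_mul_gaussian hz hx).mul_const ‖f x‖
      exact h.congr_fun (fun l hl => (hn x l hl).symm) measurableSet_Ioi
    · refine (hint.const_mul c).congr ?_
      filter_upwards [hp0] with x hx
      simp only [Function.uncurry]
      rw [setIntegral_congr_fun measurableSet_Ioi (hn x), integral_mul_const, hc _ hx]
      ring

lemma kap_ae_ne {d : ℕ} {S : Finset (Fin d)} {m : Fin d} (hm : m ∈ S) :
    ∀ᵐ x : E d ∂kap S, x m ≠ 0 := by
  rw [kap, (measurableEmbedding_toLp d).ae_map_iff]
  have : NullSingletonClass (if m ∈ S then (volume : Measure ℝ) else Measure.dirac 0) := by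
    rw [if_pos hm]; infer_instance
  exact Measure.ae_eval_ne (μ := fun i => if i ∈ S then (volume : Measure ℝ) else Measure.dirac 0)
    m 0

lemma schwartz_integrable_kap_rpow {d : ℕ} {S : Finset (Fin d)} {m : Fin d}
    (φ : 𝓢(E d, ℂ)) {r : ℝ} (hr : r < 1) (hr0 : 0 < r) :
    Integrable (fun x : E d => |x m| ^ (-r) * ‖φ x‖) (kap S) := by
  obtain ⟨C, hC0, hC⟩ := schwartz_prod_decay φ 2
  set u : Fin d → ℝ → ℝ := fun i t => (if i = m then |t| ^ (-r) else 1) * ((1 + |t|) ^ 2)⁻¹ with hu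
  have h := (integrable_kap_prod S u fun i _ => by
    simp only [hu]
    split_ifs
    · exact integrable_abs_rpow_mul (by linarith) (by push_cast; linarith)
    · simpa using integrable_one_add_abs_inv_sq).const_mul C
  refine h.mono' ?_ (Eventually.of_forall fun x => ?_)
  · have := φ.continuous.measurable
    exact Measurable.aestronglyMeasurable (by fun_prop)
  · have hx : 0 ≤ |x m| ^ (-r) := by positivity
    rw [norm_mul, norm_norm, Real.norm_eq_abs, abs_of_nonneg hx]
    simp only [hu]
    rw [Finset.prod_mul_distrib, Finset.prod_ite_eq' Finset.univ m, if_pos (Finset.mem_univ m)]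
    calc |x m| ^ (-r) * ‖φ x‖ ≤ |x m| ^ (-r) * (C * ∏ i, ((1 + |x i|) ^ 2)⁻¹) :=
          mul_le_mul_of_nonneg_left (hC x) hx
      _ = _ := by ring

lemma compl_Iio_union_Ioi {ι : Type*} [LinearOrder ι] [Fintype ι] [LocallyFiniteOrderBot ι]
    [LocallyFiniteOrderTop ι] (m : ι) : (Finset.Iio m ∪ Finset.Ioi m)ᶜ = {m} := by
  ext i
  simp only [Finset.mem_compl, Finset.mem_union, Finset.mem_Iio, Finset.mem_Ioi,
    Finset.mem_singleton, not_or, not_lt]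
  exact ⟨fun h => le_antisymm h.2 h.1, fun h => by simp [h]⟩

lemma compl_Iio_eq_Ici {ι : Type*} [LinearOrder ι] [Fintype ι] [LocallyFiniteOrderBot ι]
    [LocallyFiniteOrderTop ι] (m : ι) : (Finset.Iio m)ᶜ = Finset.Ici m := by ext; simp

lemma compl_Ioi_eq_Iic {ι : Type*} [LinearOrder ι] [Fintype ι] [LocallyFiniteOrderBot ι]
    [LocallyFiniteOrderTop ι] (m : ι) : (Finset.Ioi m)ᶜ = Finset.Iic m := by ext; simp

lemma disjoint_Iio_Ioi' {ι : Type*} [LinearOrder ι] [LocallyFiniteOrderBot ι]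
    [LocallyFiniteOrderTop ι] (m : ι) : Disjoint (Finset.Iio m) (Finset.Ioi m) := by
  rw [Finset.disjoint_left]
  intro i h1 h2
  simp only [Finset.mem_Iio, Finset.mem_Ioi] at h1 h2
  exact absurd h1 h2.not_gt

lemma gaussian_kap_Iic {d : ℕ} (m : Fin d) (φ : 𝓢(E d, ℂ)) {l : ℝ} (hl : 0 < l) :
    ∫ x : E d, (Real.exp (-Real.pi * (l * x m ^ 2)) : ℂ) * φ x ∂kap (Finset.Iic m) =
      (l : ℂ) ^ (-(1 / 2) : ℂ) *
        ∫ x : E d, (Real.exp (-Real.pi * (l⁻¹ * x m ^ 2)) : ℂ) * 𝓕 φ x ∂kap (Finset.Ici m) := by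
  have h := integral_fourier_kap (Finset.Iio m) (Finset.Ioi m) (disjoint_Iio_Ioi' m) hl φ
  rw [compl_Iio_eq_Ici, compl_Ioi_eq_Iic, compl_Iio_union_Ioi] at h
  simp only [Finset.sum_singleton, Finset.card_singleton, pow_one] at h
  rw [h, ← mul_assoc, Real.sqrt_eq_rpow, Complex.ofReal_cpow hl.le,
    ← Complex.cpow_add _ _ (by exact_mod_cast hl.ne')]
  simp

lemma mellin_eq_of_inv {a b : ℝ → ℂ}
    (hab : ∀ l : ℝ, 0 < l → a l = (l : ℂ) ^ (-(1 / 2) : ℂ) * b l⁻¹) (σ : ℂ) :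
    mellin a ((1 - σ) / 2) = mellin b (σ / 2) := by
  have e1 : mellin a ((1 - σ) / 2) =
      mellin (fun l : ℝ => (l : ℂ) ^ (-(1 / 2) : ℂ) • b l⁻¹) ((1 - σ) / 2) := by
    refine setIntegral_congr_fun measurableSet_Ioi fun l hl => ?_
    simp only [hab l hl, smul_eq_mul]
  rw [e1, mellin_cpow_smul, mellin_comp_inv]
  congr 1
  ring

lemma mellin_gaussian_kap {d : ℕ} {S : Finset (Fin d)} {m : Fin d} (hm : m ∈ S)
    (φ : 𝓢(E d, ℂ)) {z : ℂ} (h0 : 0 < z.re) (h1 : z.re < 1) :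
    mellin (fun l : ℝ => ∫ x : E d, (Real.exp (-Real.pi * (l * x m ^ 2)) : ℂ) * φ x ∂kap S)
      (z / 2) = 2 * gfac z * ∫ x : E d, ((|x m| : ℝ) : ℂ) ^ (-z) * φ x ∂kap S := by
  have hpm : Measurable fun x : E d => x m := by fun_prop
  exact mellin_gaussian (kap S) (fun x => x m) hpm (kap_ae_ne hm) φ
    φ.continuous.aestronglyMeasurable h0 (schwartz_integrable_kap_rpow φ h1 h0)

/-- The local functional equation. -/
lemma local_functional_equation {d : ℕ} (m : Fin d) (φ : 𝓢(E d, ℂ)) {σ : ℂ} (h0 : 0 < σ.re)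
    (h1 : σ.re < 1) :
    gfac (1 - σ) * ∫ x : E d, ((|x m| : ℝ) : ℂ) ^ (σ - 1) * φ x ∂kap (Finset.Iic m) =
      gfac σ * ∫ ξ : E d, ((|ξ m| : ℝ) : ℂ) ^ (-σ) * 𝓕 φ ξ ∂kap (Finset.Ici m) := by
  have A := mellin_gaussian_kap (Finset.mem_Iic.2 (le_refl m)) φ
    (z := 1 - σ) (by simpa using h1) (by simpa using h0)
  have B := mellin_gaussian_kap (Finset.mem_Ici.2 (le_refl m)) (𝓕 φ) h0 h1
  have hmel := mellin_eq_of_inv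
    (a := fun l : ℝ => ∫ x : E d, (Real.exp (-Real.pi * (l * x m ^ 2)) : ℂ) * φ x ∂kap (.Iic m))
    (b := fun l : ℝ => ∫ x : E d, (Real.exp (-Real.pi * (l * x m ^ 2)) : ℂ) * 𝓕 φ x ∂kap (.Ici m))
    (fun l hl => gaussian_kap_Iic m φ hl) σ
  have h2 := A.symm.trans (hmel.trans B)
  rw [neg_sub] at h2
  linear_combination h2 / 2

/-! ### Radial integrals -/

lemma lintegral_fun_norm {F : Type*} [NormedAddCommGroup F] [NormedSpace ℝ F] [Nontrivial F]
    [FiniteDimensional ℝ F] [MeasurableSpace F] [BorelSpace F] (μ : Measure F)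
    [μ.IsAddHaarMeasure] {f : ℝ → ℝ≥0∞} (hf : Measurable f) :
    ∫⁻ x, f ‖x‖ ∂μ = μ.toSphere univ *
      ∫⁻ y in Ioi (0 : ℝ), ENNReal.ofReal (y ^ (Module.finrank ℝ F - 1)) * f y := by
  have hfs : Measurable fun r : Ioi (0 : ℝ) => f r := hf.comp measurable_subtype_coe
  calc ∫⁻ x, f ‖x‖ ∂μ = ∫⁻ x : ({(0)}ᶜ : Set F), f ‖x.1‖ ∂(μ.comap (↑)) := by
        rw [lintegral_subtype_comap (measurableSet_singleton _).compl fun x => f ‖x‖,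
          restrict_compl_singleton]
    _ = ∫⁻ x, f x.2 ∂μ.toSphere.prod (.volumeIoiPow (Module.finrank ℝ F - 1)) := by
        have h := μ.measurePreserving_homeomorphUnitSphereProd.lintegral_comp
          (f := fun x => f x.2) (hfs.comp measurable_snd)
        rw [← h]
        simp
    _ = μ.toSphere univ * ∫⁻ x : Ioi (0 : ℝ), f x ∂.volumeIoiPow (Module.finrank ℝ F - 1) := by
        have hm : Measurable fun x : Metric.sphere (0 : F) 1 × Ioi (0 : ℝ) => f x.2 :=
          hfs.comp measurable_snd
        rw [lintegral_prod _ hm.aemeasurable]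
        simp [mul_comm]
    _ = _ := by
        rw [Measure.volumeIoiPow, lintegral_withDensity_eq_lintegral_mul _ (by fun_prop) hfs]
        congr 1
        exact lintegral_subtype_comap measurableSet_Ioi
          fun r : ℝ => ENNReal.ofReal (r ^ (Module.finrank ℝ F - 1)) * f r

/-- Extension by zero of the coordinates outside `S`. -/
def extendZero {d : ℕ} (S : Finset (Fin d)) (u : S → ℝ) : Fin d → ℝ :=
  fun i => if h : i ∈ S then u ⟨i, h⟩ else 0

lemma map_extendZero {d : ℕ} (S : Finset (Fin d)) :
    (volume : Measure (S → ℝ)).map (extendZero S) =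
      Measure.pi fun i => if i ∈ S then (volume : Measure ℝ) else Measure.dirac 0 := by
  have hm : Measurable (extendZero S) := by
    refine measurable_pi_lambda _ fun i => ?_
    by_cases h : i ∈ S
    · simp only [extendZero, h, dif_pos]; fun_prop
    · simp only [extendZero, h, dif_neg, not_false_eq_true]; fun_prop
  refine (Measure.pi_eq fun s hs => ?_).symm
  rw [Measure.map_apply hm (MeasurableSet.univ_pi hs)]
  have h1 : ∀ i ∈ S, (if i ∈ S then (volume : Measure ℝ) else Measure.dirac 0) (s i) =
      volume (s i) := fun i hi => by rw [if_pos hi]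
  have h2 : ∀ i ∈ Sᶜ, (if i ∈ S then (volume : Measure ℝ) else Measure.dirac 0) (s i) =
      (s i).indicator 1 0 := fun i hi => by
    rw [if_neg (Finset.mem_compl.1 hi), Measure.dirac_apply' _ (hs i)]
  rw [← Finset.prod_mul_prod_compl S, Finset.prod_congr rfl h1, Finset.prod_congr rfl h2]
  by_cases h : ∀ i ∈ Sᶜ, (0 : ℝ) ∈ s i
  · have e : extendZero S ⁻¹' univ.pi s = univ.pi fun i : S => s i := by
      ext u
      simp only [mem_preimage, mem_univ_pi, extendZero]
      constructor
      · intro H i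
        simpa [i.2] using H i
      · intro H i
        by_cases hi : i ∈ S
        · simpa [hi] using H ⟨i, hi⟩
        · simpa [hi] using h i (Finset.mem_compl.2 hi)
    rw [e, volume_pi_pi, Finset.prod_eq_one (s := Sᶜ), mul_one]
    · exact Finset.prod_coe_sort S fun i => volume (s i)
    · intro i hi
      simp [h i hi]
  · push Not at h
    obtain ⟨i, hi, h0⟩ := h
    have e : extendZero S ⁻¹' univ.pi s = ∅ := by
      ext u
      simp only [mem_preimage, mem_univ_pi, mem_empty_iff_false, iff_false, not_forall]
      exact ⟨i, by simpa [extendZero, Finset.mem_compl.1 hi] using h0⟩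
    rw [e, measure_empty, Finset.prod_eq_zero hi (by simp [h0]), mul_zero]

lemma norm_extendZero {d : ℕ} (S : Finset (Fin d)) (u : S → ℝ) :
    ‖(WithLp.toLp 2 (extendZero S u) : E d)‖ = ‖(WithLp.toLp 2 u : EuclideanSpace ℝ S)‖ := by
  rw [EuclideanSpace.norm_eq, EuclideanSpace.norm_eq]
  congr 1
  rw [← Finset.sum_subset (Finset.subset_univ S), ← Finset.sum_coe_sort S]
  · refine Finset.sum_congr rfl fun i _ => ?_
    simp [extendZero]
  · intro i _ hi
    simp [extendZero, hi]

lemma lintegral_norm_kap {d : ℕ} (S : Finset (Fin d)) {f : ℝ → ℝ≥0∞} (hf : Measurable f) :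
    ∫⁻ x, f ‖x‖ ∂kap S = ∫⁻ u : EuclideanSpace ℝ S, f ‖u‖ := by
  have hm : Measurable (extendZero S) := by
    refine measurable_pi_lambda _ fun i => ?_
    by_cases h : i ∈ S
    · simp only [extendZero, h, dif_pos]; fun_prop
    · simp only [extendZero, h, dif_neg, not_false_eq_true]; fun_prop
  rw [kap, ← map_extendZero,
    Measure.map_map (measurableEmbedding_toLp d).measurable hm,
    lintegral_map (by fun_prop) ((measurableEmbedding_toLp d).measurable.comp hm),
    ← (PiLp.volume_preserving_toLp S).lintegral_comp (by fun_prop)]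
  simp only [Function.comp, norm_extendZero]

lemma toSphere_univ_euclidean {ι : Type*} [Fintype ι] [Nonempty ι] {n : ℕ}
    (h : Fintype.card ι = n + 1) :
    (volume : Measure (EuclideanSpace ℝ ι)).toSphere univ = ENNReal.ofReal (sphereArea n) := by
  rw [sphereArea, ofReal_measureReal, Measure.toSphere_apply_univ, Measure.toSphere_apply_univ,
    EuclideanSpace.volume_ball, EuclideanSpace.volume_ball, finrank_euclideanSpace,
    finrank_euclideanSpace, h, Fintype.card_fin]

lemma sphereArea_pos (n : ℕ) : 0 < sphereArea n := by
  rw [sphereArea, Measure.real, ENNReal.toReal_pos_iff]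
  refine ⟨?_, measure_lt_top _ _⟩
  rw [pos_iff_ne_zero, Ne, Measure.measure_univ_eq_zero]
  exact Measure.toSphere_ne_zero _

lemma sphereArea_zero : sphereArea 0 = 2 := by
  rw [sphereArea, Measure.toSphere_real_apply_univ, Measure.real, EuclideanSpace.volume_ball]
  simp
  rw [show (2 : ℝ)⁻¹ + 1 = 1 / 2 + 1 by norm_num, Real.Gamma_add_one (by norm_num),
    Real.Gamma_one_half_eq]
  rw [ENNReal.toReal_ofReal (by positivity)]
  field_simp

lemma lintegral_radial_kap {d n : ℕ} {S : Finset (Fin d)} {p : Fin d} (hn : S.card = n + 1)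
    {f : ℝ → ℝ≥0∞} (hf : Measurable f) :
    ∫⁻ x, f ‖x‖ ∂kap S =
      ENNReal.ofReal (sphereArea n / 2) * ∫⁻ x, ENNReal.ofReal (‖x‖ ^ n) * f ‖x‖ ∂kap {p} := by
  have hS : Nonempty S := by
    have : S.Nonempty := Finset.card_pos.1 (by omega)
    exact this.to_subtype
  have hg : Measurable fun t : ℝ => ENNReal.ofReal (t ^ n) * f t := by fun_prop
  rw [lintegral_norm_kap S hf, lintegral_norm_kap {p} hg, lintegral_fun_norm _ hf,
    lintegral_fun_norm _ hg, toSphere_univ_euclidean (n := n) (by simpa using hn),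
    toSphere_univ_euclidean (n := 0) (by simp), finrank_euclideanSpace, finrank_euclideanSpace,
    sphereArea_zero, ← mul_assoc, ← ENNReal.ofReal_mul (by have := sphereArea_pos n; positivity)]
  simp [hn]

/-! ### Isometries and coordinate subspaces -/

lemma kap_ae_eq_zero {d : ℕ} (S : Finset (Fin d)) : ∀ᵐ x : E d ∂kap S, ∀ i ∉ S, x i = 0 := by
  rw [ae_all_iff]
  intro i
  rw [kap, (measurableEmbedding_toLp d).ae_map_iff]
  by_cases hi : i ∈ S
  · exact Eventually.of_forall fun x h => absurd hi h
  · have h : ∀ᵐ t ∂(if i ∈ S then (volume : Measure ℝ) else Measure.dirac 0), t = 0 := by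
      rw [if_neg hi]
      exact (ae_dirac_iff (measurableSet_singleton 0)).2 rfl
    filter_upwards [(Measure.tendsto_eval_ae_ae (μ := fun i =>
      if i ∈ S then (volume : Measure ℝ) else Measure.dirac 0) (i := i)).eventually h] with x hx _
    exact hx

/-- The coordinate projection annihilating the coordinates outside `S`. -/
def coordProj {d : ℕ} (S : Finset (Fin d)) (x : E d) : E d :=
  WithLp.toLp 2 fun i => if i ∈ S then x i else 0

lemma measurable_coordProj {d : ℕ} (S : Finset (Fin d)) : Measurable (coordProj S) := by
  refine (measurableEmbedding_toLp d).measurable.comp (measurable_pi_lambda _ fun i => ?_)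
  split_ifs <;> fun_prop

lemma map_coordProj {d : ℕ} (S : Finset (Fin d)) :
    (((volume : Measure (E d)).restrict {x | ∀ i ∉ S, x i ∈ Icc (0 : ℝ) 1}).map (coordProj S)) =
      kap S := by
  have hms : MeasurableSet {x : E d | ∀ i ∉ S, x i ∈ Icc (0 : ℝ) 1} := by
    simp only [ofPred_forall]
    exact MeasurableSet.iInter fun i => MeasurableSet.iInter fun _ =>
      (by fun_prop : Measurable fun x : E d => x i) measurableSet_Icc
  have hpi : (WithLp.toLp 2 : (Fin d → ℝ) → E d) ⁻¹' {x | ∀ i ∉ S, x i ∈ Icc (0 : ℝ) 1} =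
      univ.pi fun i => if i ∈ S then univ else Icc (0 : ℝ) 1 := by
    ext x
    simp only [mem_preimage, mem_ofPred_eq, mem_univ_pi]
    refine forall_congr' fun i => ?_
    split_ifs with h <;> simp [h]
  have hi : ∀ i : Fin d, ((volume.restrict (if i ∈ S then univ else Icc (0 : ℝ) 1)).map
      fun t : ℝ => if i ∈ S then t else 0) =
      if i ∈ S then (volume : Measure ℝ) else Measure.dirac 0 := fun i => by
    split_ifs with h
    · simp
    · rw [Measure.map_const]; simp
  have : ∀ i : Fin d, SigmaFinite ((volume.restrict (if i ∈ S then univ else Icc (0 : ℝ) 1)).map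
      fun t : ℝ => if i ∈ S then t else 0) := fun i => by rw [hi]; infer_instance
  have h := Measure.pi_map_pi
    (μ := fun i : Fin d => (volume : Measure ℝ).restrict (if i ∈ S then univ else Icc (0 : ℝ) 1))
    (f := fun i t => if i ∈ S then t else 0)
    (fun i => by split_ifs <;> fun_prop)
  simp_rw [hi] at h
  rw [kap, ← h, ← (PiLp.volume_preserving_toLp (Fin d)).map_eq,
    (measurableEmbedding_toLp d).restrict_map, hpi, volume_pi, Measure.restrict_pi_pi,
    Measure.map_map (measurable_coordProj S) (measurableEmbedding_toLp d).measurable,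
    Measure.map_map (measurableEmbedding_toLp d).measurable]
  · rfl
  · refine measurable_pi_lambda _ fun i => ?_
    split_ifs <;> fun_prop

lemma isometry_apply_coord {d : ℕ} {S : Finset (Fin d)} (U : E d ≃ₗᵢ[ℝ] E d)
    (hU : ∀ i ∉ S, U (EuclideanSpace.single i 1) = EuclideanSpace.single i 1) (x : E d)
    {i : Fin d} (hi : i ∉ S) : U x i = x i := by
  have h := U.inner_map_map (EuclideanSpace.single i 1) x
  rw [hU i hi, EuclideanSpace.inner_single_left, EuclideanSpace.inner_single_left] at h
  simpa using h

lemma isometry_coordProj {d : ℕ} {S P : Finset (Fin d)} (hS : S ⊆ P) (U : E d ≃ₗᵢ[ℝ] E d)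
    (hU : ∀ i ∉ S, U (EuclideanSpace.single i 1) = EuclideanSpace.single i 1) (x : E d) :
    U (coordProj P x) = coordProj P (U x) := by
  have e : ∀ y : E d, coordProj P y = y - ∑ i ∈ Pᶜ, y i • EuclideanSpace.single i (1 : ℝ) := by
    intro y
    ext j
    by_cases hj : j ∈ P <;> simp [coordProj, hj, Finset.sum_apply, Pi.single_apply]
  rw [e, e, map_sub, map_sum]
  congr 1
  refine Finset.sum_congr rfl fun i hi => ?_
  have hi' : i ∉ S := fun h => Finset.mem_compl.1 hi (hS h)
  rw [map_smul, hU i hi', isometry_apply_coord U hU x hi']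

lemma isometry_eq_self {d : ℕ} {S : Finset (Fin d)} (U : E d ≃ₗᵢ[ℝ] E d)
    (hU : ∀ i ∉ S, U (EuclideanSpace.single i 1) = EuclideanSpace.single i 1) {x : E d}
    (hx : ∀ i ∈ S, x i = 0) : U x = x := by
  have e : x = ∑ i ∈ Sᶜ, x i • EuclideanSpace.single i (1 : ℝ) := by
    ext j
    by_cases hj : j ∈ S <;> simp [hj, Finset.sum_apply, Pi.single_apply, hx]
  rw [e, map_sum]
  exact Finset.sum_congr rfl fun i hi => by rw [map_smul, hU i (Finset.mem_compl.1 hi)]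

lemma map_isometry_kap {d : ℕ} {S P : Finset (Fin d)} (h : S ⊆ P ∨ Disjoint S P)
    (U : E d ≃ₗᵢ[ℝ] E d)
    (hU : ∀ i ∉ S, U (EuclideanSpace.single i 1) = EuclideanSpace.single i 1) :
    (kap P).map U = kap P := by
  rcases h with h | h
  · have hUm : Measurable U := U.continuous.measurable
    have hp : U ⁻¹' {x | ∀ i ∉ P, x i ∈ Icc (0 : ℝ) 1} = {x | ∀ i ∉ P, x i ∈ Icc (0 : ℝ) 1} := by
      ext x
      simp only [mem_preimage, mem_ofPred_eq]
      refine forall₂_congr fun i hi => ?_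
      rw [isometry_apply_coord U hU x fun hS => hi (h hS)]
    have hv : ((volume : Measure (E d)).restrict {x | ∀ i ∉ P, x i ∈ Icc (0 : ℝ) 1}).map U =
        (volume : Measure (E d)).restrict {x | ∀ i ∉ P, x i ∈ Icc (0 : ℝ) 1} := by
      have h1 := (U.toHomeomorph.measurableEmbedding.restrict_map volume
        {x | ∀ i ∉ P, x i ∈ Icc (0 : ℝ) 1})
      have h2 : (volume : Measure (E d)).map U.toHomeomorph = volume :=
        U.measurePreserving.map_eq
      rw [h2] at h1
      refine Eq.trans ?_ h1.symm
      exact congrArg (fun s => (volume.restrict s).map U) hp.symm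
    conv_lhs => rw [← map_coordProj, Measure.map_map hUm (measurable_coordProj P)]
    have : U ∘ coordProj P = coordProj P ∘ U := funext fun x => isometry_coordProj h U hU x
    rw [this, ← Measure.map_map (measurable_coordProj P) hUm, hv, map_coordProj]
  · have : (U : E d → E d) =ᵐ[kap P] id := by
      filter_upwards [kap_ae_eq_zero P] with x hx
      exact isometry_eq_self U hU fun i hi => hx i (Finset.disjoint_left.1 h hi)
    rw [Measure.map_congr this, Measure.map_id]

lemma exists_isometry_map_single {d : ℕ} {S : Finset (Fin d)} {p : Fin d} (hp : p ∈ S) {v : E d}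
    (hv : ∀ i ∉ S, v i = 0) : ∃ U : E d ≃ₗᵢ[ℝ] E d,
    (∀ i ∉ S, U (EuclideanSpace.single i 1) = EuclideanSpace.single i 1) ∧
      U v = ‖v‖ • EuclideanSpace.single p (1 : ℝ) := by
  refine ⟨(ℝ ∙ (v - ‖v‖ • EuclideanSpace.single p (1 : ℝ)))ᗮ.reflection, fun i hi => ?_, ?_⟩
  · refine Submodule.reflection_mem_subspace_eq_self ?_
    rw [Submodule.mem_orthogonal_singleton_iff_inner_right]
    have hip : i ≠ p := fun h => hi (h ▸ hp)
    rw [inner_sub_left, inner_smul_left, EuclideanSpace.inner_single_right,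
      EuclideanSpace.inner_single_right]
    simp [hv i hi, hip]
  · refine Submodule.reflection_sub ?_
    simp [norm_smul]

/-! ### Splitting off a column -/

lemma map_update_pi {n : ℕ} {Y : Type*} [MeasurableSpace Y] (μ ν : Fin n → Measure Y)
    [∀ i, SigmaFinite (μ i)] [∀ i, SigmaFinite (ν i)] (c : Fin n) [IsProbabilityMeasure (ν c)]
    (h : ∀ i, i ≠ c → ν i = μ i) :
    ((Measure.pi ν).prod (μ c)).map (fun q => Function.update q.1 c q.2) = Measure.pi μ := by
  have hm : Measurable fun q : (Fin n → Y) × Y => Function.update q.1 c q.2 := by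
    refine measurable_pi_lambda _ fun i => ?_
    by_cases hi : i = c
    · subst hi; simpa using measurable_snd
    · simp only [Function.update_of_ne hi]; fun_prop
  refine (Measure.pi_eq fun s hs => ?_).symm
  rw [Measure.map_apply hm (MeasurableSet.univ_pi hs)]
  have e : (fun q : (Fin n → Y) × Y => Function.update q.1 c q.2) ⁻¹' univ.pi s =
      (univ.pi (Function.update s c univ)) ×ˢ s c := by
    ext q
    simp only [mem_preimage, mem_univ_pi, mem_prod]
    constructor
    · refine fun H => ⟨fun i => ?_, by simpa using H c⟩
      by_cases hi : i = c
      · subst hi; simp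
      · simpa [hi] using H i
    · rintro ⟨H, hc⟩ i
      by_cases hi : i = c
      · subst hi; simpa using hc
      · simpa [hi] using H i
  rw [e, Measure.prod_prod, Measure.pi_pi, ← Finset.mul_prod_erase _ _ (Finset.mem_univ c),
    ← Finset.mul_prod_erase (a := c) _ (fun i => μ i (s i)) (Finset.mem_univ c), mul_comm]
  simp only [Function.update_self, measure_univ, one_mul]
  congr 1
  refine Finset.prod_congr rfl fun i hi => ?_
  rw [Function.update_of_ne (Finset.ne_of_mem_erase hi), h i (Finset.ne_of_mem_erase hi)]

lemma map_add_kap {d : ℕ} {R S : Finset (Fin d)} (h : Disjoint R S) :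
    ((kap R).prod (kap S)).map (fun q => q.1 + q.2) = kap (R ∪ S) := by
  set a : Finset (Fin d) → Fin d → Measure ℝ := fun S i =>
    if i ∈ S then (volume : Measure ℝ) else Measure.dirac 0 with ha
  have : ∀ S i, SigmaFinite (a S i) := fun S i => by simp only [ha]; infer_instance
  set pw : (Fin d → ℝ) × (Fin d → ℝ) → Fin d → ℝ := fun q i => if i ∈ S then q.2 i else q.1 i
    with hpw
  have hpm : Measurable pw := by
    refine measurable_pi_lambda _ fun i => ?_
    simp only [hpw]
    split_ifs <;> fun_prop
  have key : ((Measure.pi (a R)).prod (Measure.pi (a S))).map pw = Measure.pi (a (R ∪ S)) := by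
    refine (Measure.pi_eq fun s hs => ?_).symm
    rw [Measure.map_apply hpm (MeasurableSet.univ_pi hs)]
    have e : pw ⁻¹' univ.pi s = (univ.pi fun i => if i ∈ S then univ else s i) ×ˢ
        (univ.pi fun i => if i ∈ S then s i else univ) := by
      ext q
      simp only [hpw, mem_preimage, mem_univ_pi, mem_prod, ← forall_and]
      refine forall_congr' fun i => ?_
      split_ifs <;> simp
    rw [e, Measure.prod_prod, Measure.pi_pi, Measure.pi_pi, ← Finset.prod_mul_distrib]
    refine Finset.prod_congr rfl fun i _ => ?_
    by_cases hi : i ∈ S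
    · have hR : i ∉ R := fun hR => Finset.disjoint_left.1 h hR hi
      simp [ha, hi, hR]
    · by_cases hR : i ∈ R <;> simp [ha, hi, hR]
  have hL := (measurableEmbedding_toLp d).measurable
  have hae : (fun q : E d × E d => q.1 + q.2) =ᵐ[(kap R).prod (kap S)]
      fun q => WithLp.toLp 2 (pw (q.1.ofLp, q.2.ofLp)) := by
    have h1 := (Measure.quasiMeasurePreserving_fst (μ := kap R) (ν := kap S)).ae (kap_ae_eq_zero R)
    have h2 := (Measure.quasiMeasurePreserving_snd (μ := kap R) (ν := kap S)).ae (kap_ae_eq_zero S)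
    filter_upwards [h1, h2] with q h1 h2
    ext i
    by_cases hi : i ∈ S
    · have hR : i ∉ R := fun hR => Finset.disjoint_left.1 h hR hi
      simp [hpw, hi, h1 i hR]
    · simp [hpw, hi, h2 i hi]
  rw [Measure.map_congr hae]
  have hk : ∀ S : Finset (Fin d), kap S = (Measure.pi (a S)).map (WithLp.toLp 2) := fun _ => rfl
  rw [hk, hk, hk, ← key, Measure.map_prod_map _ _ hL hL, Measure.map_map hL hpm, Measure.map_map]
  · rfl
  · refine hL.comp (hpm.comp ?_)
    have := (MeasurableEquiv.toLp 2 (Fin d → ℝ)).symm.measurable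
    exact (this.comp measurable_fst).prodMk (this.comp measurable_snd)
  · exact hL.prodMap hL

/-! ### The QR decomposition of product measures -/

lemma map_isometry_pi_kap {d n : ℕ} {S : Finset (Fin d)} {P : Fin n → Finset (Fin d)}
    (h : ∀ j, S ⊆ P j ∨ Disjoint S (P j)) (U : E d ≃ₗᵢ[ℝ] E d)
    (hU : ∀ i ∉ S, U (EuclideanSpace.single i 1) = EuclideanSpace.single i 1) :
    (Measure.pi fun j => kap (P j)).map (fun Y j => U (Y j)) = Measure.pi fun j => kap (P j) := by
  have e : ∀ j, (kap (P j)).map U = kap (P j) := fun j => map_isometry_kap (h j) U hU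
  have : ∀ j, SigmaFinite ((kap (P j)).map U) := fun j => by rw [e]; infer_instance
  rw [Measure.pi_map_pi (f := fun _ => U) fun j => U.continuous.aemeasurable]
  simp_rw [e]

instance {d : ℕ} : IsProbabilityMeasure (kap (∅ : Finset (Fin d))) := by
  have : kap (∅ : Finset (Fin d)) =
      (Measure.pi fun _ => Measure.dirac (0 : ℝ)).map (WithLp.toLp 2) := by simp [kap]
  rw [this]
  exact Measure.isProbabilityMeasure_map (measurableEmbedding_toLp d).measurable.aemeasurable

lemma measurable_update_prod {n : ℕ} {Y : Type*} [MeasurableSpace Y] (c : Fin n) :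
    Measurable fun q : (Fin n → Y) × Y => Function.update q.1 c q.2 := by
  refine measurable_pi_lambda _ fun i => ?_
  by_cases hi : i = c
  · subst hi; simpa using measurable_snd
  · simp only [Function.update_of_ne hi]; fun_prop

lemma lintegral_split_column {d n : ℕ} (P : Fin n → Finset (Fin d)) (c : Fin n)
    {G : (Fin n → E d) → ℝ≥0∞} (hG : Measurable G) {R S : Finset (Fin d)} (hRS : Disjoint R S)
    (hc : P c = R ∪ S) :
    ∫⁻ Y, G Y ∂Measure.pi (fun j => kap (P j)) =
      ∫⁻ v, ∫⁻ T, G (Function.update T c (T c + v))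
        ∂Measure.pi (fun j => kap (Function.update P c R j)) ∂kap S := by
  set P₀ : Fin n → Finset (Fin d) := Function.update P c ∅ with hP₀
  have i0 : IsProbabilityMeasure (kap (P₀ c)) := by
    rw [hP₀, Function.update_self]; infer_instance
  have hup := measurable_update_prod (Y := E d) c
  have s1 := map_update_pi (fun j => kap (P j)) (fun j => kap (P₀ j)) c
    (fun i hi => by simp [hP₀, hi])
  have s2 := map_update_pi (fun j => kap (Function.update P c R j)) (fun j => kap (P₀ j)) c
    (fun i hi => by simp [hP₀, hi])
  have hadd : Measurable fun q : E d × E d => q.1 + q.2 := by fun_prop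
  have hup2 : ∀ v, Measurable fun T : Fin n → E d => Function.update T c (T c + v) := fun v =>
    hup.comp (g := fun q : (Fin n → E d) × E d => Function.update q.1 c q.2)
      (f := fun T => (T, T c + v)) (by fun_prop)
  have hGu : Measurable fun q : (Fin n → E d) × E d => G (Function.update q.1 c q.2) :=
    hG.comp hup
  have hj : Measurable fun q : (Fin n → E d) × E d × E d =>
      G (Function.update q.1 c (q.2.1 + q.2.2)) :=
    hG.comp (hup.comp (measurable_fst.prodMk (hadd.comp measurable_snd)))
  calc ∫⁻ Y, G Y ∂Measure.pi (fun j => kap (P j))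
      = ∫⁻ T, ∫⁻ x, G (Function.update T c x) ∂kap (P c) ∂Measure.pi fun j => kap (P₀ j) := by
        rw [← s1, lintegral_map hG hup, lintegral_prod _ hGu.aemeasurable]
    _ = ∫⁻ T, ∫⁻ v, ∫⁻ r, G (Function.update T c (r + v)) ∂kap R ∂kap S
          ∂Measure.pi fun j => kap (P₀ j) := by
        refine lintegral_congr fun T => ?_
        have hT : Measurable fun x => G (Function.update T c x) :=
          hG.comp (hup.comp measurable_prodMk_left)
        have hTa : Measurable fun q : E d × E d => G (Function.update T c (q.1 + q.2)) :=
          hT.comp hadd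
        rw [hc, ← map_add_kap hRS, lintegral_map hT hadd,
          lintegral_prod_symm _ hTa.aemeasurable]
    _ = ∫⁻ v, ∫⁻ T, ∫⁻ r, G (Function.update T c (r + v)) ∂kap R
          ∂(Measure.pi fun j => kap (P₀ j)) ∂kap S := by
        refine lintegral_lintegral_swap (Measurable.aemeasurable ?_)
        refine Measurable.lintegral_prod_right (f := fun (q : (Fin n → E d) × E d) (r : E d) =>
          G (Function.update q.1 c (r + q.2))) ?_
        exact hj.comp ((measurable_fst.comp measurable_fst).prodMk
          (measurable_snd.prodMk (measurable_snd.comp measurable_fst)))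
    _ = _ := by
        refine lintegral_congr fun v => ?_
        have hGv : Measurable fun T => G (Function.update T c (T c + v)) := hG.comp (hup2 v)
        have hGw : Measurable fun q : (Fin n → E d) × E d =>
            G (Function.update (Function.update q.1 c q.2) c (Function.update q.1 c q.2 c + v)) :=
          hGv.comp hup
        rw [← s2, lintegral_map hGv hup, lintegral_prod _ hGw.aemeasurable, Function.update_self]
        simp

/-- Triangularisation of one column. -/
lemma lintegral_triangularise_column {d n e : ℕ} (P : Fin n → Finset (Fin d)) (c : Fin n)
    {G : (Fin n → E d) → ℝ≥0∞} (hG : Measurable G) {R S : Finset (Fin d)} (hRS : Disjoint R S)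
    (hc : P c = R ∪ S) {p : Fin d} (hp : p ∈ S) (he : S.card = e + 1)
    (hP : ∀ j, j ≠ c → S ⊆ P j ∨ Disjoint S (P j))
    (hinv : ∀ U : E d ≃ₗᵢ[ℝ] E d,
      (∀ i ∉ S, U (EuclideanSpace.single i 1) = EuclideanSpace.single i 1) →
      ∀ Y, G (fun j => U (Y j)) = G Y) :
    ∫⁻ Y, G Y ∂Measure.pi (fun j => kap (P j)) =
      ∫⁻ Y, ENNReal.ofReal (sphereArea e / 2 * |Y c p| ^ e) * G Y
        ∂Measure.pi (fun j => kap (Function.update P c (R ∪ {p}) j)) := by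
  have hpR : p ∉ R := fun h => Finset.disjoint_left.1 hRS h hp
  have hRp : Disjoint R {p} := Finset.disjoint_singleton_right.2 hpR
  set μ := Measure.pi fun j => kap (Function.update P c R j) with hμ
  set h : E d → ℝ≥0∞ := fun v => ∫⁻ T, G (Function.update T c (T c + v)) ∂μ with hh
  have hup : Measurable fun q : E d × (Fin n → E d) => Function.update q.2 c (q.2 c + q.1) := by
    refine measurable_pi_lambda _ fun i => ?_
    by_cases hi : i = c
    · subst hi; simp only [Function.update_self]; fun_prop
    · simp only [Function.update_of_ne hi]; fun_prop
  have hhm : Measurable h := Measurable.lintegral_prod_right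
    (f := fun (v : E d) (T : Fin n → E d) => G (Function.update T c (T c + v))) (hG.comp hup)
  have key : ∀ v : E d, (∀ i ∉ S, v i = 0) →
      h v = h (‖v‖ • EuclideanSpace.single p (1 : ℝ)) := by
    intro v hv
    obtain ⟨U, hU, hUv⟩ := exists_isometry_map_single hp hv
    have hmp := map_isometry_pi_kap (P := Function.update P c R) (S := S) (fun j => by
      by_cases hj : j = c
      · subst hj; rw [Function.update_self]; exact Or.inr hRS.symm
      · rw [Function.update_of_ne hj]; exact hP j hj) U hU
    have hUm : Measurable fun (Y : Fin n → E d) j => U (Y j) :=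
      measurable_pi_lambda _ fun j => U.continuous.measurable.comp (measurable_pi_apply j)
    have hw : Measurable fun T : Fin n → E d =>
        G (Function.update T c (T c + ‖v‖ • EuclideanSpace.single p (1 : ℝ))) :=
      hG.comp (hup.comp measurable_prodMk_left)
    simp only [hh]
    conv_rhs => rw [hμ, ← hmp, lintegral_map hw hUm]
    refine lintegral_congr fun T => ?_
    rw [← hUv, ← map_add, ← hinv U hU]
    congr 1
    ext1 j
    by_cases hj : j = c
    · subst hj; simp
    · simp [hj]
  have hrad : Measurable fun t : ℝ => h (t • EuclideanSpace.single p (1 : ℝ)) :=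
    hhm.comp (by fun_prop)
  rw [lintegral_split_column P c hG hRS hc, lintegral_split_column
    (Function.update P c (R ∪ {p})) c (by
      have := hG
      fun_prop) hRp (by simp)]
  simp only [Function.update_idem, ← hμ]
  have e1 : ∫⁻ v, h v ∂kap S = ∫⁻ v, h (‖v‖ • EuclideanSpace.single p (1 : ℝ)) ∂kap S :=
    lintegral_congr_ae ((kap_ae_eq_zero S).mono key)
  refine e1.trans ((lintegral_radial_kap (p := p) he hrad).trans ?_)
  rw [← lintegral_const_mul _ (by fun_prop)]
  refine lintegral_congr_ae ?_
  filter_upwards [kap_ae_eq_zero {p}] with v hv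
  have hTp : ∀ᵐ T ∂μ, (T c) p = 0 := by
    have := (Measure.tendsto_eval_ae_ae (μ := fun j => kap (Function.update P c R j)) (i := c)).eventually
      (kap_ae_eq_zero (Function.update P c R c))
    filter_upwards [this] with T hT
    exact hT p (by simpa using hpR)
  have hnv : ‖v‖ = |v p| := by
    have : v = v p • EuclideanSpace.single p (1 : ℝ) := by
      ext i
      by_cases hi : i = p
      · subst hi; simp
      · simp [hi, hv i (by simpa using hi)]
    conv_lhs => rw [this]
    simp [norm_smul]
  have e2 : ∫⁻ T, ENNReal.ofReal (sphereArea e / 2 *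
        |(Function.update T c (T c + v) c) p| ^ e) * G (Function.update T c (T c + v)) ∂μ =
      ENNReal.ofReal (sphereArea e / 2 * |v p| ^ e) * h v := by
    have hGv : Measurable fun T => G (Function.update T c (T c + v)) :=
      hG.comp (hup.comp measurable_prodMk_left)
    simp only [hh]
    rw [← lintegral_const_mul _ hGv]
    refine lintegral_congr_ae ?_
    filter_upwards [hTp] with T hT
    simp [hT]
  rw [e2, ← mul_assoc, ← ENNReal.ofReal_mul (by have := sphereArea_pos e; positivity), hnv,
    key v fun i hi => hv i fun h => hi (by simp at h; exact h ▸ hp), hnv]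

/-- The coordinate subspaces of the columns of a block diagonal matrix with blocks of sizes `k` and
`d - k`, preceded by a full column. -/
def blockPat (d k : ℕ) : Fin (d + 1) → Finset (Fin d) :=
  Fin.cases Finset.univ fun j => if (j : ℕ) < k then Finset.univ.filter (fun i : Fin d => (i : ℕ) < k)
    else Finset.univ.filter (fun i : Fin d => k ≤ (i : ℕ))

/-- The coordinate subspaces of the columns of a matrix which is upper triangular in the first `m`
columns and lower triangular in the others, preceded by a full column. -/
def stagePat (d m : ℕ) : Fin (d + 1) → Finset (Fin d) :=
  Fin.cases Finset.univ fun j => if (j : ℕ) < m then Finset.Iic j else Finset.Ici j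

/-- The exponents of the diagonal entries in the block triangular decomposition. -/
def blockExp (k j : ℕ) : ℕ := if j < k then k - 1 - j else j - k

/-- The position of a column in the order in which the columns are triangularised. -/
def columnRank (d k j : ℕ) : ℕ := if j < k then j else d - 1 - j + k

/-- The pattern after the triangularisation of `n` columns. -/
def mixPat (d k n : ℕ) : Fin (d + 1) → Finset (Fin d) :=
  fun j => Fin.cases Finset.univ
    (fun i => if columnRank d k i < n then stagePat d k i.succ else blockPat d k i.succ) j

/-- The rows involved in the triangularisation of column `c`. -/
def pivotRows (d k : ℕ) (c : Fin d) : Finset (Fin d) :=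
  Finset.univ.filter fun i : Fin d =>
    ((c : ℕ) < k ∧ (c : ℕ) ≤ i ∧ (i : ℕ) < k) ∨ (k ≤ (c : ℕ) ∧ k ≤ (i : ℕ) ∧ (i : ℕ) ≤ c)

/-- The rows unaffected by the triangularisation of column `c`. -/
def freeRows (d k : ℕ) (c : Fin d) : Finset (Fin d) :=
  Finset.univ.filter fun i : Fin d =>
    ((c : ℕ) < k ∧ (i : ℕ) < c) ∨ (k ≤ (c : ℕ) ∧ (c : ℕ) < i)

lemma mem_pivotRows {d k : ℕ} {c i : Fin d} : i ∈ pivotRows d k c ↔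
    ((c : ℕ) < k ∧ (c : ℕ) ≤ i ∧ (i : ℕ) < k) ∨ (k ≤ (c : ℕ) ∧ k ≤ (i : ℕ) ∧ (i : ℕ) ≤ c) := by
  rw [pivotRows, Finset.mem_filter, and_iff_right (Finset.mem_univ i)]

lemma mem_freeRows {d k : ℕ} {c i : Fin d} : i ∈ freeRows d k c ↔
    ((c : ℕ) < k ∧ (i : ℕ) < c) ∨ (k ≤ (c : ℕ) ∧ (c : ℕ) < i) := by
  rw [freeRows, Finset.mem_filter, and_iff_right (Finset.mem_univ i)]

lemma mem_blockPat {d k : ℕ} {j i : Fin d} : i ∈ blockPat d k j.succ ↔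
    ((j : ℕ) < k ∧ (i : ℕ) < k) ∨ (k ≤ (j : ℕ) ∧ k ≤ (i : ℕ)) := by
  simp only [blockPat, Fin.cases_succ]
  split_ifs with h <;> rw [Finset.mem_filter, and_iff_right (Finset.mem_univ i)] <;> omega

lemma mem_stagePat {d k : ℕ} {j i : Fin d} : i ∈ stagePat d k j.succ ↔
    ((j : ℕ) < k ∧ (i : ℕ) ≤ j) ∨ (k ≤ (j : ℕ) ∧ (j : ℕ) ≤ i) := by
  simp only [stagePat, Fin.cases_succ]
  split_ifs with h
  · rw [Finset.mem_Iic, Fin.le_def]; omega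
  · rw [Finset.mem_Ici, Fin.le_def]; omega

lemma card_pivotRows {d k : ℕ} (hk : k ≤ d) (c : Fin d) :
    (pivotRows d k c).card = blockExp k c + 1 := by
  rw [← Finset.card_map Fin.valEmbedding]
  have : (pivotRows d k c).map Fin.valEmbedding =
      if (c : ℕ) < k then Finset.Ico (c : ℕ) k else Finset.Ico k ((c : ℕ) + 1) := by
    ext i
    rw [Finset.mem_map]
    constructor
    · rintro ⟨a, ha, rfl⟩
      rw [mem_pivotRows] at ha
      rw [Fin.valEmbedding_apply]
      split_ifs <;> rw [Finset.mem_Ico] <;> omega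
    · intro hi
      have hc := c.2
      have : i < d := by
        split_ifs at hi <;> rw [Finset.mem_Ico] at hi <;> omega
      refine ⟨⟨i, this⟩, ?_, rfl⟩
      rw [mem_pivotRows]
      split_ifs at hi <;> rw [Finset.mem_Ico] at hi <;> simp only <;> omega
  rw [this, blockExp]
  split_ifs <;> rw [Nat.card_Ico] <;> omega

lemma columnRank_injective {d k : ℕ} {i j : Fin d} (h : columnRank d k i = columnRank d k j) :
    i = j := by
  have := i.2
  have := j.2
  simp only [columnRank] at h
  ext
  split_ifs at h <;> omega

lemma exists_columnRank {d k n : ℕ} (hn : n < d) :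
    ∃ c : Fin d, columnRank d k c = n := by
  by_cases h : n < k
  · exact ⟨⟨n, hn⟩, by simp [columnRank, h]⟩
  · refine ⟨⟨d - 1 - n + k, by omega⟩, ?_⟩
    have : ¬ (d - 1 - n + k < k) := by omega
    simp only [columnRank, this, if_false]
    omega

/-- The density of the triangular decomposition. -/
def qrDensity (d k n : ℕ) (T : Fin (d + 1) → E d) : ℝ≥0∞ :=
  ∏ j : Fin d, if columnRank d k j < n then
    ENNReal.ofReal (sphereArea (blockExp k j) / 2 * |T j.succ j| ^ blockExp k j) else 1

lemma measurable_qrDensity (d k n : ℕ) : Measurable (qrDensity d k n) := by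
  refine Finset.measurable_fun_prod _ fun j _ => ?_
  split_ifs <;> fun_prop

lemma lintegral_qr_step {d k n : ℕ} (hk : k ≤ d) (hn : n < d)
    {G : (Fin (d + 1) → E d) → ℝ≥0∞} (hG : Measurable G)
    (hinv : ∀ U : E d ≃ₗᵢ[ℝ] E d, ∀ Y, G (fun j => U (Y j)) = G Y) :
    ∫⁻ Y, qrDensity d k n Y * G Y ∂Measure.pi (fun j => kap (mixPat d k n j)) =
      ∫⁻ Y, qrDensity d k (n + 1) Y * G Y ∂Measure.pi (fun j => kap (mixPat d k (n + 1) j)) := by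
  obtain ⟨c, hc⟩ := exists_columnRank (k := k) hn
  have hcd := c.2
  have hcS : c ∈ pivotRows d k c := by rw [mem_pivotRows]; omega
  have hRS : Disjoint (freeRows d k c) (pivotRows d k c) := by
    rw [Finset.disjoint_left]
    intro i
    rw [mem_freeRows, mem_pivotRows]
    omega
  have hu : blockPat d k c.succ = freeRows d k c ∪ pivotRows d k c := by
    ext i
    rw [Finset.mem_union, mem_freeRows, mem_pivotRows, mem_blockPat]
    omega
  have hup : stagePat d k c.succ = freeRows d k c ∪ {c} := by
    ext i
    rw [Finset.mem_union, mem_freeRows, mem_stagePat, Finset.mem_singleton, Fin.ext_iff]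
    omega
  have hmc : mixPat d k n c.succ = freeRows d k c ∪ pivotRows d k c := by simp [mixPat, hc, hu]
  have hupd : Function.update (mixPat d k n) c.succ (freeRows d k c ∪ {c}) = mixPat d k (n + 1) := by
    ext1 j
    refine Fin.cases ?_ (fun j => ?_) j
    · rw [Function.update_of_ne (Fin.succ_ne_zero c).symm]
      simp [mixPat]
    · by_cases hj : j = c
      · subst hj
        simp [mixPat, hc, hup]
      · rw [Function.update_of_ne (by simpa using hj)]
        have : columnRank d k j ≠ n := fun h => hj (columnRank_injective (h.trans hc.symm))
        have h2 : columnRank d k j < n ↔ columnRank d k j < n + 1 := by omega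
        simp [mixPat, h2]
  have hnS : ∀ j : Fin d, columnRank d k j < n → j ∉ pivotRows d k c := by
    intro j hj
    have := j.2
    rw [← hc] at hj
    rw [mem_pivotRows]
    simp only [columnRank] at hj
    split_ifs at hj <;> omega
  have hdens : ∀ Y, qrDensity d k (n + 1) Y =
      ENNReal.ofReal (sphereArea (blockExp k c) / 2 * |Y c.succ c| ^ blockExp k c) *
        qrDensity d k n Y := by
    intro Y
    have e := fun n => (Finset.mul_prod_erase Finset.univ (fun j : Fin d =>
      if columnRank d k j < n then ENNReal.ofReal (sphereArea (blockExp k j) / 2 *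
        |Y j.succ j| ^ blockExp k j) else 1) (Finset.mem_univ c)).symm
    rw [qrDensity, qrDensity, e, e, if_pos (by omega), if_neg (by omega), one_mul]
    congr 1
    refine Finset.prod_congr rfl fun j hj => ?_
    have : columnRank d k j ≠ n := fun h =>
      Finset.ne_of_mem_erase hj (columnRank_injective (h.trans hc.symm))
    have h2 : columnRank d k j < n + 1 ↔ columnRank d k j < n := by omega
    simp only [h2]
  have hm : Measurable fun Y => qrDensity d k n Y * G Y := (measurable_qrDensity d k n).mul hG
  rw [lintegral_triangularise_column (mixPat d k n) c.succ hm hRS hmc hcS (card_pivotRows hk c), hupd]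
  · simp_rw [hdens, mul_assoc]
  · intro j
    refine Fin.cases (fun _ => Or.inl ?_) (fun j hj => ?_) j
    · simp [mixPat]
    · have hjc : j ≠ c := by simpa using hj
      have hjc' : (j : ℕ) ≠ c := fun h => hjc (Fin.ext h)
      by_cases hr : columnRank d k j < n
      · right
        have hm : mixPat d k n j.succ = stagePat d k j.succ := by simp [mixPat, hr]
        rw [hm, Finset.disjoint_left]
        intro i
        have := j.2
        rw [← hc] at hr
        simp only [columnRank] at hr
        rw [mem_pivotRows, mem_stagePat]
        split_ifs at hr <;> omega
      · have hm : mixPat d k n j.succ = blockPat d k j.succ := by simp [mixPat, hr]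
        rw [hm]
        by_cases h1 : (c : ℕ) < k ↔ (j : ℕ) < k
        · left
          intro i
          rw [mem_pivotRows, mem_blockPat]
          omega
        · right
          rw [Finset.disjoint_left]
          intro i
          rw [mem_pivotRows, mem_blockPat]
          omega
  · intro U hU Y
    rw [hinv U Y]
    congr 1
    refine Finset.prod_congr rfl fun j _ => ?_
    split_ifs with hj
    · rw [isometry_apply_coord U hU _ (hnS j hj)]
    · rfl

lemma lintegral_qr {d k : ℕ} (hk : k ≤ d)
    {G : (Fin (d + 1) → E d) → ℝ≥0∞} (hG : Measurable G)
    (hinv : ∀ U : E d ≃ₗᵢ[ℝ] E d, ∀ Y, G (fun j => U (Y j)) = G Y) :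
    ∫⁻ Y, G Y ∂Measure.pi (fun j => kap (blockPat d k j)) =
      ∫⁻ Y, qrDensity d k d Y * G Y ∂Measure.pi (fun j => kap (stagePat d k j)) := by
  have h : ∀ n ≤ d, ∫⁻ Y, G Y ∂Measure.pi (fun j => kap (blockPat d k j)) =
      ∫⁻ Y, qrDensity d k n Y * G Y ∂Measure.pi (fun j => kap (mixPat d k n j)) := by
    intro n
    induction n with
    | zero =>
      intro _
      have : mixPat d k 0 = blockPat d k := by
        ext1 j
        refine Fin.cases ?_ (fun j => ?_) j <;> simp [mixPat, blockPat]
      rw [this]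
      simp [qrDensity]
    | succ n ih => exact fun hn => (ih (by omega)).trans (lintegral_qr_step hk hn hG hinv)
  rw [h d le_rfl]
  have : mixPat d k d = stagePat d k := by
    ext1 j
    refine Fin.cases ?_ (fun j => ?_) j
    · simp [mixPat, stagePat]
    · have : columnRank d k j < d := by simp only [columnRank]; split_ifs <;> omega
      simp [mixPat, this]
  rw [this]

/-! ### The orthogonal group -/

/-- The isometry of `ℝ^d` given by an orthogonal matrix. -/
def rotL {d : ℕ} (Q : Orth d) : E d ≃ₗᵢ[ℝ] E d :=
  Unitary.linearIsometryEquiv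
    ⟨Matrix.toEuclideanCLM (n := Fin d) (𝕜 := ℝ) Q, Unitary.map_mem _ Q.2⟩

lemma rotL_apply {d : ℕ} (Q : Orth d) (x : E d) :
    rotL Q x = Matrix.toEuclideanLin (Q : Matrix (Fin d) (Fin d) ℝ) x := rfl

lemma rotL_mul {d : ℕ} (Q R : Orth d) (x : E d) : rotL (Q * R) x = rotL Q (rotL R x) := by
  rw [rotL_apply, rotL_apply, rotL_apply, ← Matrix.coe_toEuclideanCLM_eq_toEuclideanLin,
    ← Matrix.coe_toEuclideanCLM_eq_toEuclideanLin, ← Matrix.coe_toEuclideanCLM_eq_toEuclideanLin,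
    Submonoid.coe_mul, map_mul]
  rfl

lemma exists_rotL {d : ℕ} (U : E d ≃ₗᵢ[ℝ] E d) : ∃ Q : Orth d, rotL Q = U := by
  obtain ⟨u, rfl⟩ := Unitary.linearIsometryEquiv.surjective U
  refine ⟨⟨(Matrix.toEuclideanCLM (n := Fin d) (𝕜 := ℝ)).symm u, ?_⟩, ?_⟩
  · exact Unitary.map_mem (Matrix.toEuclideanCLM (n := Fin d) (𝕜 := ℝ)).symm u.2
  · rw [rotL]
    congr 1
    exact Subtype.ext ((Matrix.toEuclideanCLM (n := Fin d) (𝕜 := ℝ)).apply_symm_apply _)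

lemma continuous_rotL {d : ℕ} : Continuous fun q : Orth d × E d => rotL q.1 q.2 := by
  have : (fun q : Orth d × E d => rotL q.1 q.2) = fun q =>
      WithLp.toLp 2 ((q.1 : Matrix (Fin d) (Fin d) ℝ).mulVec q.2.ofLp) := rfl
  rw [this]
  refine (PiLp.continuous_toLp 2 _).comp ?_
  exact (continuous_subtype_val.comp continuous_fst).matrix_mulVec
    ((PiLp.continuous_ofLp 2 _).comp continuous_snd)

attribute [irreducible] rotL

/-- Normalised Haar measure on the orthogonal group. -/
def haarO (d : ℕ) : Measure (Orth d) :=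
  Measure.haarMeasure (⊤ : TopologicalSpace.PositiveCompacts (Orth d))

instance (d : ℕ) : (haarO d).IsHaarMeasure := by unfold haarO; infer_instance

instance (d : ℕ) : IsProbabilityMeasure (haarO d) :=
  ⟨by have := Measure.haarMeasure_self (K₀ := (⊤ : TopologicalSpace.PositiveCompacts (Orth d)))
      simpa [haarO] using this⟩

instance (d : ℕ) : (haarO d).IsMulRightInvariant := by
  refine ⟨fun g => ?_⟩
  have : IsProbabilityMeasure ((haarO d).map (· * g)) :=
    Measure.isProbabilityMeasure_map (by fun_prop)
  exact Measure.isHaarMeasure_eq_of_isProbabilityMeasure _ _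

/-- The simultaneous rotation of all columns. -/
def rotX {d n : ℕ} (Q : Orth d) (Y : Fin n → E d) : Fin n → E d := fun j => rotL Q (Y j)

lemma continuous_rotX {d n : ℕ} : Continuous fun q : Orth d × (Fin n → E d) => rotX q.1 q.2 := by
  unfold rotX
  refine continuous_pi fun j => ?_
  exact continuous_rotL.comp (f := fun q : Orth d × (Fin n → E d) => (q.1, q.2 j)) (by fun_prop)

lemma lintegral_haar_qr {d k : ℕ} (hk : k ≤ d) {H : (Fin (d + 1) → E d) → ℝ≥0∞}
    (hH : Measurable H) :
    ∫⁻ q, H (rotX q.1 q.2) ∂(haarO d).prod (Measure.pi fun j => kap (blockPat d k j)) =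
      ∫⁻ q, qrDensity d k d q.2 * H (rotX q.1 q.2)
        ∂(haarO d).prod (Measure.pi fun j => kap (stagePat d k j)) := by
  have hHr : Measurable fun q : Orth d × (Fin (d + 1) → E d) => H (rotX q.1 q.2) :=
    hH.comp continuous_rotX.measurable
  have hG : Measurable fun Y : Fin (d + 1) → E d => ∫⁻ Q, H (rotX Q Y) ∂haarO d :=
    hHr.lintegral_prod_left'
  have hqH : Measurable fun q : Orth d × (Fin (d + 1) → E d) =>
      qrDensity d k d q.2 * H (rotX q.1 q.2) :=
    ((measurable_qrDensity d k d).comp measurable_snd).mul hHr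
  have hinv : ∀ U : E d ≃ₗᵢ[ℝ] E d, ∀ Y : Fin (d + 1) → E d,
      ∫⁻ Q, H (rotX Q fun j => U (Y j)) ∂haarO d = ∫⁻ Q, H (rotX Q Y) ∂haarO d := by
    intro U Y
    obtain ⟨R, rfl⟩ := exists_rotL U
    have : ∀ Q, rotX Q (fun j => rotL R (Y j)) = rotX (Q * R) Y := fun Q => by
      ext1 j
      exact (rotL_mul Q R (Y j)).symm
    simp_rw [this]
    exact lintegral_mul_right_eq_self (fun Q => H (rotX Q Y)) R
  have h := lintegral_qr hk hG hinv
  rw [lintegral_prod_symm _ hHr.aemeasurable, lintegral_prod_symm _ hqH.aemeasurable, h]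
  refine lintegral_congr fun Y => ?_
  exact (lintegral_const_mul (f := fun Q => H (rotX Q Y)) _
    (hHr.comp measurable_prodMk_right)).symm

lemma map_haar_qr {d k : ℕ} (hk : k ≤ d) :
    ((haarO d).prod (Measure.pi fun j => kap (blockPat d k j))).map (fun q => rotX q.1 q.2) =
      (((haarO d).prod (Measure.pi fun j => kap (stagePat d k j))).withDensity
        fun q => qrDensity d k d q.2).map (fun q => rotX q.1 q.2) := by
  ext s hs
  have hm := (continuous_rotX (d := d) (n := d + 1)).measurable
  have h := lintegral_haar_qr hk (H := s.indicator 1) (measurable_one.indicator hs)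
  rw [← lintegral_indicator_one hs, ← lintegral_indicator_one hs,
    lintegral_map (measurable_one.indicator hs) hm, lintegral_map (measurable_one.indicator hs) hm]
  refine h.trans ?_
  exact (lintegral_withDensity_eq_lintegral_mul _
      ((measurable_qrDensity d k d).comp measurable_snd)
      ((measurable_one.indicator hs).comp hm)).symm

/-! ### Holomorphic dependence on parameters -/

lemma differentiableAt_integral_of_dominated {α : Type*} [MeasurableSpace α] {μ : Measure α}
    {f : ℂ → α → ℂ} {s₀ : ℂ} {r : ℝ} (hr : 0 < r) {B : α → ℝ}
    (hm : ∀ s ∈ Metric.ball s₀ r, AEStronglyMeasurable (f s) μ)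
    (hd : ∀ᵐ a ∂μ, ∀ s ∈ Metric.ball s₀ r, DifferentiableAt ℂ (fun s => f s a) s)
    (hB : Integrable B μ) (hb : ∀ᵐ a ∂μ, ∀ s ∈ Metric.ball s₀ r, ‖f s a‖ ≤ B a) :
    DifferentiableAt ℂ (fun s => ∫ a, f s a ∂μ) s₀ := by
  have h0 : s₀ ∈ Metric.ball s₀ r := Metric.mem_ball_self hr
  refine (hasDerivAt_integral_of_dominated_loc_of_deriv_le (s := Metric.ball s₀ (r / 4))
    (F' := fun s a => deriv (fun s => f s a) s) (bound := fun a => B a / (r / 4))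
    (Metric.ball_mem_nhds s₀ (by positivity)) ?_ (hB.mono' (hm s₀ h0) (hb.mono fun a ha => ha s₀ h0))
    ?_ ?_ (hB.div_const _) ?_).2.differentiableAt
  · filter_upwards [Metric.ball_mem_nhds s₀ hr] with s hs using hm s hs
  · have hu : Tendsto (fun n : ℕ => s₀ + ((r / (n + 2) : ℝ) : ℂ)) atTop (𝓝[≠] s₀) := by
      refine tendsto_nhdsWithin_iff.2 ⟨?_, Eventually.of_forall fun n => ?_⟩
      · have h1 : Tendsto (fun n : ℕ => r / ((n : ℝ) + 2)) atTop (𝓝 0) :=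
          tendsto_const_nhds.div_atTop
            (tendsto_atTop_add_const_right _ _ tendsto_natCast_atTop_atTop)
        have h2 := (tendsto_const_nhds (x := s₀)).add
          ((Complex.continuous_ofReal.tendsto 0).comp h1)
        simpa using h2
      · have : r / ((n : ℝ) + 2) ≠ 0 := by positivity
        simpa using (by exact_mod_cast this : ((r / (n + 2) : ℝ) : ℂ) ≠ 0)
    refine aestronglyMeasurable_of_tendsto_ae atTop
      (f := fun (n : ℕ) a => slope (fun s => f s a) s₀ (s₀ + ((r / (n + 2) : ℝ) : ℂ)))
      (fun n => ?_) ?_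
    · simp only [slope_def_field, div_eq_mul_inv]
      refine AEStronglyMeasurable.mul_const ((hm _ ?_).sub (hm _ h0)) _
      rw [Metric.mem_ball, dist_self_add_left, Complex.norm_real, Real.norm_eq_abs,
        abs_of_pos (by positivity)]
      exact div_lt_self hr (by have : (0 : ℝ) ≤ n := Nat.cast_nonneg n; linarith)
    · filter_upwards [hd] with a ha
      exact (hasDerivAt_iff_tendsto_slope.1 (ha s₀ h0).hasDerivAt).comp hu
  · filter_upwards [hd, hb] with a ha hba s hs
    have hsub : Metric.closedBall s (r / 4) ⊆ Metric.ball s₀ r := by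
      refine Metric.closedBall_subset_ball' ?_
      have := Metric.mem_ball.1 hs
      linarith
    refine Complex.norm_deriv_le_of_forall_mem_sphere_norm_le (by positivity) ?_
      fun z hz => hba z (hsub (Metric.sphere_subset_closedBall hz))
    exact DifferentiableOn.diffContOnCl_ball
      (fun z hz => (ha z hz).differentiableWithinAt) hsub
  · filter_upwards [hd] with a ha s hs
    exact (ha s (Metric.ball_subset_ball (by linarith) hs)).hasDerivAt

/-! ### Weights -/

lemma norm_cpow_le {a : ℝ} {M : ℕ} {z : ℂ} (h1 : a ≤ z.re) (h2 : z.re ≤ M) (t : ℝ) :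
    ‖((|t| : ℝ) : ℂ) ^ z‖ ≤ |t| ^ a + (1 + |t|) ^ M := by
  rcases eq_or_ne t 0 with rfl | ht
  · have h3 : (0 : ℝ) ≤ 0 ^ a := Real.rpow_nonneg le_rfl a
    by_cases hz : z = 0
    · simp [hz, h3]
    · simp only [abs_zero, Complex.ofReal_zero, Complex.zero_cpow hz, norm_zero]
      positivity
  · have ht' : 0 < |t| := abs_pos.2 ht
    rw [Complex.norm_cpow_eq_rpow_re_of_pos ht']
    rcases le_total |t| 1 with h | h
    · have := Real.rpow_le_rpow_of_exponent_ge ht' h h1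
      have : 0 ≤ (1 + |t|) ^ M := by positivity
      linarith
    · have h3 := Real.rpow_le_rpow_of_exponent_le h h2
      have h4 : |t| ^ M ≤ (1 + |t|) ^ M := by gcongr; linarith
      have h5 : 0 ≤ |t| ^ a := by positivity
      rw [Real.rpow_natCast] at h3
      linarith

/-- The exponent of the `i`-th diagonal entry at stage `m`. -/
def stageExp (m : ℕ) (s : ℂ) (i : ℕ) : ℂ := if i < m then s - 1 - i else i - s

/-- The weight at stage `m`. -/
def stageWeight {d : ℕ} (m : ℕ) (s : ℂ) (T : Fin (d + 1) → E d) : ℂ :=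
  ∏ i : Fin d, ((|T i.succ i| : ℝ) : ℂ) ^ stageExp m s i

/-- The product of local factors at stage `m`. -/
def stageNorm (d m : ℕ) (s : ℂ) : ℂ := ∏ i : Fin d, gfac (stageExp m s i + 1)

/-- The measure on columns at stage `m`. -/
def stageMeasure (d m : ℕ) : Measure (Orth d × (Fin (d + 1) → E d)) :=
  (haarO d).prod (Measure.pi fun j => kap (stagePat d m j))

/-- The function dominating the weighted Schwartz functions. -/
def dominator {d : ℕ} (a : ℝ) (M : ℕ) (T : Fin (d + 1) → E d) : ℝ :=
  (∏ i : Fin d, (|T i.succ i| ^ a + (1 + |T i.succ i|) ^ M)) *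
    ∏ j, ∏ i, ((1 + |T j i|) ^ (M + 2))⁻¹

lemma dominator_nonneg {d : ℕ} (a : ℝ) (M : ℕ) (T : Fin (d + 1) → E d) : 0 ≤ dominator a M T := by
  unfold dominator
  positivity

lemma integrable_dominator {d m M : ℕ} {a : ℝ} (ha : -1 < a) (haM : a ≤ M) :
    Integrable (fun q : Orth d × (Fin (d + 1) → E d) => dominator a M q.2) (stageMeasure d m) := by
  have h1 : Integrable (fun t : ℝ => ((1 + |t|) ^ (M + 2))⁻¹) := by
    simpa using integrable_abs_rpow_mul (a := 0) (by norm_num) (K := M + 2)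
      (by push_cast; have : (0 : ℝ) ≤ M := Nat.cast_nonneg M; linarith)
  have h2 : Integrable (fun t : ℝ => (|t| ^ a + (1 + |t|) ^ M) * ((1 + |t|) ^ (M + 2))⁻¹) := by
    simp_rw [add_mul]
    refine (integrable_abs_rpow_mul ha (by push_cast; linarith)).add ?_
    refine integrable_one_add_abs_inv_sq.congr (Eventually.of_forall fun t => ?_)
    have : (1 + |t|) ^ M ≠ 0 := by positivity
    simp only
    rw [pow_add, mul_inv, ← mul_assoc, mul_inv_cancel₀ this, one_mul]
  set u : Fin (d + 1) → Fin d → ℝ → ℝ := fun j i t =>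
    (if j = i.succ then |t| ^ a + (1 + |t|) ^ M else 1) * ((1 + |t|) ^ (M + 2))⁻¹ with hu
  have hcol : ∀ j, Integrable (fun x : E d => ∏ i, u j i (x i)) (kap (stagePat d m j)) := fun j =>
    integrable_kap_prod _ _ fun i _ => by
      simp only [hu]
      split_ifs
      · exact h2
      · simpa using h1
  have h := Integrable.fintype_prod (μ := fun j => kap (stagePat d m j))
    (f := fun j (x : E d) => ∏ i, u j i (x i)) hcol
  have e : ∀ T : Fin (d + 1) → E d, dominator a M T = ∏ j, ∏ i, u j i (T j i) := fun T => by
    simp only [hu, Finset.prod_mul_distrib, dominator]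
    congr 1
    rw [Finset.prod_comm]
    refine Finset.prod_congr rfl fun i _ => ?_
    rw [Finset.prod_ite_eq' Finset.univ i.succ (fun j => |T j i| ^ a + (1 + |T j i|) ^ M)]
    simp
  simp_rw [e, stageMeasure]
  exact h.comp_snd _

lemma measurable_stageWeight {d : ℕ} (m : ℕ) (s : ℂ) :
    Measurable (stageWeight m s : (Fin (d + 1) → E d) → ℂ) := by
  unfold stageWeight
  fun_prop

lemma norm_stageWeight_le {d m M : ℕ} {a : ℝ} {s : ℂ} (h1 : ∀ i : Fin d, a ≤ (stageExp m s i).re)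
    (h2 : ∀ i : Fin d, (stageExp m s i).re ≤ M) (T : Fin (d + 1) → E d) :
    ‖stageWeight m s T‖ ≤ ∏ i : Fin d, (|T i.succ i| ^ a + (1 + |T i.succ i|) ^ M) := by
  rw [stageWeight, norm_prod]
  exact Finset.prod_le_prod (fun _ _ => norm_nonneg _) fun i _ => norm_cpow_le (h1 i) (h2 i) _

lemma norm_rotX {d n : ℕ} (Q : Orth d) (Y : Fin n → E d) : ‖rotX Q Y‖ = ‖Y‖ := by
  simp [rotX, Pi.norm_def]

lemma norm_schwartz_rotX_le {d : ℕ} (N : ℕ) (ψ : 𝓢(Fin (d + 1) → E d, ℂ)) (Q : Orth d)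
    (T : Fin (d + 1) → E d) :
    ‖ψ (rotX Q T)‖ ≤ 2 ^ (N * d * (d + 1)) * (Finset.Iic (N * d * (d + 1), 0)).sup
      (schwartzSeminormFamily ℂ (Fin (d + 1) → E d) ℂ) ψ * ∏ j, ∏ i, ((1 + |T j i|) ^ N)⁻¹ := by
  have h := one_add_le_sup_seminorm_apply (𝕜 := ℂ) (m := (N * d * (d + 1), 0)) le_rfl le_rfl ψ
    (rotX Q T)
  rw [norm_iteratedFDeriv_zero, norm_rotX] at h
  have hp : ∏ j, ∏ i, (1 + |T j i|) ^ N ≤ (1 + ‖T‖) ^ (N * d * (d + 1)) := by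
    have h1 : ∀ j i, (1 + |T j i|) ^ N ≤ (1 + ‖T‖) ^ N := fun j i => by
      have h2 : |T j i| ≤ ‖T j‖ := PiLp.norm_apply_le (T j) i
      have h3 := norm_le_pi_norm T j
      gcongr
      linarith
    refine (Finset.prod_le_prod (fun j _ => by positivity) fun j _ =>
      Finset.prod_le_prod (fun i _ => by positivity) fun i _ => h1 j i).trans (le_of_eq ?_)
    simp [← pow_mul]
  have hpos : 0 < ∏ j, ∏ i, (1 + |T j i|) ^ N := by positivity
  simp only [Finset.prod_inv_distrib]
  rw [← div_eq_mul_inv, le_div_iff₀ hpos, mul_comm]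
  exact (mul_le_mul_of_nonneg_right hp (norm_nonneg _)).trans h

/-! ### The stage functionals -/

lemma continuous_stageExp (m i : ℕ) : Continuous fun s => stageExp m s i := by
  unfold stageExp
  split_ifs <;> fun_prop

lemma exists_stageExp_bounds {d m : ℕ} {s : ℂ} (h : ∀ i : Fin d, -1 < (stageExp m s i).re) :
    ∃ (a : ℝ) (M : ℕ) (r : ℝ), -1 < a ∧ a ≤ M ∧ 0 < r ∧ ∀ z ∈ Metric.ball s r, ∀ i : Fin d,
      a ≤ (stageExp m z i).re ∧ (stageExp m z i).re ≤ M := by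
  have h1 : ∀ᶠ a : ℝ in 𝓝[>] (-1), a ∈ Ioo (-1 : ℝ) 0 ∧ ∀ i : Fin d, a < (stageExp m s i).re :=
    Eventually.and (Ioo_mem_nhdsGT (by norm_num : (-1 : ℝ) < 0)) (eventually_all.2 fun i =>
      (eventually_lt_nhds (h i)).filter_mono nhdsWithin_le_nhds)
  obtain ⟨a, ⟨ha, ha0⟩, hai⟩ := h1.exists
  have h2 : ∀ᶠ M : ℕ in atTop, ∀ i : Fin d, (stageExp m s i).re < M :=
    eventually_all.2 fun i => tendsto_natCast_atTop_atTop.eventually_gt_atTop _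
  obtain ⟨M, hM⟩ := h2.exists
  have h3 : ∀ᶠ z in 𝓝 s, ∀ i : Fin d, a ≤ (stageExp m z i).re ∧ (stageExp m z i).re ≤ M := by
    refine eventually_all.2 fun i => ?_
    have hc : Tendsto (fun z => (stageExp m z i).re) (𝓝 s) (𝓝 (stageExp m s i).re) :=
      (Complex.continuous_re.comp (continuous_stageExp m i)).tendsto s
    filter_upwards [hc.eventually_const_lt (hai i), hc.eventually_lt_const (hM i)] with z h4 h5
    exact ⟨h4.le, h5.le⟩
  obtain ⟨r, hr, hz⟩ := Metric.eventually_nhds_iff_ball.1 h3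
  exact ⟨a, M, r, ha, ha0.le.trans (Nat.cast_nonneg M), hr, hz⟩

/-- The integrand of the stage functionals. -/
def stageIntegrand {d : ℕ} (m : ℕ) (s : ℂ) (ψ : (Fin (d + 1) → E d) → ℂ)
    (q : Orth d × (Fin (d + 1) → E d)) : ℂ :=
  stageWeight m s q.2 * ψ (rotX q.1 q.2)

lemma measurable_stageIntegrand {d : ℕ} (m : ℕ) (s : ℂ) {ψ : (Fin (d + 1) → E d) → ℂ}
    (hψ : Measurable ψ) : Measurable (stageIntegrand m s ψ) :=
  ((measurable_stageWeight m s).comp measurable_snd).mul (hψ.comp continuous_rotX.measurable)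

lemma norm_stageIntegrand_le {d m M : ℕ} {a : ℝ} {s : ℂ}
    (h : ∀ i : Fin d, a ≤ (stageExp m s i).re ∧ (stageExp m s i).re ≤ M)
    (ψ : 𝓢(Fin (d + 1) → E d, ℂ)) (q : Orth d × (Fin (d + 1) → E d)) :
    ‖stageIntegrand m s ψ q‖ ≤ 2 ^ ((M + 2) * d * (d + 1)) *
      (Finset.Iic ((M + 2) * d * (d + 1), 0)).sup
        (schwartzSeminormFamily ℂ (Fin (d + 1) → E d) ℂ) ψ * dominator a M q.2 := by
  rw [stageIntegrand, norm_mul, dominator]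
  refine (mul_le_mul (norm_stageWeight_le (fun i => (h i).1) (fun i => (h i).2) q.2)
    (norm_schwartz_rotX_le (M + 2) ψ q.1 q.2) (norm_nonneg _) (by positivity)).trans (le_of_eq ?_)
  ring

lemma integrable_stageIntegrand {d m : ℕ} {s : ℂ} (h : ∀ i : Fin d, -1 < (stageExp m s i).re)
    (ψ : 𝓢(Fin (d + 1) → E d, ℂ)) : Integrable (stageIntegrand m s ψ) (stageMeasure d m) := by
  obtain ⟨a, M, r, ha, haM, hr, hb⟩ := exists_stageExp_bounds h
  exact ((integrable_dominator ha haM).const_mul _).mono'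
    (measurable_stageIntegrand m s ψ.continuous.measurable).aestronglyMeasurable
    (Eventually.of_forall fun q =>
      norm_stageIntegrand_le (hb s (Metric.mem_ball_self hr)) ψ q)

/-- The stage functional, as a continuous linear form. -/
def stageCLM {d m : ℕ} {s : ℂ} (h : ∀ i : Fin d, -1 < (stageExp m s i).re) :
    𝓢(Fin (d + 1) → E d, ℂ) →L[ℂ] ℂ :=
  mkCLMtoNormedSpace (σ := RingHom.id ℂ)
    (fun ψ => ∫ q, stageIntegrand m s ψ q ∂stageMeasure d m)
    (fun f g => by
      rw [← integral_add (integrable_stageIntegrand h f) (integrable_stageIntegrand h g)]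
      simp [stageIntegrand, mul_add])
    (fun a f => by
      rw [RingHom.id_apply, smul_eq_mul, ← integral_const_mul]
      simp [stageIntegrand, mul_left_comm])
    (by
      obtain ⟨a, M, r, ha, haM, hr, hb⟩ := exists_stageExp_bounds h
      have hD : 0 ≤ ∫ q : Orth d × (Fin (d + 1) → E d), dominator a M q.2 ∂stageMeasure d m :=
        integral_nonneg fun q => dominator_nonneg a M q.2
      refine ⟨Finset.Iic ((M + 2) * d * (d + 1), 0), 2 ^ ((M + 2) * d * (d + 1)) *
        ∫ q : Orth d × (Fin (d + 1) → E d), dominator a M q.2 ∂stageMeasure d m,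
        mul_nonneg (by positivity) hD, fun ψ => ?_⟩
      refine (norm_integral_le_of_norm_le ((integrable_dominator ha haM).const_mul _)
        (Eventually.of_forall fun q =>
          norm_stageIntegrand_le (hb s (Metric.mem_ball_self hr)) ψ q)).trans (le_of_eq ?_)
      rw [integral_const_mul]
      ring)

lemma self_mem_stagePat {d m : ℕ} (i : Fin d) : i ∈ stagePat d m i.succ := by
  rw [mem_stagePat]
  omega

lemma stageMeasure_ae_ne {d m : ℕ} : ∀ᵐ q ∂stageMeasure d m, ∀ i : Fin d, q.2 i.succ i ≠ 0 := by
  refine ae_all_iff.2 fun i => ?_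
  have h : ∀ᵐ T : Fin (d + 1) → E d ∂Measure.pi (fun j => kap (stagePat d m j)),
      T i.succ i ≠ 0 :=
    (Measure.tendsto_eval_ae_ae (μ := fun j => kap (stagePat d m j)) (i := i.succ)).eventually
      (kap_ae_ne (self_mem_stagePat i))
  exact (Measure.quasiMeasurePreserving_snd (μ := haarO d)).ae h

lemma differentiableAt_stage {d m : ℕ} {s : ℂ} (h : ∀ i : Fin d, -1 < (stageExp m s i).re)
    (ψ : 𝓢(Fin (d + 1) → E d, ℂ)) :
    DifferentiableAt ℂ (fun s => ∫ q, stageIntegrand m s ψ q ∂stageMeasure d m) s := by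
  obtain ⟨a, M, r, ha, haM, hr, hb⟩ := exists_stageExp_bounds h
  refine differentiableAt_integral_of_dominated hr (fun z _ =>
    (measurable_stageIntegrand m z ψ.continuous.measurable).aestronglyMeasurable) ?_
    ((integrable_dominator (m := m) ha haM).const_mul _)
    (Eventually.of_forall fun q z hz => norm_stageIntegrand_le (hb z hz) ψ q)
  filter_upwards [stageMeasure_ae_ne] with q hq z _
  simp only [stageIntegrand, stageWeight]
  refine DifferentiableAt.mul_const ?_ _
  refine DifferentiableAt.fun_finsetProd fun i _ => ?_
  refine DifferentiableAt.const_cpow ?_ (Or.inl (by simpa using hq i))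
  unfold stageExp
  split_ifs <;> fun_prop

/-! ### Passing from one stage to the next -/

/-- The composition of a function of one column with an isometry. -/
lemma fourier_comp_rotL {d : ℕ} (Q : Orth d) (h : 𝓢(E d, ℂ)) (ξ : E d) :
    𝓕 (compCLMOfContinuousLinearEquiv ℂ (rotL Q).toContinuousLinearEquiv h) ξ =
      𝓕 h (rotL Q ξ) := by
  rw [fourier_coe, fourier_coe, ← Real.fourier_comp_linearIsometry]
  rfl

lemma rotX_update {d n : ℕ} (Q : Orth d) (T : Fin n → E d) (c : Fin n) (x : E d) :
    rotX Q (Function.update T c x) = Function.update (rotX Q T) c (rotL Q x) := by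
  ext1 j
  by_cases hj : j = c
  · subst hj; simp [rotX]
  · simp [rotX, hj]

lemma integral_split_column {d n : ℕ} (P : Fin n → Finset (Fin d)) (c : Fin n)
    {F : Orth d × (Fin n → E d) → ℂ} (hF : Measurable F)
    (hi : Integrable F ((haarO d).prod (Measure.pi fun j => kap (P j)))) :
    ∫ q, F q ∂(haarO d).prod (Measure.pi fun j => kap (P j)) =
      ∫ r, ∫ x, F (r.1, Function.update r.2 c x) ∂kap (P c)
        ∂(haarO d).prod (Measure.pi fun j => kap (Function.update P c ∅ j)) := by
  have i0 : IsProbabilityMeasure (kap (Function.update P c ∅ c)) := by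
    rw [Function.update_self]; infer_instance
  have s1 : MeasurePreserving (fun q : (Fin n → E d) × E d => Function.update q.1 c q.2)
      ((Measure.pi fun j => kap (Function.update P c ∅ j)).prod (kap (P c)))
      (Measure.pi fun j => kap (P j)) :=
    ⟨measurable_update_prod c, map_update_pi (fun j => kap (P j))
      (fun j => kap (Function.update P c ∅ j)) c (fun i hi => by simp [hi])⟩
  have s2 := ((MeasurePreserving.id (haarO d)).prod s1).comp
    (measurePreserving_prodAssoc (haarO d) (Measure.pi fun j => kap (Function.update P c ∅ j))
      (kap (P c)))
  have hi' : Integrable (fun z : (Orth d × (Fin n → E d)) × E d =>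
      F (z.1.1, Function.update z.1.2 c z.2))
      (((haarO d).prod (Measure.pi fun j => kap (Function.update P c ∅ j))).prod (kap (P c))) :=
    s2.integrable_comp_of_integrable hi
  rw [← integral_prod _ hi', ← s2.map_eq,
    integral_map s2.measurable.aemeasurable hF.aestronglyMeasurable]
  rfl

lemma stageWeight_update {d m : ℕ} (n : ℕ) (hm : m < d) (s : ℂ) (T : Fin (d + 1) → E d) (x : E d) :
    stageWeight n s (Function.update T (Fin.succ ⟨m, hm⟩) x) =
      (∏ i ∈ Finset.univ.erase (⟨m, hm⟩ : Fin d), ((|T i.succ i| : ℝ) : ℂ) ^ stageExp n s i) *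
        ((|x ⟨m, hm⟩| : ℝ) : ℂ) ^ stageExp n s m := by
  rw [stageWeight, ← Finset.prod_erase_mul _ _ (Finset.mem_univ (⟨m, hm⟩ : Fin d))]
  congr 1
  · refine Finset.prod_congr rfl fun i hi => ?_
    have hi' : i.succ ≠ Fin.succ ⟨m, hm⟩ := fun h =>
      Finset.ne_of_mem_erase hi (Fin.succ_injective _ h)
    rw [Function.update_of_ne hi']
  · rw [Function.update_self]

lemma stage_step {d m : ℕ} (hm : m < d) {s : ℂ} (h0 : m < s.re) (h1 : s.re < m + 1)
    (h : ∀ i : Fin d, -1 < (stageExp m s i).re) (h' : ∀ i : Fin d, -1 < (stageExp (m + 1) s i).re)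
    (ψ : 𝓢(Fin (d + 1) → E d, ℂ)) :
    gfac (s - m) * ∫ q, stageIntegrand m s (colFourier (Fin.succ ⟨m, hm⟩) ψ) q ∂stageMeasure d m =
      gfac (1 - (s - m)) * ∫ q, stageIntegrand (m + 1) s ψ q ∂stageMeasure d (m + 1) := by
  set c : Fin (d + 1) := Fin.succ ⟨m, hm⟩ with hc
  have hP : Function.update (stagePat d m) c ∅ = Function.update (stagePat d (m + 1)) c ∅ := by
    ext1 j
    by_cases hj : j = c
    · subst hj; simp
    · rw [Function.update_of_ne hj, Function.update_of_ne hj]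
      revert hj
      refine Fin.cases (fun _ => rfl) (fun i hi => ?_) j
      ext l
      have : (i : ℕ) ≠ m := fun h => hi (by rw [hc]; congr 1; exact Fin.ext h)
      rw [mem_stagePat, mem_stagePat]
      omega
  have hc1 : stagePat d m c = Finset.Ici ⟨m, hm⟩ := by simp [stagePat, hc]
  have hc2 : stagePat d (m + 1) c = Finset.Iic ⟨m, hm⟩ := by simp [stagePat, hc]
  have e1 : stageExp m s m = -(s - m) := by simp [stageExp]
  have e2 : stageExp (m + 1) s m = (s - m) - 1 := by simp [stageExp]; ring
  have hW : ∀ T : Fin (d + 1) → E d,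
      (∏ i ∈ Finset.univ.erase (⟨m, hm⟩ : Fin d), ((|T i.succ i| : ℝ) : ℂ) ^ stageExp (m + 1) s i) =
      ∏ i ∈ Finset.univ.erase (⟨m, hm⟩ : Fin d), ((|T i.succ i| : ℝ) : ℂ) ^ stageExp m s i := by
    intro T
    refine Finset.prod_congr rfl fun i hi => ?_
    have : (i : ℕ) ≠ m := fun h => Finset.ne_of_mem_erase hi (Fin.ext h)
    have h2 : (i : ℕ) < m + 1 ↔ (i : ℕ) < m := by omega
    simp only [stageExp, h2]
  rw [stageMeasure, stageMeasure,
    integral_split_column _ c (measurable_stageIntegrand m s (SchwartzMap.continuous _).measurable)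
      (integrable_stageIntegrand h _),
    integral_split_column _ c (measurable_stageIntegrand (m + 1) s ψ.continuous.measurable)
      (integrable_stageIntegrand h' _), hP, hc1, hc2, ← integral_const_mul, ← integral_const_mul]
  refine integral_congr_ae (Eventually.of_forall fun r => ?_)
  have L := local_functional_equation (⟨m, hm⟩ : Fin d)
    (compCLMOfContinuousLinearEquiv ℂ (rotL r.1).toContinuousLinearEquiv
      (colSlice (rotX r.1 r.2) c ψ)) (σ := s - m) (by simpa using h0) (by simp; linarith)
  simp only [stageIntegrand, hc, stageWeight_update, e1, e2, hW, mul_assoc, rotX_update]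
  rw [integral_const_mul, integral_const_mul, mul_left_comm, mul_left_comm (gfac (1 - (s - m)))]
  congr 1
  refine Eq.trans ?_ (L.symm.trans ?_)
  · simp only [fourier_comp_rotL, fourier_colSlice, colSlice_apply]
    rfl
  · rfl

/-! ### The family of distributions -/

/-- The linear change of variables which places the base point in column `0`. -/
def shear (d : ℕ) : (Fin (d + 1) → E d) ≃L[ℝ] (Fin (d + 1) → E d) :=
  LinearEquiv.toContinuousLinearEquiv
    { toFun := fun Y j => if j = 0 then Y 0 else Y 0 + Y j
      invFun := fun Y j => if j = 0 then Y 0 else Y j - Y 0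
      map_add' := fun Y Z => by
        ext1 j
        by_cases hj : j = 0
        · simp [hj]
        · simp only [hj, if_false, Pi.add_apply]; abel
      map_smul' := fun a Y => by
        ext1 j
        by_cases hj : j = 0 <;> simp [hj]
      left_inv := fun Y => by
        ext1 j
        by_cases hj : j = 0 <;> simp [hj]
      right_inv := fun Y => by
        ext1 j
        by_cases hj : j = 0 <;> simp [hj] }

lemma shear_zero {d : ℕ} (Y : Fin (d + 1) → E d) : shear d Y 0 = Y 0 := rfl

lemma shear_succ {d : ℕ} (Y : Fin (d + 1) → E d) (i : Fin d) :
    shear d Y i.succ = Y 0 + Y i.succ := by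
  change (if i.succ = 0 then Y 0 else Y 0 + Y i.succ) = _
  rw [if_neg (Fin.succ_ne_zero i)]

/-- The pullback of Schwartz functions under `shear`. -/
def baseChange (d : ℕ) : 𝓢(Fin (d + 1) → E d, ℂ) →L[ℂ] 𝓢(Fin (d + 1) → E d, ℂ) :=
  compCLMOfContinuousLinearEquiv ℂ (shear d)

lemma baseChange_apply {d : ℕ} (φ : 𝓢(Fin (d + 1) → E d, ℂ)) (Y : Fin (d + 1) → E d) :
    baseChange d φ Y = φ (shear d Y) := rfl

/-- The Fourier transform in the last `t` columns. -/
def tailFourier (d : ℕ) : ℕ → 𝓢(Fin (d + 1) → E d, ℂ) →L[ℂ] 𝓢(Fin (d + 1) → E d, ℂ)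
  | 0 => ContinuousLinearMap.id ℂ _
  | t + 1 => if h : t < d then
      (colFourier (Fin.succ ⟨d - 1 - t, by omega⟩)).comp (tailFourier d t) else tailFourier d t

lemma tailFourier_sub {d m : ℕ} (hm : m < d) (φ : 𝓢(Fin (d + 1) → E d, ℂ)) :
    tailFourier d (d - m) φ =
      colFourier (Fin.succ ⟨m, hm⟩) (tailFourier d (d - (m + 1)) φ) := by
  obtain ⟨t, rfl⟩ : ∃ t, d = m + 1 + t := ⟨d - (m + 1), by omega⟩
  have e1 : m + 1 + t - m = t + 1 := by omega
  have e2 : m + 1 + t - (m + 1) = t := by omega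
  have e3 : m + 1 + t - 1 - t = m := by omega
  rw [e1, e2, tailFourier, dif_pos (by omega)]
  simp only [e3]
  rfl

/-- The constant relating Lebesgue measure to the triangular decomposition. -/
def triConst (n : ℕ) : ℝ := ∏ i ∈ Finset.range n, sphereArea i / 2

/-- The value of the family at a test function, as computed at stage `m`. -/
def rhoFun (d m : ℕ) (s : ℂ) (φ : 𝓢(Fin (d + 1) → E d, ℂ)) : ℂ :=
  (triConst d : ℂ) * (stageNorm d m s)⁻¹ *
    ∫ q, stageIntegrand m s (tailFourier d (d - m) (baseChange d φ)) q ∂stageMeasure d m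

/-- The value of the family, as a distribution, as computed at stage `m`. -/
def rhoCLM {d m : ℕ} {s : ℂ} (h : ∀ i : Fin d, -1 < (stageExp m s i).re) :
    𝓢(Fin (d + 1) → E d, ℂ) →L[ℂ] ℂ :=
  ((triConst d : ℂ) * (stageNorm d m s)⁻¹) •
    (stageCLM h ∘L tailFourier d (d - m) ∘L baseChange d)

lemma differentiable_gfac_inv : Differentiable ℂ fun z => (gfac z)⁻¹ := by
  have h : (fun z => (gfac z)⁻¹) =
      fun z => 2 * (Real.pi : ℂ) ^ (z / 2) * (Complex.Gamma (z / 2))⁻¹ := by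
    ext z
    simp [gfac, mul_comm]
  rw [h]
  have hpi : (Real.pi : ℂ) ≠ 0 := by exact_mod_cast Real.pi_ne_zero
  refine Differentiable.mul (Differentiable.const_mul (fun z => ?_) 2) ?_
  · exact DifferentiableAt.const_cpow (by fun_prop) (Or.inl hpi)
  · exact Complex.differentiable_one_div_Gamma.comp (by fun_prop)

lemma gfac_ne_zero {z : ℂ} (hz : 0 < z.re) : gfac z ≠ 0 := by
  have hpi : (Real.pi : ℂ) ≠ 0 := by exact_mod_cast Real.pi_ne_zero
  refine mul_ne_zero (one_div_ne_zero (mul_ne_zero two_ne_zero ?_))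
    (Complex.Gamma_ne_zero_of_re_pos (by simpa using hz))
  simp [Complex.cpow_eq_zero_iff, hpi]

lemma differentiableAt_rhoFun {d m : ℕ} {s : ℂ} (h : ∀ i : Fin d, -1 < (stageExp m s i).re)
    (φ : 𝓢(Fin (d + 1) → E d, ℂ)) : DifferentiableAt ℂ (fun s => rhoFun d m s φ) s := by
  refine DifferentiableAt.mul (DifferentiableAt.const_mul ?_ _) (differentiableAt_stage h _)
  simp only [stageNorm, ← Finset.prod_inv_distrib]
  refine DifferentiableAt.fun_finsetProd fun i _ => ?_
  refine (differentiable_gfac_inv _).comp s ?_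
  unfold stageExp
  split_ifs <;> fun_prop

lemma rhoFun_succ {d m : ℕ} (hm : m < d) {s : ℂ} (h : ∀ i : Fin d, -1 < (stageExp m s i).re)
    (h' : ∀ i : Fin d, -1 < (stageExp (m + 1) s i).re) (φ : 𝓢(Fin (d + 1) → E d, ℂ)) :
    rhoFun d m s φ = rhoFun d (m + 1) s φ := by
  have e1 : stageExp m s m + 1 = 1 - (s - m) := by simp [stageExp]; ring
  have e2 : stageExp (m + 1) s m + 1 = s - m := by simp [stageExp]; ring
  have h0 : m < s.re := by
    have := h' ⟨m, hm⟩
    simp [stageExp] at this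
    linarith
  have h1 : s.re < m + 1 := by
    have := h ⟨m, hm⟩
    simp [stageExp] at this
    linarith
  have hg1 : gfac (1 - (s - m)) ≠ 0 := gfac_ne_zero (by simp; linarith)
  have hg2 : gfac (s - m) ≠ 0 := gfac_ne_zero (by simp; linarith)
  have n : ∀ n, stageNorm d n s = (∏ i ∈ Finset.univ.erase (⟨m, hm⟩ : Fin d),
      gfac (stageExp n s i + 1)) * gfac (stageExp n s m + 1) := fun n =>
    (Finset.prod_erase_mul _ _ (Finset.mem_univ (⟨m, hm⟩ : Fin d))).symm
  have hP : ∏ i ∈ Finset.univ.erase (⟨m, hm⟩ : Fin d), gfac (stageExp (m + 1) s i + 1) =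
      ∏ i ∈ Finset.univ.erase (⟨m, hm⟩ : Fin d), gfac (stageExp m s i + 1) := by
    refine Finset.prod_congr rfl fun i hi => ?_
    have : (i : ℕ) ≠ m := fun h => Finset.ne_of_mem_erase hi (Fin.ext h)
    have h2 : (i : ℕ) < m + 1 ↔ (i : ℕ) < m := by omega
    simp only [stageExp, h2]
  have hstep := stage_step hm h0 h1 h h' (tailFourier d (d - (m + 1)) (baseChange d φ))
  rw [rhoFun, rhoFun, tailFourier_sub hm, n, n, hP, e1, e2, mul_inv, mul_inv]
  have key : ∀ {a b x y : ℂ}, a ≠ 0 → b ≠ 0 → b * x = a * y → a⁻¹ * x = b⁻¹ * y := by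
    intro a b x y ha hb hxy
    field_simp
    linear_combination hxy
  linear_combination ((triConst d : ℂ) * (∏ i ∈ Finset.univ.erase (⟨m, hm⟩ : Fin d),
      gfac (stageExp m s i + 1))⁻¹) * key hg1 hg2 hstep

lemma rhoFun_eq {d m n : ℕ} {s : ℂ} (hm : m ≤ d) (hn : n ≤ d)
    (h : ∀ i : Fin d, -1 < (stageExp m s i).re)
    (h' : ∀ i : Fin d, -1 < (stageExp n s i).re) (φ : 𝓢(Fin (d + 1) → E d, ℂ)) :
    rhoFun d m s φ = rhoFun d n s φ := by
  wlog hmn : m ≤ n generalizing m n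
  · exact (this hn hm h' h (by omega)).symm
  rcases hmn.eq_or_lt with rfl | hlt
  · rfl
  have h1 := h ⟨m, by omega⟩
  have h2 := h' ⟨n - 1, by omega⟩
  have hn1 : ((n - 1 : ℕ) : ℝ) = n - 1 := by push_cast [Nat.cast_sub (by omega : 1 ≤ n)]; ring
  simp [stageExp, show n - 1 < n by omega, hn1] at h1 h2
  have : (n : ℝ) < m + 2 := by linarith
  obtain rfl : n = m + 1 := by
    have : n < m + 2 := by exact_mod_cast this
    omega
  exact rhoFun_succ (by omega) h h' φ

/-- The stage at which the family is computed. -/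
def stageOf (d : ℕ) (s : ℂ) : ℕ := min d ⌊s.re⌋₊

lemma stageOf_spec (d : ℕ) (s : ℂ) (i : Fin d) : -1 < (stageExp (stageOf d s) s i).re := by
  have hi := i.2
  unfold stageExp stageOf
  split_ifs with h
  · have h1 : (i : ℕ) + 1 ≤ ⌊s.re⌋₊ := by omega
    have h2 : ((i : ℕ) + 1 : ℝ) ≤ s.re := by
      have := (Nat.le_floor_iff' (by omega)).1 h1
      exact_mod_cast this
    simp
    linarith
  · have h1 : ⌊s.re⌋₊ < (i : ℕ) + 1 := by omega
    have h2 := Nat.lt_of_floor_lt h1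
    push_cast at h2
    simp
    linarith

/-- The analytic family of tempered distributions. -/
def rhoFamily (d : ℕ) (s : ℂ) : 𝓢'(Fin (d + 1) → E d, ℂ) :=
  ContinuousLinearMap.toPointwiseConvergenceCLM _ _ _ _ (rhoCLM (stageOf_spec d s))

lemma rhoFamily_eq {d m : ℕ} {s : ℂ} (hm : m ≤ d) (h : ∀ i : Fin d, -1 < (stageExp m s i).re)
    (φ : 𝓢(Fin (d + 1) → E d, ℂ)) : rhoFamily d s φ = rhoFun d m s φ :=
  rhoFun_eq (min_le_left _ _) hm (stageOf_spec d s) h φ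

lemma differentiable_rhoFamily (d : ℕ) (φ : 𝓢(Fin (d + 1) → E d, ℂ)) :
    Differentiable ℂ fun s => rhoFamily d s φ := by
  intro s
  obtain ⟨a, M, r, ha, -, hr, hb⟩ := exists_stageExp_bounds (stageOf_spec d s)
  refine (differentiableAt_rhoFun (stageOf_spec d s) φ).congr_of_eventuallyEq ?_
  filter_upwards [Metric.ball_mem_nhds s hr] with z hz
  exact rhoFamily_eq (min_le_left _ _) (fun i => ha.trans_le (hb z hz i).1) φ

/-! ### The range of absolute convergence -/

lemma measurePreserving_shear (d : ℕ) : MeasurePreserving (shear d) volume volume := by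
  have h1 := measurePreserving_piFinSuccAbove (α := fun _ : Fin (d + 1) => E d)
    (fun _ => (volume : Measure (E d))) 0
  have h2 : MeasurePreserving
      (fun p : E d × (Fin d → E d) => (p.1, (fun _ : Fin d => p.1) + p.2))
      ((volume : Measure (E d)).prod (Measure.pi fun _ => volume))
      ((volume : Measure (E d)).prod (Measure.pi fun _ => volume)) := by
    refine (MeasurePreserving.id volume).skew_product
      (g := fun (x : E d) (v : Fin d → E d) => (fun _ : Fin d => x) + v) ?_
      (Eventually.of_forall fun x => ?_)
    · exact measurable_pi_lambda _ fun i =>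
        measurable_fst.add ((measurable_pi_apply i).comp measurable_snd)
    · exact map_add_left_eq_self (volume : Measure (Fin d → E d)) (fun _ : Fin d => x)
  have h3 := (h1.symm.comp h2).comp h1
  have e : ⇑(shear d) = ((MeasurableEquiv.piFinSuccAbove (fun _ : Fin (d + 1) => E d) 0).symm ∘
      fun p : E d × (Fin d → E d) => (p.1, (fun _ : Fin d => p.1) + p.2)) ∘
      (MeasurableEquiv.piFinSuccAbove (fun _ : Fin (d + 1) => E d) 0) := by
    ext1 Y
    ext1 j
    refine Fin.cases rfl (fun j => ?_) j
    rw [shear_succ]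
    rfl
  rw [e]
  exact h3

/-- The matrix of the columns other than the base column. -/
def colMat {d : ℕ} (Y : Fin (d + 1) → E d) : Matrix (Fin d) (Fin d) ℝ :=
  Matrix.of fun i j => Y j.succ i

lemma rho_shear {d : ℕ} (Y : Fin (d + 1) → E d) : rho (shear d Y) = (colMat Y).det := by
  set B : Matrix (Fin (d + 1)) (Fin (d + 1)) ℝ :=
    Matrix.of fun j i => Fin.cases (if j = 0 then 1 else 0) (fun a => Y j a) i with hB
  have h1 : rho (shear d Y) = B.det := by
    rw [rho, ← Matrix.det_transpose]
    refine Matrix.det_eq_of_forall_row_eq_smul_add_const (fun j => if j = 0 then 0 else 1) 0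
      (by simp) fun j i => ?_
    refine Fin.cases ?_ (fun j => ?_) j
    · refine Fin.cases ?_ (fun i => ?_) i <;> simp [hB, shear_zero]
    · refine Fin.cases ?_ (fun i => ?_) i <;> simp [hB, shear_succ, add_comm]
  have h2 : B.transpose.det = (colMat Y).det := by
    rw [Matrix.det_succ_row_zero, Finset.sum_eq_single 0]
    · simp [hB]
      rfl
    · intro j _ hj
      simp [hB, hj]
    · simp
  rw [h1, ← Matrix.det_transpose, h2]

lemma abs_det_rotX {d : ℕ} (Q : Orth d) (T : Fin (d + 1) → E d) :
    |(colMat (rotX Q T)).det| = |(colMat T).det| := by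
  have h : colMat (rotX Q T) = (Q : Matrix (Fin d) (Fin d) ℝ) * colMat T := by
    ext i j
    simp only [colMat, rotX, rotL_apply, Matrix.of_apply, Matrix.mul_apply]
    rfl
  have hQ : |(Q : Matrix (Fin d) (Fin d) ℝ).det| = 1 := by
    have h1 := congrArg Matrix.det (Unitary.star_mul_self_of_mem Q.2)
    rw [Matrix.det_mul, Matrix.det_one, Matrix.star_eq_conjTranspose, Matrix.det_conjTranspose,
      star_trivial, ← sq] at h1
    rcases sq_eq_one_iff.1 h1 with h | h <;> simp [h]
  rw [h, Matrix.det_mul, abs_mul, hQ, one_mul]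

lemma stageMeasure_ae_zero {d m : ℕ} : ∀ᵐ q ∂stageMeasure d m, ∀ j : Fin (d + 1),
    ∀ i ∉ stagePat d m j, q.2 j i = 0 := by
  refine ae_all_iff.2 fun j => ?_
  have h : ∀ᵐ T : Fin (d + 1) → E d ∂Measure.pi (fun j => kap (stagePat d m j)),
      ∀ i ∉ stagePat d m j, T j i = 0 :=
    (Measure.tendsto_eval_ae_ae (μ := fun j => kap (stagePat d m j)) (i := j)).eventually
      (kap_ae_eq_zero _)
  exact (Measure.quasiMeasurePreserving_snd (μ := haarO d)).ae h

lemma stageMeasure_ae_det {d : ℕ} : ∀ᵐ q ∂stageMeasure d d,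
    |(colMat (rotX q.1 q.2)).det| = ∏ i : Fin d, |q.2 i.succ i| := by
  filter_upwards [stageMeasure_ae_zero] with q hq
  rw [abs_det_rotX, Matrix.det_of_isUpperTriangular, Finset.abs_prod]
  · rfl
  · intro i j hij
    refine hq j.succ i ?_
    rw [mem_stagePat]
    have := j.2
    simp only [id] at hij
    rw [Fin.lt_def] at hij
    omega

/-- The product measure attached to the block pattern. -/
def blockMeasure (d k : ℕ) : Measure (Orth d × (Fin (d + 1) → E d)) :=
  (haarO d).prod (Measure.pi fun j => kap (blockPat d k j))

/-- The density of the triangular decomposition, as a real function. -/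
def qrWeight (d k : ℕ) (T : Fin (d + 1) → E d) : ℝ :=
  ∏ j : Fin d, (sphereArea (blockExp k j) / 2 * |T j.succ j| ^ blockExp k j)

lemma qrDensity_eq {d k : ℕ} (T : Fin (d + 1) → E d) :
    qrDensity d k d T = ENNReal.ofReal (qrWeight d k T) := by
  have hs : ∀ n, 0 ≤ sphereArea n := fun n => (sphereArea_pos n).le
  rw [qrDensity, qrWeight, ENNReal.ofReal_prod_of_nonneg]
  · refine Finset.prod_congr rfl fun j _ => if_pos ?_
    have := j.2
    simp only [columnRank]
    split_ifs <;> omega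
  · intro j _
    have := hs (blockExp k j)
    positivity

lemma measurable_qrWeight (d k : ℕ) : Measurable (qrWeight d k) := by
  unfold qrWeight
  fun_prop

lemma measurable_ofReal_qrWeight (d k : ℕ) :
    Measurable fun q : Orth d × (Fin (d + 1) → E d) => ENNReal.ofReal (qrWeight d k q.2) :=
  ((measurable_qrWeight d k).comp measurable_snd).ennreal_ofReal

lemma qrWeight_nonneg (d k : ℕ) (T : Fin (d + 1) → E d) : 0 ≤ qrWeight d k T :=
  Finset.prod_nonneg fun j _ => by
    have := (sphereArea_pos (blockExp k j)).le
    positivity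

lemma map_rotX_blockMeasure {d k : ℕ} (hk : k ≤ d) :
    (blockMeasure d k).map (fun q => rotX q.1 q.2) = ((stageMeasure d k).withDensity
      fun q => ENNReal.ofReal (qrWeight d k q.2)).map (fun q => rotX q.1 q.2) := by
  rw [blockMeasure, map_haar_qr hk]
  simp_rw [qrDensity_eq]
  rfl

lemma integrable_blockMeasure_iff {d k : ℕ} (hk : k ≤ d) {Φ : (Fin (d + 1) → E d) → ℂ}
    (hΦ : Measurable Φ) :
    Integrable (fun q => Φ (rotX q.1 q.2)) (blockMeasure d k) ↔
      Integrable (fun q => (qrWeight d k q.2 : ℂ) * Φ (rotX q.1 q.2)) (stageMeasure d k) := by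
  have hm := (continuous_rotX (d := d) (n := d + 1)).measurable
  have hw := measurable_ofReal_qrWeight d k
  have h1 := integrable_map_measure (μ := blockMeasure d k) hΦ.aestronglyMeasurable hm.aemeasurable
  have h2 := integrable_map_measure (μ := (stageMeasure d k).withDensity
      fun q => ENNReal.ofReal (qrWeight d k q.2)) hΦ.aestronglyMeasurable hm.aemeasurable
  rw [← map_rotX_blockMeasure hk, h1] at h2
  refine h2.trans ?_
  rw [integrable_withDensity_iff_integrable_smul' hw
    (Eventually.of_forall fun _ => ENNReal.ofReal_lt_top)]
  simp [ENNReal.toReal_ofReal (qrWeight_nonneg d k _)]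

lemma integral_blockMeasure {d k : ℕ} (hk : k ≤ d) {Φ : (Fin (d + 1) → E d) → ℂ}
    (hΦ : Measurable Φ) :
    ∫ q, Φ (rotX q.1 q.2) ∂blockMeasure d k =
      ∫ q, (qrWeight d k q.2 : ℂ) * Φ (rotX q.1 q.2) ∂stageMeasure d k := by
  have hm := (continuous_rotX (d := d) (n := d + 1)).measurable
  have hw := measurable_ofReal_qrWeight d k
  rw [← integral_map (f := Φ) hm.aemeasurable hΦ.aestronglyMeasurable, map_rotX_blockMeasure hk,
    integral_map hm.aemeasurable hΦ.aestronglyMeasurable,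
    integral_withDensity_eq_integral_toReal_smul hw
      (Eventually.of_forall fun _ => ENNReal.ofReal_lt_top)]
  simp [ENNReal.toReal_ofReal (qrWeight_nonneg d k _)]

lemma measurePreserving_rotX_blockMeasure (d : ℕ) :
    MeasurePreserving (fun q : Orth d × (Fin (d + 1) → E d) => rotX q.1 q.2) (blockMeasure d d)
      volume := by
  have hb : (fun j => kap (blockPat d d j)) = fun _ => (volume : Measure (E d)) := by
    ext1 j
    rw [← kap_univ]
    congr 1
    refine Fin.cases rfl (fun j => ?_) j
    ext i
    have := i.2
    have := j.2
    rw [mem_blockPat]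
    simp
  have h1 : MeasurePreserving
      (fun q : Orth d × (Fin (d + 1) → E d) => (q.1, rotX q.1 q.2))
      ((haarO d).prod volume) ((haarO d).prod volume) := by
    refine (MeasurePreserving.id (haarO d)).skew_product continuous_rotX.measurable
      (Eventually.of_forall fun Q => ?_)
    have := map_isometry_pi_kap (P := fun _ : Fin (d + 1) => (Finset.univ : Finset (Fin d)))
      (S := Finset.univ) (fun _ => Or.inl le_rfl) (rotL Q) (by simp)
    simp_rw [kap_univ] at this
    exact this
  have h2 : MeasurePreserving (Prod.snd : Orth d × (Fin (d + 1) → E d) → _)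
      ((haarO d).prod volume) volume := measurePreserving_snd
  have h3 := h2.comp h1
  rw [blockMeasure, hb]
  exact h3

lemma measurable_det_colMat (d : ℕ) :
    Measurable fun Y : Fin (d + 1) → E d => (colMat Y).det := by
  refine Continuous.measurable (Continuous.matrix_det ?_)
  refine continuous_matrix fun i j => ?_
  simp only [colMat, Matrix.of_apply]
  fun_prop

lemma qrWeight_self {d : ℕ} (T : Fin (d + 1) → E d) :
    qrWeight d d T = triConst d * ∏ j : Fin d, |T j.succ j| ^ (d - 1 - (j : ℕ)) := by
  have e : ∀ j : Fin d, blockExp d j = d - 1 - j := fun j => by simp [blockExp, j.2]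
  rw [qrWeight, Finset.prod_mul_distrib]
  simp_rw [e]
  congr 1
  rw [Fin.prod_univ_eq_prod_range (fun j => sphereArea (d - 1 - j) / 2) d,
    Finset.prod_range_reflect (fun j => sphereArea j / 2) d]
  rfl

lemma stageExp_self_re {d : ℕ} {s : ℂ} (hs : (d : ℝ) - 1 < s.re) (i : Fin d) :
    -1 < (stageExp d s i).re := by
  have h : ((i : ℕ) : ℝ) + 1 ≤ d := by exact_mod_cast i.2
  simp [stageExp]
  linarith

/-- The integrand of the family, in the sheared coordinates. -/
def rhoIntegrand {d : ℕ} (s : ℂ) (φ : 𝓢(Fin (d + 1) → E d, ℂ)) (Y : Fin (d + 1) → E d) : ℂ :=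
  ((|(colMat Y).det| : ℝ) : ℂ) ^ (-(d : ℂ) + s) * φ (shear d Y)

lemma measurable_rhoIntegrand {d : ℕ} (s : ℂ) (φ : 𝓢(Fin (d + 1) → E d, ℂ)) :
    Measurable (rhoIntegrand s φ) := by
  have h1 := measurable_det_colMat d
  have h2 : Measurable fun Y => φ (shear d Y) :=
    (φ.continuous.comp (shear d).continuous).measurable
  unfold rhoIntegrand
  have h3 : Measurable fun Y : Fin (d + 1) → E d => ((|(colMat Y).det| : ℝ) : ℂ) := by
    have : Measurable fun Y : Fin (d + 1) → E d => |(colMat Y).det| := h1.abs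
    fun_prop
  exact (h3.pow_const _).mul h2

lemma ofReal_prod_cpow {ι : Type*} (S : Finset ι) (f : ι → ℝ) (hf : ∀ i ∈ S, 0 ≤ f i) (z : ℂ) :
    ((∏ i ∈ S, f i : ℝ) : ℂ) ^ z = ∏ i ∈ S, (f i : ℂ) ^ z := by
  classical
  induction S using Finset.induction with
  | empty => simp
  | insert a S ha ih =>
    rw [Finset.prod_insert ha, Finset.prod_insert ha, Complex.ofReal_mul,
      Complex.mul_cpow_ofReal_nonneg (hf a (Finset.mem_insert_self a S))
        (Finset.prod_nonneg fun i hi => hf i (Finset.mem_insert_of_mem hi)),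
      ih fun i hi => hf i (Finset.mem_insert_of_mem hi)]

lemma qrWeight_mul_rhoIntegrand {d : ℕ} (s : ℂ) (φ : 𝓢(Fin (d + 1) → E d, ℂ)) :
    (fun q : Orth d × (Fin (d + 1) → E d) =>
      (qrWeight d d q.2 : ℂ) * rhoIntegrand s φ (rotX q.1 q.2)) =ᵐ[stageMeasure d d]
    fun q => (triConst d : ℂ) * stageIntegrand d s (baseChange d φ) q := by
  filter_upwards [stageMeasure_ae_det, stageMeasure_ae_ne] with q hdet hne
  rw [rhoIntegrand, hdet, stageIntegrand, baseChange_apply, qrWeight_self, Complex.ofReal_mul,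
    mul_assoc]
  congr 1
  rw [← mul_assoc]
  congr 1
  rw [stageWeight, ofReal_prod_cpow _ _ fun i _ => abs_nonneg _, Complex.ofReal_prod,
    ← Finset.prod_mul_distrib]
  refine Finset.prod_congr rfl fun i _ => ?_
  have h0 : ((|q.2 i.succ i| : ℝ) : ℂ) ≠ 0 := by simpa using hne i
  have hi : ((d - 1 - (i : ℕ) : ℕ) : ℂ) = (d : ℂ) - 1 - (i : ℕ) := by
    have := i.2
    push_cast [Nat.cast_sub (by omega : (i : ℕ) ≤ d - 1), Nat.cast_sub (by omega : 1 ≤ d)]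
    ring
  rw [Complex.ofReal_pow, ← Complex.cpow_natCast, ← Complex.cpow_add _ _ h0, hi]
  congr 1
  simp only [stageExp, i.2, if_true]
  ring

lemma integrable_rhoIntegrand {d : ℕ} {s : ℂ} (hs : (d : ℝ) - 1 < s.re)
    (φ : 𝓢(Fin (d + 1) → E d, ℂ)) : Integrable (rhoIntegrand s φ) := by
  rw [← (measurePreserving_rotX_blockMeasure d).map_eq, integrable_map_measure
    (measurable_rhoIntegrand s φ).aestronglyMeasurable continuous_rotX.measurable.aemeasurable]
  refine (integrable_blockMeasure_iff le_rfl (measurable_rhoIntegrand s φ)).2 ?_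
  exact ((integrable_stageIntegrand (stageExp_self_re hs) _).const_mul _).congr
    (qrWeight_mul_rhoIntegrand s φ).symm

lemma integral_rhoIntegrand {d : ℕ} (s : ℂ)
    (φ : 𝓢(Fin (d + 1) → E d, ℂ)) : ∫ Y, rhoIntegrand s φ Y =
      (triConst d : ℂ) * ∫ q, stageIntegrand d s (baseChange d φ) q ∂stageMeasure d d := by
  rw [← (measurePreserving_rotX_blockMeasure d).map_eq, integral_map
    continuous_rotX.measurable.aemeasurable (measurable_rhoIntegrand s φ).aestronglyMeasurable,
    integral_blockMeasure le_rfl (measurable_rhoIntegrand s φ),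
    integral_congr_ae (qrWeight_mul_rhoIntegrand s φ), integral_const_mul]

lemma rhoIntegrand_eq {d : ℕ} (s : ℂ) (φ : 𝓢(Fin (d + 1) → E d, ℂ)) :
    rhoIntegrand s φ = (fun x => ((|rho x| : ℝ) : ℂ) ^ (-(d : ℂ) + s) * φ x) ∘ shear d := by
  ext Y
  simp [rhoIntegrand, rho_shear]

lemma stageNorm_self (d : ℕ) (s : ℂ) : stageNorm d d s = gam d s := by
  rw [gam, ← Fin.prod_univ_eq_prod_range
    (fun j => 1 / (2 * (Real.pi : ℂ) ^ ((s - j) / 2)) * Complex.Gamma ((s - j) / 2)) d]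
  refine Finset.prod_congr rfl fun i _ => ?_
  have : stageExp d s i + 1 = s - (i : ℕ) := by simp [stageExp]; ring
  rw [this, gfac]

lemma isRhoFamily_rhoFamily (d : ℕ) : IsRhoFamily d (rhoFamily d) := by
  have hemb : MeasurableEmbedding (shear d) := (shear d).toHomeomorph.measurableEmbedding
  refine ⟨differentiable_rhoFamily d, fun s hs φ => ?_, fun s hs φ => ?_⟩
  · have h := integrable_rhoIntegrand hs φ
    rw [rhoIntegrand_eq] at h
    exact ((measurePreserving_shear d).integrable_comp_emb hemb).1 h
  · have h := (measurePreserving_shear d).integral_comp hemb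
      (fun x => ((|rho x| : ℝ) : ℂ) ^ (-(d : ℂ) + s) * φ x)
    have h2 := integral_rhoIntegrand s φ
    rw [rhoIntegrand_eq] at h2
    rw [rhoFamily_eq le_rfl (stageExp_self_re hs), rhoFun, stageNorm_self, ← h]
    refine Eq.trans ?_ (congrArg (1 / gam d s * ·) h2).symm
    rw [Nat.sub_self]
    simp only [tailFourier, ContinuousLinearMap.id_apply]
    ring

lemma IsRhoFamily.eq {d : ℕ} {A B : ℂ → 𝓢'(Fin (d + 1) → E d, ℂ)} (hA : IsRhoFamily d A)
    (hB : IsRhoFamily d B) : A = B := by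
  ext s φ
  have hf : AnalyticOnNhd ℂ (fun s => A s φ) univ := fun z _ => (hA.entire φ).analyticAt z
  have hg : AnalyticOnNhd ℂ (fun s => B s φ) univ := fun z _ => (hB.entire φ).analyticAt z
  refine congrFun (hf.eq_of_eventuallyEq hg (z₀ := (d : ℂ)) ?_) s
  have : ∀ᶠ z : ℂ in 𝓝 (d : ℂ), (d : ℝ) - 1 < z.re :=
    Complex.continuous_re.continuousAt.eventually_const_lt (by simp)
  filter_upwards [this] with z hz
  rw [hA.eq_integral z hz, hB.eq_integral z hz]

/-! ### The value of the family at integers -/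

lemma stageExp_natCast {d k : ℕ} (i : Fin d) : stageExp k (k : ℂ) i = (blockExp k i : ℕ) := by
  unfold stageExp blockExp
  split_ifs with h
  · push_cast [Nat.cast_sub (by omega : (i : ℕ) ≤ k - 1), Nat.cast_sub (by omega : 1 ≤ k)]
    ring
  · push_cast [Nat.cast_sub (by omega : k ≤ (i : ℕ))]
    ring

lemma stageExp_natCast_re {d k : ℕ} (i : Fin d) : -1 < (stageExp k (k : ℂ) i).re := by
  rw [stageExp_natCast, Complex.natCast_re]
  have : (0 : ℝ) ≤ (blockExp k i : ℕ) := Nat.cast_nonneg _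
  linarith

lemma prod_fin_blockExp {M : Type*} [CommMonoid M] {d k : ℕ} (hk : k ≤ d) (f : ℕ → M) :
    ∏ i : Fin d, f (blockExp k i) =
      (∏ i ∈ Finset.range k, f i) * ∏ i ∈ Finset.range (d - k), f i := by
  rw [Fin.prod_univ_eq_prod_range (fun i => f (blockExp k i)) d,
    ← Finset.prod_range_mul_prod_Ico _ hk, Finset.prod_Ico_eq_prod_range]
  congr 1
  · rw [← Finset.prod_range_reflect f k]
    refine Finset.prod_congr rfl fun i hi => ?_
    simp [blockExp, Finset.mem_range.1 hi]
  · refine Finset.prod_congr rfl fun i _ => ?_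
    simp [blockExp]

lemma gam_natCast (n : ℕ) : gam n (n : ℂ) = ∏ i ∈ Finset.range n, gfac ((i : ℂ) + 1) := by
  rw [← Finset.prod_range_reflect]
  refine Finset.prod_congr rfl fun j hj => ?_
  have h := Finset.mem_range.1 hj
  have : ((n - 1 - j : ℕ) : ℂ) + 1 = n - j := by
    push_cast [Nat.cast_sub (by omega : j ≤ n - 1), Nat.cast_sub (by omega : 1 ≤ n)]
    ring
  rw [this]
  rfl

lemma stageNorm_natCast {d k : ℕ} (hk : k ≤ d) :
    stageNorm d k (k : ℂ) = gam k k * gam (d - k) ((d - k : ℕ) : ℂ) := by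
  rw [stageNorm, gam_natCast, gam_natCast, ← prod_fin_blockExp hk (fun i => gfac ((i : ℂ) + 1))]
  simp_rw [stageExp_natCast]

lemma qrWeight_eq {d k : ℕ} (hk : k ≤ d) (T : Fin (d + 1) → E d) :
    (qrWeight d k T : ℂ) = (triConst k * triConst (d - k) : ℝ) * stageWeight k (k : ℂ) T := by
  rw [qrWeight, Finset.prod_mul_distrib, prod_fin_blockExp hk (fun i => sphereArea i / 2),
    stageWeight, Complex.ofReal_mul]
  congr 1
  rw [Complex.ofReal_prod]
  refine Finset.prod_congr rfl fun i _ => ?_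
  rw [stageExp_natCast, Complex.cpow_natCast, Complex.ofReal_pow]

lemma triConst_pos (n : ℕ) : 0 < triConst n :=
  Finset.prod_pos fun i _ => half_pos (sphereArea_pos i)

lemma grassMass_eq {d k : ℕ} (hk : k ≤ d) :
    grassMass d k = triConst d / (triConst k * triConst (d - k)) := by
  have h1 : triConst d = triConst (d - k) * ∏ i ∈ Finset.range k, sphereArea (d - 1 - i) / 2 := by
    rw [triConst, triConst, ← Finset.prod_range_mul_prod_Ico _ (Nat.sub_le d k),
      Finset.prod_Ico_eq_prod_range, Nat.sub_sub_self hk, ← Finset.prod_range_reflect _ k]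
    congr 1
    refine Finset.prod_congr rfl fun i hi => ?_
    have := Finset.mem_range.1 hi
    congr 2
    omega
  have h2 := (triConst_pos (d - k)).ne'
  rw [h1, mul_comm (triConst k), mul_div_mul_left _ _ h2, triConst, ← Finset.prod_div_distrib,
    grassMass, ← Finset.prod_div_distrib]
  refine Finset.prod_congr rfl fun i _ => ?_
  rw [div_div_div_cancel_right₀ two_ne_zero]

lemma rhoFamily_natCast {d k : ℕ} (hk : k ≤ d) (φ : 𝓢(Fin (d + 1) → E d, ℂ)) :
    rhoFamily d k φ = constD d k * (grassMass d k : ℂ) *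
      ∫ q, tailFourier d (d - k) (baseChange d φ) (rotX q.1 q.2) ∂blockMeasure d k := by
  have h1 : ((triConst k * triConst (d - k) : ℝ) : ℂ) ≠ 0 := by
    exact_mod_cast (mul_pos (triConst_pos k) (triConst_pos (d - k))).ne'
  rw [rhoFamily_eq hk stageExp_natCast_re, rhoFun, stageNorm_natCast hk, grassMass_eq hk,
    integral_blockMeasure hk (SchwartzMap.continuous _).measurable, constD, one_div,
    Complex.ofReal_div]
  simp_rw [qrWeight_eq hk, mul_assoc]
  rw [integral_const_mul]
  simp only [stageIntegrand]
  field_simp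

/-- The pattern in which the last columns, from `m` on, lie in the last coordinates. -/
def partPat (d k m : ℕ) : Fin (d + 1) → Finset (Fin d) :=
  Fin.cases Finset.univ fun j =>
    if (j : ℕ) < m then Finset.univ.filter (fun i : Fin d => (i : ℕ) < k)
    else Finset.univ.filter (fun i : Fin d => k ≤ (i : ℕ))

lemma integrable_schwartz_rotX {d : ℕ} (P : Fin (d + 1) → Finset (Fin d))
    (ψ : 𝓢(Fin (d + 1) → E d, ℂ)) : Integrable
      (fun q : Orth d × (Fin (d + 1) → E d) => ψ (rotX q.1 q.2))
      ((haarO d).prod (Measure.pi fun j => kap (P j))) := by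
  have h := Integrable.fintype_prod (μ := fun j => kap (P j))
    (f := fun _ (x : E d) => ∏ i, ((1 + |x i|) ^ 2)⁻¹)
    fun j => integrable_kap_prod (P j) _ fun i _ => integrable_one_add_abs_inv_sq
  exact ((h.comp_snd (haarO d)).const_mul _).mono'
    (ψ.continuous.comp continuous_rotX).measurable.aestronglyMeasurable
    (Eventually.of_forall fun q => norm_schwartz_rotX_le 2 ψ q.1 q.2)

lemma integral_colFourier_step {d k m : ℕ} (hm : m < d) (ψ : 𝓢(Fin (d + 1) → E d, ℂ)) :
    ∫ q, colFourier (Fin.succ ⟨m, hm⟩) ψ (rotX q.1 q.2)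
        ∂(haarO d).prod (Measure.pi fun j => kap (partPat d k m j)) =
      ∫ q, ψ (rotX q.1 q.2)
        ∂(haarO d).prod (Measure.pi fun j => kap (partPat d k (m + 1) j)) := by
  set c : Fin (d + 1) := Fin.succ ⟨m, hm⟩ with hc
  have hP : Function.update (partPat d k m) c ∅ = Function.update (partPat d k (m + 1)) c ∅ := by
    ext1 j
    by_cases hj : j = c
    · subst hj; simp
    · rw [Function.update_of_ne hj, Function.update_of_ne hj]
      revert hj
      refine Fin.cases (fun _ => rfl) (fun i hi => ?_) j
      have : (i : ℕ) ≠ m := fun h => hi (by rw [hc]; congr 1; exact Fin.ext h)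
      have h2 : (i : ℕ) < m + 1 ↔ (i : ℕ) < m := by omega
      simp only [partPat, Fin.cases_succ, h2]
  have hc1 : partPat d k m c = (Finset.univ.filter (fun i : Fin d => (i : ℕ) < k))ᶜ := by
    ext i
    simp [partPat, hc]
  have hc2 : partPat d k (m + 1) c = Finset.univ.filter (fun i : Fin d => (i : ℕ) < k) := by
    simp [partPat, hc]
  have hmeas : ∀ ψ : 𝓢(Fin (d + 1) → E d, ℂ),
      Measurable fun q : Orth d × (Fin (d + 1) → E d) => ψ (rotX q.1 q.2) := fun ψ =>
    (ψ.continuous.comp continuous_rotX).measurable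
  rw [integral_split_column _ c (hmeas _) (integrable_schwartz_rotX _ _),
    integral_split_column _ c (hmeas _) (integrable_schwartz_rotX _ _), hP, hc1, hc2]
  refine integral_congr_ae (Eventually.of_forall fun r => ?_)
  have L := integral_fourier_kap_compl (Finset.univ.filter (fun i : Fin d => (i : ℕ) < k))
    (compCLMOfContinuousLinearEquiv ℂ (rotL r.1).toContinuousLinearEquiv
      (colSlice (rotX r.1 r.2) c ψ))
  simp only [rotX_update]
  refine Eq.trans ?_ (L.trans ?_)
  · simp only [fourier_comp_rotL, fourier_colSlice, colSlice_apply]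
  · rfl

lemma integral_tailFourier {d k : ℕ} (hk : k ≤ d) (ψ : 𝓢(Fin (d + 1) → E d, ℂ)) :
    ∫ q, tailFourier d (d - k) ψ (rotX q.1 q.2) ∂blockMeasure d k =
      ∫ q, ψ (rotX q.1 q.2) ∂(haarO d).prod (Measure.pi fun j => kap (partPat d k d j)) := by
  have h : ∀ n, k + n ≤ d → ∫ q, tailFourier d (d - k) ψ (rotX q.1 q.2) ∂blockMeasure d k =
      ∫ q, tailFourier d (d - (k + n)) ψ (rotX q.1 q.2)
        ∂(haarO d).prod (Measure.pi fun j => kap (partPat d k (k + n) j)) := by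
    intro n
    induction n with
    | zero => exact fun _ => rfl
    | succ n ih =>
      intro hn
      rw [ih (by omega)]
      have := integral_colFourier_step (k := k) (m := k + n) (by omega)
        (tailFourier d (d - (k + n + 1)) ψ)
      rw [← tailFourier_sub] at this
      exact this
  have h2 := h (d - k) (by omega)
  rw [Nat.add_sub_cancel' hk, Nat.sub_self] at h2
  exact h2

/-! ### Separation of the columns -/

/-- The first `k` coordinates. -/
def firstRows (d k : ℕ) : Finset (Fin d) := Finset.univ.filter fun i : Fin d => (i : ℕ) < k

lemma map_sub_kap {d : ℕ} {S : Finset (Fin d)} {v : E d} (hv : ∀ i ∉ S, v i = 0) :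
    (kap S).map (fun x => x - v) = kap S := by
  have hi : ∀ i : Fin d, (if i ∈ S then (volume : Measure ℝ) else Measure.dirac 0).map
      (fun t => t - v i) = if i ∈ S then (volume : Measure ℝ) else Measure.dirac 0 := fun i => by
    split_ifs with h
    · exact (measurePreserving_sub_right volume (v i)).map_eq
    · rw [hv i h]; simp
  have : ∀ i : Fin d, SigmaFinite ((if i ∈ S then (volume : Measure ℝ) else Measure.dirac 0).map
      (fun t => t - v i)) := fun i => by rw [hi]; infer_instance
  have h := Measure.pi_map_pi
    (μ := fun i : Fin d => if i ∈ S then (volume : Measure ℝ) else Measure.dirac 0)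
    (f := fun i t => t - v i) (fun i => by fun_prop)
  simp_rw [hi] at h
  conv_rhs => rw [kap, ← h]
  rw [kap, Measure.map_map (by fun_prop) (measurableEmbedding_toLp d).measurable,
    Measure.map_map (measurableEmbedding_toLp d).measurable (by fun_prop)]
  rfl

lemma map_shear_partPat (d k : ℕ) :
    (Measure.pi fun j => kap (partPat d k d j)).map (shear d) =
      ((kap (firstRows d k)ᶜ).prod (Measure.pi fun _ : Fin (d + 1) => kap (firstRows d k))).map
        (fun p j => p.1 + p.2 j) := by
  set S := firstRows d k with hS
  have h1 := measurePreserving_piFinSuccAbove (α := fun _ : Fin (d + 1) => E d)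
    (fun j => kap (partPat d k d j)) 0
  have h2 := measurePreserving_piFinSuccAbove (α := fun _ : Fin (d + 1) => E d)
    (fun _ => kap S) 0
  have e0 : partPat d k d 0 = Sᶜ ∪ S := by
    rw [Finset.union_comm, Finset.union_compl]; rfl
  have es : ∀ j : Fin d, partPat d k d (Fin.succAbove 0 j) = S := fun j => by
    rw [Fin.succAbove_zero]
    simp [partPat, hS, firstRows]
  simp_rw [es, e0] at h1
  have h3 : MeasurePreserving (fun p : E d × E d => p.1 + p.2) ((kap Sᶜ).prod (kap S))
      (kap (Sᶜ ∪ S)) := ⟨by fun_prop, map_add_kap disjoint_compl_left⟩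
  have h4 : MeasurePreserving
      (fun p : (E d × E d) × (Fin d → E d) => (p.1.1 + p.1.2, fun j => p.2 j - p.1.2))
      (((kap Sᶜ).prod (kap S)).prod (Measure.pi fun _ => kap S))
      ((kap (Sᶜ ∪ S)).prod (Measure.pi fun _ => kap S)) := by
    refine h3.skew_product (g := fun (a : E d × E d) (y : Fin d → E d) => fun j => y j - a.2) ?_ ?_
    · exact measurable_pi_lambda _ fun j => ((measurable_pi_apply j).comp measurable_snd).sub
        (measurable_snd.comp measurable_fst)
    · filter_upwards [(Measure.quasiMeasurePreserving_snd (μ := kap Sᶜ) (ν := kap S)).ae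
        (kap_ae_eq_zero S)] with a ha
      have e := map_sub_kap ha
      have : SigmaFinite ((kap S).map fun x => x - a.2) := by
        rw [e]; infer_instance
      have h := Measure.pi_map_pi (μ := fun _ : Fin d => kap S) (f := fun _ x => x - a.2)
        (hμ := fun _ => this) (fun _ => by fun_prop)
      simp_rw [e] at h
      exact h
  have h5 := (measurePreserving_prodAssoc (kap Sᶜ) (kap S) (Measure.pi fun _ : Fin d => kap S)).symm
  have h6 := h1.symm.comp (h4.comp (h5.comp ((MeasurePreserving.id (kap Sᶜ)).prod h2)))
  rw [← h6.map_eq, Measure.map_map (shear d).continuous.measurable h6.measurable]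
  congr 1
  ext1 p
  ext1 j
  refine Fin.cases rfl (fun j => ?_) j
  rw [Function.comp_apply, shear_succ]
  change p.1 + p.2 0 + (p.2 j.succ - p.2 0) = p.1 + p.2 j.succ
  abel

/-- The integral of `f` over the image under `Q` of the translate by `u` of the span of the first
`k` basis vectors. -/
def planeIntegral {d : ℕ} (k : ℕ) (f : E d → ℂ) (r : Orth d × E d) : ℂ :=
  ∫ y, f (rotL r.1 (r.2 + y)) ∂kap (firstRows d k)

lemma rotX_shear {d : ℕ} (Q : Orth d) (Y : Fin (d + 1) → E d) :
    shear d (rotX Q Y) = rotX Q (shear d Y) := by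
  ext1 j
  refine Fin.cases rfl (fun j => ?_) j
  rw [shear_succ]
  simp only [rotX, shear_succ, map_add]

lemma integral_tensor {d : ℕ} (k : ℕ) (f : Fin (d + 1) → 𝓢(E d, ℂ)) :
    Integrable (fun r => ∏ j, planeIntegral k (f j) r) ((haarO d).prod (kap (firstRows d k)ᶜ)) ∧
    ∫ q, baseChange d (tensor f) (rotX q.1 q.2)
        ∂(haarO d).prod (Measure.pi fun j => kap (partPat d k d j)) =
      ∫ r, ∏ j, planeIntegral k (f j) r ∂(haarO d).prod (kap (firstRows d k)ᶜ) := by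
  set S := firstRows d k with hS
  set φ := tensor f with hφ
  set ν := (Measure.pi fun j => kap (partPat d k d j)).map (shear d) with hν
  have m1 : MeasurePreserving (shear d) (Measure.pi fun j => kap (partPat d k d j)) ν :=
    ⟨(shear d).continuous.measurable, rfl⟩
  have m2 : MeasurePreserving (fun (p : E d × (Fin (d + 1) → E d)) j => p.1 + p.2 j)
      ((kap Sᶜ).prod (Measure.pi fun _ => kap S)) ν :=
    ⟨measurable_pi_lambda _ fun j =>
      measurable_fst.add ((measurable_pi_apply j).comp measurable_snd),
      (map_shear_partPat d k).symm⟩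
  have n1 := (MeasurePreserving.id (haarO d)).prod m1
  have n2 := ((MeasurePreserving.id (haarO d)).prod m2).comp
    (measurePreserving_prodAssoc (haarO d) (kap Sᶜ) (Measure.pi fun _ : Fin (d + 1) => kap S))
  set H : Orth d × (Fin (d + 1) → E d) → ℂ := fun q => φ (rotX q.1 q.2) with hH
  have hHm : Measurable H := (φ.continuous.comp continuous_rotX).measurable
  have hemb : MeasurableEmbedding (Prod.map (id : Orth d → Orth d) (shear d)) :=
    MeasurableEmbedding.id.prodMap (shear d).toHomeomorph.measurableEmbedding
  have e1 : ∀ q : Orth d × (Fin (d + 1) → E d), baseChange d φ (rotX q.1 q.2) =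
      H (Prod.map id (shear d) q) := fun q => by
    rw [baseChange_apply, rotX_shear]; rfl
  have hi1 : Integrable H ((haarO d).prod ν) := by
    rw [← n1.integrable_comp_emb hemb]
    exact (integrable_schwartz_rotX (partPat d k d) (baseChange d φ)).congr
      (Eventually.of_forall e1)
  have hi2 := n2.integrable_comp_of_integrable hi1
  have e2 : ∀ r : Orth d × E d, ∫ y, H (r.1, fun j => r.2 + y j)
      ∂(Measure.pi fun _ : Fin (d + 1) => kap S) = ∏ j, planeIntegral k (f j) r := fun r =>
    integral_fintype_prod_eq_prod (μ := fun _ : Fin (d + 1) => kap S)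
      (fun j (y : E d) => f j (rotL r.1 (r.2 + y)))
  refine ⟨hi2.integral_prod_left.congr (Eventually.of_forall e2), ?_⟩
  simp_rw [e1, ← e2]
  rw [n1.integral_comp hemb, ← n2.map_eq,
    integral_map n2.measurable.aemeasurable hHm.aestronglyMeasurable]
  exact integral_prod _ hi2

/-! ### Coordinate planes and their rotations -/

/-- Extension by zero of vectors with coordinates in `S`. -/
def extL {d : ℕ} (S : Finset (Fin d)) : EuclideanSpace ℝ S →ₗᵢ[ℝ] E d where
  toFun u := WithLp.toLp 2 (extendZero S u.ofLp)
  map_add' u v := by ext i; by_cases h : i ∈ S <;> simp [extendZero, h]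
  map_smul' c u := by ext i; by_cases h : i ∈ S <;> simp [extendZero, h]
  norm_map' u := norm_extendZero S u.ofLp

lemma extL_apply {d : ℕ} (S : Finset (Fin d)) (u : EuclideanSpace ℝ S) (i : Fin d) :
    extL S u i = if h : i ∈ S then u ⟨i, h⟩ else 0 := rfl

lemma map_extL {d : ℕ} (S : Finset (Fin d)) :
    (volume : Measure (EuclideanSpace ℝ S)).map (extL S) = kap S := by
  have hm : Measurable (extendZero S) := by
    refine measurable_pi_lambda _ fun i => ?_
    by_cases h : i ∈ S
    · simp only [extendZero, h, dif_pos]; fun_prop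
    · simp only [extendZero, h, dif_neg, not_false_eq_true]; fun_prop
  rw [kap, ← map_extendZero, Measure.map_map (measurableEmbedding_toLp d).measurable hm,
    ← (PiLp.volume_preserving_toLp S).map_eq,
    Measure.map_map (extL S).continuous.measurable (by fun_prop)]
  rfl

lemma card_firstRows {d k : ℕ} (hk : k ≤ d) : (firstRows d k).card = k := by
  rw [firstRows, Fin.card_filter_val_lt, min_eq_right hk]

lemma finrank_range_extL {d : ℕ} (S : Finset (Fin d)) :
    Module.finrank ℝ (LinearMap.range (extL S).toLinearMap) = S.card := by
  rw [LinearMap.finrank_range_of_inj (extL S).injective, finrank_euclideanSpace,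
    Fintype.card_coe]

lemma range_extL_firstRows {d k : ℕ} (hk : k ≤ d) :
    LinearMap.range (extL (firstRows d k)).toLinearMap = (coordPlane d k hk).space := by
  symm
  refine Submodule.eq_of_le_of_finrank_eq ?_ ?_
  · refine Submodule.span_le.2 ?_
    rintro _ ⟨i, rfl⟩
    have hi : Fin.castLE hk i ∈ firstRows d k := by simp [firstRows]
    refine ⟨EuclideanSpace.single ⟨Fin.castLE hk i, hi⟩ 1, ?_⟩
    ext j
    change extL _ _ j = _
    rw [extL_apply]
    split_ifs with h
    · simp
    · have : j ≠ Fin.castLE hk i := fun e => h (e ▸ hi)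
      simp [this]
  · rw [finrank_range_extL, card_firstRows hk, (coordPlane d k hk).finrank_space]

lemma range_extL_firstRows_compl {d k : ℕ} (hk : k ≤ d) :
    LinearMap.range (extL (firstRows d k)ᶜ).toLinearMap = (coordPlane d k hk).spaceᗮ := by
  refine Submodule.eq_of_le_of_finrank_eq ?_ ?_
  · rw [← range_extL_firstRows hk]
    rintro _ ⟨v, rfl⟩ _ ⟨u, rfl⟩
    change inner ℝ (extL _ u) (extL _ v) = 0
    rw [PiLp.inner_apply]
    refine Finset.sum_eq_zero fun i _ => ?_
    rw [extL_apply, extL_apply]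
    by_cases h : i ∈ firstRows d k <;> simp [h]
  · have h := Submodule.finrank_add_finrank_orthogonal (coordPlane d k hk).space
    rw [(coordPlane d k hk).finrank_space, finrank_euclideanSpace, Fintype.card_fin] at h
    rw [finrank_range_extL, Finset.card_compl, card_firstRows hk, Fintype.card_fin]
    omega

lemma map_subtype_volume_range {F G : Type*} [NormedAddCommGroup F] [InnerProductSpace ℝ F]
    [FiniteDimensional ℝ F] [MeasurableSpace F] [BorelSpace F] [NormedAddCommGroup G]
    [InnerProductSpace ℝ G] [MeasurableSpace G] [BorelSpace G] (J : F →ₗᵢ[ℝ] G)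
    {V : Submodule ℝ G} [FiniteDimensional ℝ V] (hV : LinearMap.range J.toLinearMap = V) :
    (volume : Measure V).map Subtype.val = (volume : Measure F).map J := by
  subst hV
  rw [← J.equivRange.measurePreserving.map_eq,
    Measure.map_map measurable_subtype_coe J.equivRange.continuous.measurable]
  rfl

lemma rot_space {d k : ℕ} (Q : Orth d) (W : Grass d k) :
    (rot Q W).space = W.space.map (rotL Q).toLinearEquiv.toLinearMap := by
  ext x
  change (∃ y ∈ W.space, _ = x) ↔ ∃ y ∈ W.space, rotL Q y = x
  simp only [rotL_apply]

lemma rotL_symm {d : ℕ} (Q : Orth d) (x : E d) : (rotL Q).symm x = rotL Q⁻¹ x := by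
  rw [LinearIsometryEquiv.symm_apply_eq, ← rotL_mul, mul_inv_cancel, rotL_apply]
  simp

lemma range_rotL_extL_compl {d k : ℕ} (hk : k ≤ d) (Q : Orth d) :
    LinearMap.range ((rotL Q).toLinearIsometry.comp (extL (firstRows d k)ᶜ)).toLinearMap =
      (rot Q (coordPlane d k hk)).spaceᗮ := by
  rw [rot_space]
  have h := Submodule.map_orthogonal_equiv (coordPlane d k hk).space (rotL Q)
  rw [← range_extL_firstRows_compl hk, ← LinearMap.range_comp] at h
  exact h

lemma starProjection_rot {d k : ℕ} (Q : Orth d) (W : Grass d k) (x : E d) :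
    (rot Q W).space.starProjection x = rotL Q (W.space.starProjection (rotL Q⁻¹ x)) := by
  rw [← rotL_symm, ← Submodule.starProjection_map_apply (rotL Q) W.space x]
  simp_rw [rot_space]

/-- The image under `Q` of the translate by `u` of the coordinate plane. -/
def rotPlane {d k : ℕ} (hk : k ≤ d) (r : Orth d × E d) : AffGrass d k :=
  translate (rot r.1 (coordPlane d k hk)) (rotL r.1 r.2)

lemma coe_rotPlane {d k : ℕ} (hk : k ≤ d) (r : Orth d × E d) :
    ((rotPlane hk r).space : Set (E d)) =
      range fun v => rotL r.1 (r.2 + extL (firstRows d k) v) := by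
  ext x
  rw [rotPlane, translate, SetLike.mem_coe, AffineSubspace.mem_mk', rot_space,
    ← range_extL_firstRows hk]
  simp only [vsub_eq_sub, Submodule.mem_map, LinearMap.mem_range, mem_range, map_add]
  constructor
  · rintro ⟨_, ⟨v, rfl⟩, h⟩
    exact ⟨v, (sub_eq_iff_eq_add'.1 h.symm).symm⟩
  · rintro ⟨v, rfl⟩
    exact ⟨_, ⟨v, rfl⟩, by simp⟩

lemma planeTransform_rotPlane {d k : ℕ} (hk : k ≤ d) (f : E d → ℂ) (r : Orth d × E d) :
    planeTransform f (rotPlane hk r) = planeIntegral k f r := by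
  have hiso : Isometry fun v => rotL r.1 (r.2 + extL (firstRows d k) v) :=
    (rotL r.1).isometry.comp ((isometry_add_left r.2).comp (extL _).isometry)
  have hvol : (Measure.euclideanHausdorffMeasure k :
      Measure (EuclideanSpace ℝ (firstRows d k))) = volume := by
    rw [← InnerProductSpace.euclideanHausdorffMeasure_eq_volume, finrank_euclideanSpace,
      Fintype.card_coe, card_firstRows hk]
  rw [planeTransform, coe_rotPlane, ← hiso.map_euclideanHausdorffMeasure, hvol,
    hiso.isClosedEmbedding.measurableEmbedding.integral_map, planeIntegral, ← map_extL,
    (extL _).isometry.isClosedEmbedding.measurableEmbedding.integral_map]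

/-! ### The orbit map onto affine planes -/

lemma Grass.starProjection_injective (d k : ℕ) :
    Function.Injective fun W : Grass d k => (W.space.starProjection : E d →L[ℝ] E d) := by
  rintro ⟨V, hV⟩ ⟨W, hW⟩ h
  have : V = W := Submodule.starProjection_inj.1 h
  subst this
  rfl

lemma foot_mem {d k : ℕ} (P : AffGrass d k) : foot P ∈ P.space := by
  have : Nonempty P.space := P.nonempty.to_subtype
  exact SetLike.coe_mem (EuclideanGeometry.orthogonalProjection P.space 0)

lemma AffGrass.embedding_injective (d k : ℕ) : Function.Injective fun P : AffGrass d k =>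
    ((P.space.direction.starProjection : E d →L[ℝ] E d), foot P) := by
  intro P R h
  obtain ⟨h1, h2⟩ := Prod.mk.inj h
  have hd : P.space.direction = R.space.direction := Submodule.starProjection_inj.1 h1
  have hs : P.space = R.space :=
    AffineSubspace.ext_of_direction_eq hd ⟨foot P, foot_mem P, h2 ▸ foot_mem R⟩
  cases P; cases R; cases hs; rfl

instance (d k : ℕ) : T2Space (Grass d k) :=
  (⟨⟨rfl⟩, Grass.starProjection_injective d k⟩ : IsEmbedding _).t2Space

instance (d k : ℕ) : T2Space (AffGrass d k) :=
  (⟨⟨rfl⟩, AffGrass.embedding_injective d k⟩ : IsEmbedding _).t2Space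

instance (d : ℕ) : SecondCountableTopology (E d →L[ℝ] E d) :=
  haveI := FiniteDimensional.proper_real (E d →L[ℝ] E d)
  secondCountable_of_proper

instance (d k : ℕ) : SecondCountableTopology (Grass d k) :=
  TopologicalSpace.secondCountableTopology_induced _ _ _

instance (d k : ℕ) : SecondCountableTopology (AffGrass d k) :=
  TopologicalSpace.secondCountableTopology_induced _ _ _

instance (d : ℕ) : PolishSpace (Orth d) :=
  haveI : PolishSpace (Matrix (Fin d) (Fin d) ℝ) :=
    inferInstanceAs (PolishSpace (Fin d → Fin d → ℝ))
  IsClosed.polishSpace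
    (s := (unitary (Matrix (Fin d) (Fin d) ℝ) : Set (Matrix (Fin d) (Fin d) ℝ))) isClosed_unitary

lemma continuous_rot {d k : ℕ} (W : Grass d k) : Continuous fun Q : Orth d => rot Q W := by
  refine continuous_induced_rng.2 (continuous_clm_apply.2 fun x => ?_)
  simp only [Function.comp_apply, starProjection_rot]
  have h : Continuous fun Q : Orth d => rotL Q⁻¹ x :=
    continuous_rotL.comp (continuous_inv.prodMk continuous_const)
  exact continuous_rotL.comp
    (continuous_id.prodMk (W.space.starProjection.continuous.comp h))

lemma foot_translate {d k : ℕ} (W : Grass d k) (x : E d) :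
    foot (translate W x) = x - W.space.starProjection x := by
  have : Nonempty (translate W x).space := (translate W x).nonempty.to_subtype
  have hd : (translate W x).space.direction = W.space := AffineSubspace.direction_mk' _ _
  have h := EuclideanGeometry.orthogonalProjection_apply_mem (translate W x).space (p := 0)
    (AffineSubspace.self_mem_mk' x W.space)
  rw [Submodule.coe_orthogonalProjectionOnto_apply] at h
  refine h.trans ?_
  simp_rw [hd]
  rw [vsub_eq_sub, zero_sub, map_neg, vadd_eq_add, neg_add_eq_sub]

lemma continuous_rotPlane {d k : ℕ} (hk : k ≤ d) : Continuous (rotPlane (d := d) hk) := by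
  refine continuous_induced_rng.2 (Continuous.prodMk ?_ ?_)
  · have h := (continuous_induced_dom.comp (continuous_rot (coordPlane d k hk))).comp
      (continuous_fst (Y := E d))
    refine h.congr fun r => ?_
    have : (rotPlane hk r).space.direction = (rot r.1 (coordPlane d k hk)).space :=
      AffineSubspace.direction_mk' _ _
    simp only [Function.comp_apply, this]
  · have e : ∀ r : Orth d × E d, rotL r.1 (r.2 - (coordPlane d k hk).space.starProjection r.2) =
        foot (rotPlane hk r) := fun r => by
      rw [rotPlane, foot_translate, starProjection_rot, ← rotL_symm,
        LinearIsometryEquiv.symm_apply_apply, map_sub]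
    refine Continuous.congr ?_ e
    exact continuous_rotL.comp (continuous_fst.prodMk (continuous_snd.sub
      ((coordPlane d k hk).space.starProjection.continuous.comp continuous_snd)))

lemma surjective_rot {d k : ℕ} (W₀ : Grass d k) :
    Function.Surjective fun Q : Orth d => rot Q W₀ := by
  intro W
  have hd : Module.finrank ℝ W₀.space = Module.finrank ℝ W.space :=
    W₀.finrank_space.trans W.finrank_space.symm
  set e : W₀.space ≃ₗᵢ[ℝ] W.space :=
    (stdOrthonormalBasis ℝ W₀.space).equiv (stdOrthonormalBasis ℝ W.space) (finCongr hd)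
  set L := W.space.subtypeₗᵢ.comp e.toLinearIsometry with hL
  obtain ⟨Q, hQ⟩ := exists_rotL (L.extend.toLinearIsometryEquiv rfl)
  refine ⟨Q, Grass.starProjection_injective d k ?_⟩
  have : (rot Q W₀).space = W.space := by
    refine Submodule.eq_of_le_of_finrank_eq ?_
      ((rot Q W₀).finrank_space.trans W.finrank_space.symm)
    rw [rot_space]
    rintro _ ⟨x, hx, rfl⟩
    change rotL Q x ∈ _
    rw [hQ]
    change L.extend x ∈ _
    rw [L.extend_apply ⟨x, hx⟩]
    exact (e ⟨x, hx⟩).2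
  simp_rw [this]

lemma surjective_rotPlane {d k : ℕ} (hk : k ≤ d) :
    Function.Surjective (rotPlane (d := d) hk) := by
  intro P
  obtain ⟨Q, hQ⟩ := surjective_rot (coordPlane d k hk) ⟨P.space.direction, P.finrank_direction⟩
  refine ⟨(Q, (rotL Q).symm (foot P)), ?_⟩
  have hs : (rotPlane hk (Q, (rotL Q).symm (foot P))).space = P.space := by
    simp only [rotPlane, hQ, LinearIsometryEquiv.apply_symm_apply]
    exact AffineSubspace.mk'_eq (foot_mem P)
  generalize rotPlane hk (Q, (rotL Q).symm (foot P)) = R at hs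
  cases P; cases R; cases hs; rfl

lemma measurable_planeTransform {d k : ℕ} (hk : k ≤ d) {f : E d → ℂ} (hf : Continuous f) :
    Measurable fun P : AffGrass d k => planeTransform f P := by
  rw [← (continuous_rotPlane hk).measurable.measurable_comp_iff_of_surjective
    (surjective_rotPlane hk)]
  have : (fun P : AffGrass d k => planeTransform f P) ∘ rotPlane hk = planeIntegral k f :=
    funext fun r => planeTransform_rotPlane hk f r
  rw [this]
  have h : StronglyMeasurable fun p : (Orth d × E d) × E d => f (rotL p.1.1 (p.1.2 + p.2)) :=
    (hf.comp (continuous_rotL.comp (f := fun p : (Orth d × E d) × E d => (p.1.1, p.1.2 + p.2))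
      (by fun_prop))).stronglyMeasurable
  exact h.integral_prod_right.measurable

lemma muM_eq {d k : ℕ} (hk : k ≤ d) : muM d k hk = ENNReal.ofReal (grassMass d k) •
    ((haarO d).prod (kap (firstRows d k)ᶜ)).map (rotPlane hk) := by
  have hm := (continuous_rotPlane (d := d) hk).measurable
  have hr := (continuous_rot (coordPlane d k hk)).measurable
  have hQm : ∀ Q : Orth d, Measurable fun u => rotPlane hk (Q, u) := fun Q =>
    hm.comp measurable_prodMk_left
  set κ : Grass d k → Measure (AffGrass d k) := fun W =>
    (volume : Measure (W.spaceᗮ : Submodule ℝ (E d))).map fun x : (W.spaceᗮ : Submodule ℝ (E d)) =>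
      translate W (x : E d) with hκ
  have hκr : ∀ Q : Orth d, κ (rot Q (coordPlane d k hk)) =
      (kap (firstRows d k)ᶜ).map fun u => rotPlane hk (Q, u) := fun Q => by
    have ht : ∀ x, translate (rot Q (coordPlane d k hk)) x = rotPlane hk (Q, (rotL Q).symm x) :=
      fun x => by simp only [rotPlane, LinearIsometryEquiv.apply_symm_apply]
    have htm : Measurable (translate (rot Q (coordPlane d k hk))) := by
      simp_rw [funext ht]
      exact (hQm Q).comp (rotL Q).symm.continuous.measurable
    have hv := map_subtype_volume_range _ (range_rotL_extL_compl hk Q)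
    calc κ (rot Q (coordPlane d k hk)) = ((volume : Measure
          ((rot Q (coordPlane d k hk)).spaceᗮ : Submodule ℝ (E d))).map Subtype.val).map
          (translate (rot Q (coordPlane d k hk))) :=
        (Measure.map_map htm measurable_subtype_coe).symm
      _ = _ := by
        rw [hv, ← map_extL, Measure.map_map htm (LinearIsometry.continuous _).measurable,
          Measure.map_map (hQm Q) (extL _).continuous.measurable]
        congr 1
  have hκm : Measurable κ := by
    rw [← hr.measurable_comp_iff_of_surjective (surjective_rot (coordPlane d k hk))]
    refine Measure.measurable_of_measurable_coe _ fun A hA => ?_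
    have := measurable_measure_prodMk_left (ν := kap (firstRows d k)ᶜ) (hm hA)
    convert this using 1
    ext Q
    rw [Function.comp_apply, hκr, Measure.map_apply (hQm Q) hA]
    rfl
  ext A hA
  rw [muM, ← hκ, Measure.bind_apply hA hκm.aemeasurable, muG, lintegral_smul_measure,
    lintegral_map (f := fun W => κ W A) ((Measure.measurable_coe hA).comp hκm) hr, Measure.smul_apply,
    Measure.map_apply hm hA, Measure.prod_apply (hm hA)]
  congr 1
  refine lintegral_congr fun Q => ?_
  rw [hκr, Measure.map_apply (hQm Q) hA]
  rfl

lemma integral_prod_planeTransform {d k : ℕ} (hk : k ≤ d) (f : Fin (d + 1) → 𝓢(E d, ℂ)) :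
    Integrable (fun P : AffGrass d k => ∏ i, planeTransform (f i) P) (muM d k hk) ∧
    ∫ P : AffGrass d k, ∏ i, planeTransform (f i) P ∂muM d k hk =
      (grassMass d k : ℂ) * ∫ r, ∏ j, planeIntegral k (f j) r
        ∂(haarO d).prod (kap (firstRows d k)ᶜ) := by
  have hm := (continuous_rotPlane (d := d) hk).measurable
  have hF : Measurable fun P : AffGrass d k => ∏ i, planeTransform (f i) P :=
    Finset.measurable_prod _ fun i _ => measurable_planeTransform hk (f i).continuous
  have hM : 0 ≤ grassMass d k :=
    div_nonneg (Finset.prod_nonneg fun i _ => measureReal_nonneg)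
      (Finset.prod_nonneg fun i _ => measureReal_nonneg)
  rw [muM_eq]
  constructor
  · refine Integrable.smul_measure ?_ ENNReal.ofReal_ne_top
    rw [integrable_map_measure hF.aestronglyMeasurable hm.aemeasurable]
    refine (integral_tensor k f).1.congr (Eventually.of_forall fun r => ?_)
    simp only [Function.comp_apply, planeTransform_rotPlane]
  · rw [integral_smul_measure, integral_map hm.aemeasurable hF.aestronglyMeasurable,
      ENNReal.toReal_ofReal hM, Complex.real_smul]
    simp only [planeTransform_rotPlane]

end Drury

end

/-- Drury's identity, with its constant. -/
theorem mainTheorem9 (d k : ℕ) (hk : 1 ≤ k) (hkd : k < d) :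
    (∃! A : ℂ → 𝓢'(Fin (d + 1) → Drury.E d, ℂ), Drury.IsRhoFamily d A) ∧
    ∀ A : ℂ → 𝓢'(Fin (d + 1) → Drury.E d, ℂ), Drury.IsRhoFamily d A →
      ∀ f : Fin (d + 1) → 𝓢(Drury.E d, ℂ),
        Integrable (fun P : Drury.AffGrass d k => ∏ i, Drury.planeTransform (f i) P)
          (Drury.muM d k hkd.le) ∧
        A k (Drury.tensor f) =
          Drury.constD d k *
            ∫ P : Drury.AffGrass d k, ∏ i, Drury.planeTransform (f i) P
              ∂(Drury.muM d k hkd.le) := by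
  refine ⟨⟨Drury.rhoFamily d, Drury.isRhoFamily_rhoFamily d,
    fun B hB => hB.eq (Drury.isRhoFamily_rhoFamily d)⟩, fun A hA f => ?_⟩
  rw [hA.eq (Drury.isRhoFamily_rhoFamily d), Drury.rhoFamily_natCast hkd.le,
    Drury.integral_tailFourier hkd.le, (Drury.integral_tensor k f).2]
  have h := Drury.integral_prod_planeTransform hkd.le f
  exact ⟨h.1, by rw [h.2, mul_assoc]⟩
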